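/- Let $T>0$. A smooth solution of the cubic NLS is a function $q\in C^\infty((-T,T)\times\mathbb R;\mathbb C)$ with $\partial_t q=i\big(\partial_x^2q+\tfrac12|q|^2q\big)$. Let $q=q_1+iq_2$, with $q\in L^2_{|t|<T}L^2_{x,\mathrm{loc}}$ and $|q|^2\in L^2_{|t|<T}(H^{-1}(\mathbb R))$, be a limit of smooth solutions: there are smooth solutions $q_k$ of the cubic NLS such that $q_k\to q$ in $L^2_{tx,\mathrm{loc}}((-T,T)\times\mathbb R)$ and $|q_k|^2\to|q|^2$ in $L^2_{t,\mathrm{loc}}((-T,T);H^{-1}(\mathbb R))$. Consider maps $u,e:(-T,T)\times\mathbb R\to\mathbb R^3$, with $u,e\in L^2_{|t|<T}(H^1_{\mathrm{loc}})\cap C_{|t|<T}(L^2_{\mathrm{loc}})$ and, for every $t$ and almost every $x$, $|u|=|e|=1$ and $u\perp e$ (so that $\{e,u\times e\}$ is an orthonormal frame of $u^{-1}T\mathbb S^2$), which satisfy the frame system $$\partial_tu=p_1e+p_2\,u\times e,\qquad \partial_xu=q_1e+q_2\,u\times e,\qquad \partial_te+p_1u=-\tfrac12|q|^2\,u\times e,\qquad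 \partial_xe+q_1u=0,$$ $p=p_1+ip_2=i\,\partial_xq$, in the sense of distributions on $(-T,T)\times\mathbb R$; here the products of $p_1=-\partial_xq_2$ and $p_2=\partial_xq_1$ with $L^2H^1_{\mathrm{loc}}$ functions $w$ are defined by $\langle(\partial_xg)w,\varphi\rangle=-\int g\,\partial_x(\varphi w)$. (1) There exists such a pair $(u,e)$ for which, moreover, $u$ is a weak solution of the Schrödinger map equation into $\mathbb S^2$, that is, $\partial_tu=\partial_x(u\times\partial_xu)$ in the sense of distributions on $(-T,T)\times\mathbb R$. (2) It is unique up to isometries of the sphere: if $(u,e)$ and $(\tilde u,\tilde e)$ are two such pairs (for the same $q$), there is an orientation-preserving linear isometry $\rho$ of $\mathbb R^3$ such that, for every $t\in(-T,T)$, $\tilde u(t,x)=\rho\,u(t,x)$ and $\tilde e(t,x)=\rho\,e(t,x)$ for almost every $x$. -/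

import Mathlib

open MeasureTheory Set Filter Topology
open scoped ENNReal ContDiff Distributions Matrix

noncomputable section

/-- Euclidean space `ℝ³`, the ambient space of the sphere `𝕊²`. -/
abbrev E3 : Type := EuclideanSpace ℝ (Fin 3)

/-- The cross product of `ℝ³`. -/
def cross (a b : E3) : E3 := WithLp.toLp 2 (a.ofLp ⨯₃ b.ofLp)

/-- The space-time slab `{(t, x) : |t| < T}`. Points of space-time are written `z = (t, x)`. -/
def slab (T : ℝ) : TopologicalSpace.Opens (ℝ × ℝ) :=
  ⟨Ioo (-T) T ×ˢ univ, isOpen_Ioo.prod isOpen_univ⟩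

section Derivatives

variable {F : Type*} [NormedAddCommGroup F] [NormedSpace ℝ F]

/-- The classical derivative `∂_t w`. -/
def dt (w : ℝ × ℝ → F) (z : ℝ × ℝ) : F := fderiv ℝ w z (1, 0)

/-- The classical derivative `∂_x w`. -/
def dx (w : ℝ × ℝ → F) (z : ℝ × ℝ) : F := fderiv ℝ w z (0, 1)

/-- `w ∈ L²_{|t|<T} L²_{x,loc}`. -/
def MemL2L2loc (T : ℝ) (w : ℝ × ℝ → F) : Prop :=
  ∀ K : Set ℝ, IsCompact K → MemLp w 2 (volume.restrict (Ioo (-T) T ×ˢ K))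

/-- `∂_x w = w'` in the sense of distributions on the slab. -/
def HasWeakDx (T : ℝ) (w w' : ℝ × ℝ → F) : Prop :=
  ∀ φ : 𝓓(slab T, ℝ), ∫ z, φ z • w' z = -∫ z, dx φ z • w z

/-- `w ∈ L²_{|t|<T} H¹_{x,loc}`. -/
def MemL2H1loc (T : ℝ) (w : ℝ × ℝ → F) : Prop :=
  MemL2L2loc T w ∧ ∃ w', MemL2L2loc T w' ∧ HasWeakDx T w w'

/-- `w ∈ C_{|t|<T}(L²_{x,loc})`. -/
def ContL2loc (T : ℝ) (w : ℝ × ℝ → F) : Prop :=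
  ∀ K : Set ℝ, IsCompact K → ∀ t₀ ∈ Ioo (-T) T,
    MemLp (fun x => w (t₀, x)) 2 (volume.restrict K) ∧
    Tendsto (fun t => eLpNorm (fun x => w (t, x) - w (t₀, x)) 2 (volume.restrict K))
      (𝓝 t₀) (𝓝 0)

/-- `D` is the distribution `(∂_x g) w` on the slab, for a real function `g ∈ L²_loc` and
`w ∈ L²_{|t|<T} H¹_{x,loc}`: the product is defined by the duality of `H⁻¹` and `H¹` in `x`, i.e.
`⟨(∂_x g) w, φ⟩ = ⟨∂_x g, φ w⟩ = -∫ g ∂_x (φ w)`, where `∂_x (φ w) = (∂_x φ) w + φ ∂_x w`. -/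
def IsDxMul (T : ℝ) (g : ℝ × ℝ → ℝ) (w : ℝ × ℝ → F) (D : 𝓓(slab T, ℝ) → F) : Prop :=
  ∃ w', MemL2L2loc T w ∧ MemL2L2loc T w' ∧ HasWeakDx T w w' ∧
    ∀ φ : 𝓓(slab T, ℝ), D φ = -∫ z, g z • (dx φ z • w z + φ z • w' z)

end Derivatives

/-- The norm of `H⁻¹(ℝ) = (H¹(ℝ))*` of a real function `g`, as the supremum of `|∫ g φ|` over the
test functions `φ` with `‖φ‖_{H¹} ≤ 1`; it is `∞` when `g` is not in `H⁻¹(ℝ)`. -/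
def hNegOneNorm (g : ℝ → ℝ) : ℝ≥0∞ :=
  ⨆ (φ : 𝓓((⊤ : TopologicalSpace.Opens ℝ), ℝ))
    (_ : ∫ x, (φ x ^ 2 + deriv φ x ^ 2) ≤ 1), ENNReal.ofReal |∫ x, g x * φ x|

/-- The norm of `L²_{|t|<S} H⁻¹_x` of a real function `g` of `(t, x)`. -/
def l2HNegOneNorm (S : ℝ) (g : ℝ × ℝ → ℝ) : ℝ≥0∞ :=
  (∫⁻ t in Ioo (-S) S, hNegOneNorm (fun x => g (t, x)) ^ 2) ^ (1 / 2 : ℝ)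

/-- `q` is a smooth solution for `|t| < T` of the focusing cubic NLS
`∂_t q = i (∂_x² q + ½ |q|² q)`. -/
def IsSmoothNLS (T : ℝ) (q : ℝ × ℝ → ℂ) : Prop :=
  ContDiffOn ℝ ∞ q (slab T) ∧
    ∀ z ∈ slab T, dt q z = Complex.I * (dx (dx q) z + (1 / 2) * (‖q z‖ : ℂ) ^ 2 * q z)

/-- `u ∈ L²(H¹_loc) ∩ C(L²_loc)` is a weak solution for `|t| < T` of the Schrödinger map equation
into `𝕊²`: `|u| = 1` and `∂_t u = ∂_x (u × ∂_x u)` in the sense of distributions. -/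
def IsWeakSchrodingerMap (T : ℝ) (u : ℝ × ℝ → E3) : Prop :=
  MemL2H1loc T u ∧ ContL2loc T u ∧ (∀ t ∈ Ioo (-T) T, ∀ᵐ x : ℝ, ‖u (t, x)‖ = 1) ∧
    ∃ ux, MemL2L2loc T ux ∧ HasWeakDx T u ux ∧
      ∀ φ : 𝓓(slab T, ℝ), -∫ z, dt φ z • u z = -∫ z, dx φ z • cross (u z) (ux z)

/-- The map `u` and the orthonormal frame `{e, u × e}` of `u⁻¹ T𝕊²`, both of class
`L²(H¹_loc) ∩ C(L²_loc)` for `|t| < T`, solve in the sense of distributions the frame system of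
`q = q₁ + i q₂`, in which `p = i ∂_x q`, i.e. `p₁ = -∂_x q₂` and `p₂ = ∂_x q₁`. -/
structure IsFrameSolution (T : ℝ) (q : ℝ × ℝ → ℂ) (u e : ℝ × ℝ → E3) : Prop where
  u_memL2H1loc : MemL2H1loc T u
  u_contL2loc : ContL2loc T u
  e_memL2H1loc : MemL2H1loc T e
  e_contL2loc : ContL2loc T e
  norm_u : ∀ t ∈ Ioo (-T) T, ∀ᵐ x : ℝ, ‖u (t, x)‖ = 1
  norm_e : ∀ t ∈ Ioo (-T) T, ∀ᵐ x : ℝ, ‖e (t, x)‖ = 1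
  orthogonal : ∀ t ∈ Ioo (-T) T, ∀ᵐ x : ℝ, inner ℝ (u (t, x)) (e (t, x)) = 0
  /-- `∂_t u = p₁ e + p₂ u × e`; `P₁`, `P₂` are the distributions `p₁ e` and `p₂ u × e`. -/
  dt_u : ∃ P₁ P₂ : 𝓓(slab T, ℝ) → E3,
    IsDxMul T (fun z => -(q z).im) e P₁ ∧
    IsDxMul T (fun z => (q z).re) (fun z => cross (u z) (e z)) P₂ ∧
    ∀ φ : 𝓓(slab T, ℝ), -∫ z, dt φ z • u z = P₁ φ + P₂ φ
  /-- `∂_x u = q₁ e + q₂ u × e`. -/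
  dx_u : HasWeakDx T u (fun z => (q z).re • e z + (q z).im • cross (u z) (e z))
  /-- `∂_t e + p₁ u = -½ |q|² u × e`; `P` is the distribution `p₁ u`. -/
  dt_e : ∃ P : 𝓓(slab T, ℝ) → E3,
    IsDxMul T (fun z => -(q z).im) u P ∧
    ∀ φ : 𝓓(slab T, ℝ),
      (-∫ z, dt φ z • e z) + P φ =
        ∫ z, φ z • (-(1 / 2) * ‖q z‖ ^ 2 : ℝ) • cross (u z) (e z)
  /-- `∂_x e + q₁ u = 0`. -/
  dx_e : HasWeakDx T e (fun z => -((q z).re • u z))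

end

/-! The guiding principle is that every step may use only `q` itself, in `L²_loc`, and never `∂_x
q`. Write `f = u × e`, `q = q₁ + i q₂`. Since `∂_x e = -q₁ u` and `∂_x f = -q₂ u`, the products with
`p` can be put in divergence form: `p₁ e + p₂ f = -∂_x (q₂ e - q₁ f)`, because the two terms `±q₁ q₂
u` cancel, and the equations of `e` and `f` become similar ones with an additional source that is
quadratic in `q`. So each coordinate of the frame is a bounded function `a` with `∂_x a` in `L²_loc`
and `∂_t a = -∂_x G + H`, where `G` is in `L²_loc` and `H` in `L¹_loc`. This class (`WeakReg`) is
closed under products, with the expected Leibniz rules (`WeakReg.mul`, proved by mollifying one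
factor).

Uniqueness: the system rotates the triple `(u, e, f)` by skew matrices that act on the index of the
frame vector and are the same for every coordinate. Hence for two solutions the sums `u'ᵢ uⱼ + e'ᵢ
eⱼ + f'ᵢ fⱼ` have vanishing derivatives (`FrameReg.inner`), and so are constant
(`WeakReg.exists_const`). They are the entries of a rotation matrix that takes one frame to the
other almost everywhere in space-time, and continuity in time with values in `L²_loc` extends this
to every time.

Existence: for a smooth `q_k` the system is a linear connection on the slab, whose flatness follows
from the NLS together with the derivative of `½|q_k|²`. A flat connection on a convex open set has
parallel sections (`exists_parallel_section`, by transport along rays), which gives smooth frames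
with a prescribed value at one point. To compare the frames of two potentials `q` and `p`, let `m`
be the inner product of corresponding coordinate rows, so that `1 - m` is half their squared
distance. Then `|∂_x m| ≤ 4|q - p|` and `∂_t m = ∂_x B + O(|q - p|(|q| + |p|))` with `|B| ≤ 4|q -
p|` (`IsSmoothRow.dt_inner`). Integration against a spatial cutoff controls the `L²_loc` distance at
every time by quantities that are small when `q - p` is small in `L²_loc`, provided that the two
potentials are also close in `L¹_loc` at the time where the frames are normalised
(`IsSmoothRow.integral_one_sub_inner_le`). Such a time exists along a subsequence
(`exists_good_time`). The frames are then Cauchy in `L²_loc`, locally uniformly in time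
(`frames_cauchy`). In the limit, orthonormality survives pointwise, and the equations survive
because bounded sequences that converge almost everywhere multiply coefficients that converge in
`L¹_loc` (`FrameReg.of_tendsto`). Finally `u × ∂_x u = q₁ f - q₂ e`, so the divergence form of the
equation for `u` is the Schrödinger map equation. -/

noncomputable section

/-! ### Mollification in `Lᵖ`. -/

open scoped Convolution in
/-- Young's inequality for the convolution with a probability density. -/
theorem eLpNorm_normed_convolution_le {E : Type*} [NormedAddCommGroup E] [NormedSpace ℝ E]
    [FiniteDimensional ℝ E] [MeasurableSpace E] [BorelSpace E] {μ : Measure E} [μ.IsAddHaarMeasure]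
    (ρ : ContDiffBump (0 : E)) {p : ℝ} (hp : 1 ≤ p) {g : E → ℝ} (hg : AEStronglyMeasurable g μ) :
    eLpNorm (ρ.normed μ ⋆[ContinuousLinearMap.lsmul ℝ ℝ, μ] g) (ENNReal.ofReal p) μ
      ≤ eLpNorm g (ENNReal.ofReal p) μ := by
  have hp0 : 0 < p := by linarith
  -- A strongly measurable representative makes `(x, t) ↦ g (x - t)` jointly measurable, as
  -- Tonelli's theorem requires below.
  wlog hgm : StronglyMeasurable g generalizing g
  · have h := this (hg.stronglyMeasurable_mk.aestronglyMeasurable) hg.stronglyMeasurable_mk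
    rw [eLpNorm_congr_ae hg.ae_eq_mk,
      convolution_congr _ (ae_eq_refl _) hg.ae_eq_mk]
    exact h
  have hρc : Continuous (ρ.normed μ) := ρ.continuous_normed
  set w : E → ℝ≥0∞ := fun t => ENNReal.ofReal (ρ.normed μ t) with hw
  have hwm : Measurable w := (hρc.measurable).ennreal_ofReal
  have hw1 : ∫⁻ t, w t ∂μ = 1 := by
    rw [← ofReal_integral_eq_lintegral_ofReal ρ.integrable_normed
      (Eventually.of_forall fun t => ρ.nonneg_normed t), ρ.integral_normed, ENNReal.ofReal_one]
  have hprob : IsProbabilityMeasure (μ.withDensity w) := by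
    constructor
    rw [withDensity_apply _ MeasurableSet.univ, Measure.restrict_univ, hw1]
  rw [eLpNorm_eq_lintegral_rpow_enorm_toReal (by simpa using hp0) ENNReal.ofReal_ne_top,
    eLpNorm_eq_lintegral_rpow_enorm_toReal (by simpa using hp0) ENNReal.ofReal_ne_top,
    ENNReal.toReal_ofReal hp0.le]
  gcongr ?_ ^ _
  have hsub : Measurable (fun z : E × E => ‖g (z.1 - z.2)‖ₑ) :=
    (hgm.comp_measurable measurable_sub).enorm
  calc ∫⁻ x, ‖(ρ.normed μ ⋆[ContinuousLinearMap.lsmul ℝ ℝ, μ] g) x‖ₑ ^ p ∂μ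
      ≤ ∫⁻ x, (∫⁻ t, w t * ‖g (x - t)‖ₑ ^ p ∂μ) ∂μ := by
        refine lintegral_mono fun x => ?_
        have hx : Measurable (fun t => ‖g (x - t)‖ₑ) := hsub.comp measurable_prodMk_left
        have h1 : ‖(ρ.normed μ ⋆[ContinuousLinearMap.lsmul ℝ ℝ, μ] g) x‖ₑ
            ≤ ∫⁻ t, ‖g (x - t)‖ₑ ∂(μ.withDensity w) := by
          rw [lintegral_withDensity_eq_lintegral_mul _ hwm hx]
          refine (enorm_integral_le_lintegral_enorm _).trans (lintegral_mono fun t => ?_)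
          simp only [ContinuousLinearMap.lsmul_apply, smul_eq_mul, enorm_mul, Pi.mul_apply, hw]
          rw [Real.enorm_eq_ofReal (ρ.nonneg_normed t)]
        -- Jensen's inequality: for the probability measure with density `w`, the `L¹` norm is at
        -- most the `Lᵖ` norm.
        have h2 := eLpNorm'_le_eLpNorm'_of_exponent_le one_pos hp (μ.withDensity w)
          hx.aestronglyMeasurable
        simp only [eLpNorm', enorm_eq_self, ENNReal.rpow_one, ne_eq, one_ne_zero, not_false_eq_true,
          div_self] at h2
        have h3 := ENNReal.rpow_le_rpow (h1.trans h2) hp0.le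
        rw [← ENNReal.rpow_mul, one_div, inv_mul_cancel₀ hp0.ne', ENNReal.rpow_one,
          lintegral_withDensity_eq_lintegral_mul _ hwm (hx.pow_const p)] at h3
        exact h3
    _ = ∫⁻ t, (∫⁻ x, w t * ‖g (x - t)‖ₑ ^ p ∂μ) ∂μ :=
        lintegral_lintegral_swap
          ((hwm.comp measurable_snd).mul (hsub.pow_const p)).aemeasurable
    _ = ∫⁻ t, w t * (∫⁻ x, ‖g x‖ₑ ^ p ∂μ) ∂μ := by
        refine lintegral_congr fun t => ?_
        have hm : Measurable fun x => ‖g (x - t)‖ₑ ^ p :=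
          (hsub.comp (measurable_prodMk_right (y := t))).pow_const p
        rw [lintegral_const_mul _ hm]
        congr 1
        exact lintegral_sub_right_eq_self (fun x => ‖g x‖ₑ ^ p) t
    _ = ∫⁻ x, ‖g x‖ₑ ^ p ∂μ := by
        rw [lintegral_mul_const _ hwm, hw1, one_mul]

-- Uniform continuity makes the error uniformly small, and for `rOut < 1` the error is supported in
-- the fixed compact set `K`, the closed 1-neighbourhood of the support. Together these bound the
-- `Lᵖ` norm for every exponent.
open scoped Convolution in
theorem ContDiffBump.tendsto_normed_convolution_of_hasCompactSupport {E : Type*}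
    [NormedAddCommGroup E] [NormedSpace ℝ E]
    [FiniteDimensional ℝ E] [MeasurableSpace E] [BorelSpace E] {μ : Measure E} [μ.IsAddHaarMeasure]
    {ρ : ℕ → ContDiffBump (0 : E)} (hρ : Tendsto (fun n => (ρ n).rOut) atTop (𝓝 0))
    (p : ℝ≥0∞) {g : E → ℝ} (hg : Continuous g) (hgc : HasCompactSupport g) :
    Tendsto (fun n => eLpNorm ((ρ n).normed μ ⋆[ContinuousLinearMap.lsmul ℝ ℝ, μ] g - g) p μ)
      atTop (𝓝 0) := by
  set K := Metric.cthickening 1 (tsupport g) with hK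
  have hKc : IsCompact K := hgc.isCompact.cthickening
  have hKf : μ K ^ p.toReal⁻¹ ≠ ⊤ :=
    ENNReal.rpow_ne_top_of_nonneg (inv_nonneg.2 ENNReal.toReal_nonneg) hKc.measure_lt_top.ne
  rw [ENNReal.tendsto_nhds_zero]
  intro ε hε
  obtain ⟨η, hη, hηε⟩ : ∃ η : ℝ, 0 < η ∧ μ K ^ p.toReal⁻¹ * ENNReal.ofReal η ≤ ε := by
    have : Tendsto (fun η : ℝ => μ K ^ p.toReal⁻¹ * ENNReal.ofReal η) (𝓝[>] 0) (𝓝 0) := by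
      have h0 : Tendsto (fun η : ℝ => ENNReal.ofReal η) (𝓝[>] 0) (𝓝 0) := by
        have := (ENNReal.continuous_ofReal.tendsto (0 : ℝ)).mono_left
          (nhdsWithin_le_nhds (s := Ioi 0))
        simpa using this
      simpa using ENNReal.Tendsto.const_mul h0 (Or.inr hKf)
    obtain ⟨η, h1, h2⟩ := ((this.eventually (ge_mem_nhds hε)).and self_mem_nhdsWithin).exists
    exact ⟨η, h2, h1⟩
  obtain ⟨δ, hδ, hgδ⟩ := Metric.uniformContinuous_iff.1
    (hgc.uniformContinuous_of_continuous hg) η hη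
  filter_upwards [hρ.eventually (gt_mem_nhds (lt_min hδ one_pos))] with n hn
  refine le_trans ?_ hηε
  rw [← eLpNorm_restrict_eq_of_support_subset (s := K)]
  · refine (eLpNorm_le_of_ae_bound (C := η) (Eventually.of_forall fun x => ?_)).trans ?_
    · rw [Pi.sub_apply, ← dist_eq_norm]
      refine ContDiffBump.dist_normed_convolution_le hg.aestronglyMeasurable fun y hy => ?_
      exact (hgδ ((Metric.mem_ball.1 hy).trans (hn.trans_le (min_le_left _ _)))).le
    · simp
  · intro x hx
    by_contra hxK
    apply hx
    have h0 : ∀ y ∈ Metric.ball x 1, g y = 0 := by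
      intro y hy
      by_contra hgy
      apply hxK
      exact Metric.mem_cthickening_of_dist_le x y 1 _ (subset_tsupport _ hgy)
        (by rw [dist_comm]; exact (Metric.mem_ball.1 hy).le)
    have hgx : g x = 0 := h0 x (Metric.mem_ball_self one_pos)
    rw [Pi.sub_apply, ContDiffBump.normed_convolution_eq_right, sub_self]
    intro y hy
    rw [hgx]
    exact h0 y (Metric.ball_subset_ball (hn.le.trans (min_le_right _ _)) hy)

open scoped Convolution in
/-- Mollifications converge in `Lᵖ` for `1 ≤ p < ∞`. -/
theorem ContDiffBump.tendsto_eLpNorm_normed_convolution_sub {E : Type*}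
    [NormedAddCommGroup E] [NormedSpace ℝ E]
    [FiniteDimensional ℝ E] [MeasurableSpace E] [BorelSpace E] {μ : Measure E} [μ.IsAddHaarMeasure]
    {ρ : ℕ → ContDiffBump (0 : E)} (hρ : Tendsto (fun n => (ρ n).rOut) atTop (𝓝 0))
    {p : ℝ} (hp : 1 ≤ p) {g : E → ℝ} (hg : MemLp g (ENNReal.ofReal p) μ) :
    Tendsto (fun n => eLpNorm ((ρ n).normed μ ⋆[ContinuousLinearMap.lsmul ℝ ℝ, μ] g - g)
      (ENNReal.ofReal p) μ) atTop (𝓝 0) := by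
  have hp1 : 1 ≤ ENNReal.ofReal p := by simpa using hp
  rw [ENNReal.tendsto_nhds_zero]
  intro ε hε
  have hε3 : ε / 3 ≠ 0 := (ENNReal.div_pos hε.ne' (by norm_num)).ne'
  obtain ⟨c, hcc, hgc, hc, hcp⟩ :=
    hg.exists_hasCompactSupport_eLpNorm_sub_le ENNReal.ofReal_ne_top hε3
  have h := ContDiffBump.tendsto_normed_convolution_of_hasCompactSupport (μ := μ) hρ
    (ENNReal.ofReal p) hc hcc
  rw [ENNReal.tendsto_nhds_zero] at h
  filter_upwards [h (ε / 3) (pos_iff_ne_zero.2 hε3)] with n hn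
  set L := ContinuousLinearMap.lsmul ℝ ℝ (E := ℝ) with hL
  have hgl : LocallyIntegrable g μ := hg.locallyIntegrable hp1
  have hcl : LocallyIntegrable c μ := hcp.locallyIntegrable hp1
  have ex : ∀ {h : E → ℝ}, LocallyIntegrable h μ → ConvolutionExists ((ρ n).normed μ) h L μ :=
    fun hh => (ρ n).hasCompactSupport_normed.convolutionExists_left L (ρ n).continuous_normed hh
  have cont : ∀ {h : E → ℝ}, LocallyIntegrable h μ → Continuous ((ρ n).normed μ ⋆[L, μ] h) :=
    fun hh => (ρ n).hasCompactSupport_normed.continuous_convolution_left L (ρ n).continuous_normed hh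
  have hsplit : (ρ n).normed μ ⋆[L, μ] g - g = ((ρ n).normed μ ⋆[L, μ] (g - c)) +
      (((ρ n).normed μ ⋆[L, μ] c - c) - (g - c)) := by
    have : (ρ n).normed μ ⋆[L, μ] g = ((ρ n).normed μ ⋆[L, μ] (g - c)) +
        ((ρ n).normed μ ⋆[L, μ] c) := by
      rw [← ConvolutionExists.distrib_add (ex (hgl.sub hcl)) (ex hcl), sub_add_cancel]
    rw [this]; abel
  have m1 : AEStronglyMeasurable ((ρ n).normed μ ⋆[L, μ] (g - c)) μ :=
    (cont (hgl.sub hcl)).aestronglyMeasurable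
  have m2 : AEStronglyMeasurable ((ρ n).normed μ ⋆[L, μ] c - c) μ :=
    ((cont hcl).sub hc).aestronglyMeasurable
  have m3 := hg.aestronglyMeasurable.sub hc.aestronglyMeasurable (μ := μ)
  rw [hsplit]
  calc _ ≤ ε / 3 + (ε / 3 + ε / 3) := by
        refine (eLpNorm_add_le m1 (m2.sub m3) hp1).trans (add_le_add ?_ ?_)
        · exact (eLpNorm_normed_convolution_le _ hp m3).trans hgc
        · exact (eLpNorm_sub_le m2 m3 hp1).trans (add_le_add hn hgc)
    _ = ε := by rw [← add_assoc]; exact ENNReal.add_thirds ε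

/-! ### Local spaces, test functions and mollification on the slab. -/

/-- `f ∈ Lᵖ(K)` for all compact subsets `K` of the slab. -/
def LocMemLp (T : ℝ) (p : ℝ≥0∞) (f : ℝ × ℝ → ℝ) : Prop :=
  ∀ K : Set (ℝ × ℝ), IsCompact K → K ⊆ slab T → MemLp f p (volume.restrict K)

/-- The mollification of `f`, truncated to `K`. -/
def mollify (ρ : ContDiffBump (0 : ℝ × ℝ)) (K : Set (ℝ × ℝ)) (f : ℝ × ℝ → ℝ) : ℝ × ℝ → ℝ :=
  convolution (ρ.normed volume) (K.indicator f) (ContinuousLinearMap.lsmul ℝ ℝ) volume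

/-- The product of a test function and a smooth function. -/
def testMul {T : ℝ} (φ : 𝓓(slab T, ℝ)) (g : ℝ × ℝ → ℝ) (hg : ContDiff ℝ ∞ g) : 𝓓(slab T, ℝ) where
  toFun := fun z => φ z * g z
  contDiff' := φ.contDiff.mul hg
  hasCompactSupport' := φ.hasCompactSupport.mul_right
  tsupport_subset' := (tsupport_mul_subset_left).trans φ.tsupport_subset

theorem testMul_apply {T : ℝ} (φ : 𝓓(slab T, ℝ)) (g : ℝ × ℝ → ℝ) (hg : ContDiff ℝ ∞ g)
    (z : ℝ × ℝ) : testMul φ g hg z = φ z * g z := rfl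

theorem dx_mul {f g : ℝ × ℝ → ℝ} {z : ℝ × ℝ} (hf : DifferentiableAt ℝ f z)
    (hg : DifferentiableAt ℝ g z) : dx (fun z => f z * g z) z = dx f z * g z + f z * dx g z := by
  have := fderiv_fun_mul hf hg
  simp only [dx, this, _root_.add_apply, _root_.smul_apply, smul_eq_mul]
  ring

theorem dt_mul {f g : ℝ × ℝ → ℝ} {z : ℝ × ℝ} (hf : DifferentiableAt ℝ f z)
    (hg : DifferentiableAt ℝ g z) : dt (fun z => f z * g z) z = dt f z * g z + f z * dt g z := by
  have := fderiv_fun_mul hf hg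
  simp only [dt, this, _root_.add_apply, _root_.smul_apply, smul_eq_mul]
  ring

theorem TestFunction.differentiable {T : ℝ} (φ : 𝓓(slab T, ℝ)) : Differentiable ℝ φ :=
  φ.contDiff.differentiable (by simp)

theorem dx_testMul {T : ℝ} (φ : 𝓓(slab T, ℝ)) (g : ℝ × ℝ → ℝ) (hg : ContDiff ℝ ∞ g)
    (z : ℝ × ℝ) : dx (testMul φ g hg) z = dx φ z * g z + φ z * dx g z :=
  dx_mul (φ.differentiable z) (hg.differentiable (by simp) z)

theorem dt_testMul {T : ℝ} (φ : 𝓓(slab T, ℝ)) (g : ℝ × ℝ → ℝ) (hg : ContDiff ℝ ∞ g)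
    (z : ℝ × ℝ) : dt (testMul φ g hg) z = dt φ z * g z + φ z * dt g z :=
  dt_mul (φ.differentiable z) (hg.differentiable (by simp) z)

theorem continuous_dx {f : ℝ × ℝ → ℝ} (hf : ContDiff ℝ ∞ f) : Continuous (dx f) :=
  (hf.continuous_fderiv (by simp)).clm_apply continuous_const

theorem continuous_dt {f : ℝ × ℝ → ℝ} (hf : ContDiff ℝ ∞ f) : Continuous (dt f) :=
  (hf.continuous_fderiv (by simp)).clm_apply continuous_const

theorem dx_eq_zero {f : ℝ × ℝ → ℝ} {z : ℝ × ℝ} (hz : z ∉ tsupport f) : dx f z = 0 := by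
  have := image_eq_zero_of_notMem_tsupport (fun h => hz (tsupport_fderiv_subset ℝ h))
  simp [dx, this]

theorem dt_eq_zero {f : ℝ × ℝ → ℝ} {z : ℝ × ℝ} (hz : z ∉ tsupport f) : dt f z = 0 := by
  have := image_eq_zero_of_notMem_tsupport (fun h => hz (tsupport_fderiv_subset ℝ h))
  simp [dt, this]

/-- A continuous function times an `Lᵖ(K)` function, vanishing off `K`, is in `Lᵖ`. -/
theorem memLp_mul_of_eq_zero_off {K : Set (ℝ × ℝ)} (hK : IsCompact K) {p : ℝ≥0∞}
    {ψ f : ℝ × ℝ → ℝ} (hψ : Continuous ψ) (h0 : ∀ z ∉ K, ψ z = 0)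
    (hf : MemLp f p (volume.restrict K)) : MemLp (fun z => ψ z * f z) p volume := by
  have h1 : (fun z => ψ z * f z) = K.indicator (fun z => ψ z * f z) := by
    ext z
    by_cases hz : z ∈ K
    · simp [hz]
    · simp [hz, h0 z hz]
  rw [h1, memLp_indicator_iff_restrict hK.measurableSet]
  obtain ⟨C, hC⟩ := hK.exists_bound_of_continuousOn hψ.continuousOn
  refine MemLp.of_le_mul (c := C) hf
    ((hψ.aestronglyMeasurable).mul hf.aestronglyMeasurable) ?_
  filter_upwards [ae_restrict_mem hK.measurableSet] with z hz
  rw [norm_mul]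
  exact mul_le_mul_of_nonneg_right (hC z hz) (norm_nonneg _)

theorem integrable_mul_of_eq_zero_off {K : Set (ℝ × ℝ)} (hK : IsCompact K)
    {ψ f : ℝ × ℝ → ℝ} (hψ : Continuous ψ) (h0 : ∀ z ∉ K, ψ z = 0)
    (hf : IntegrableOn f K) : Integrable (fun z => ψ z * f z) :=
  memLp_one_iff_integrable.1
    (memLp_mul_of_eq_zero_off hK hψ h0 (memLp_one_iff_integrable.2 hf))

section Mollify

variable {ρ : ContDiffBump (0 : ℝ × ℝ)} {K : Set (ℝ × ℝ)} {f : ℝ × ℝ → ℝ}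

theorem contDiff_mollify (hK : IsCompact K) (hf : IntegrableOn f K) :
    ContDiff ℝ ∞ (mollify ρ K f) :=
  ρ.hasCompactSupport_normed.contDiff_convolution_left _ ρ.contDiff_normed
    (hf.integrable_indicator hK.measurableSet).locallyIntegrable

/-- The test function `y ↦ ρ(z - y)`. -/
def bumpAt {T : ℝ} (ρ : ContDiffBump (0 : ℝ × ℝ)) (z : ℝ × ℝ)
    (hz : Metric.closedBall z ρ.rOut ⊆ slab T) : 𝓓(slab T, ℝ) where
  toFun := fun y => ρ.normed volume (z - y)
  contDiff' := ρ.contDiff_normed.comp (contDiff_const.sub contDiff_id)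
  hasCompactSupport' := HasCompactSupport.intro (isCompact_closedBall z ρ.rOut) fun y hy => by
    have : z - y ∉ Function.support (ρ.normed volume) := by
      rw [ρ.support_normed_eq]
      simp only [Metric.mem_closedBall, not_le, Metric.mem_ball, dist_zero_right] at hy ⊢
      rw [not_lt, ← dist_eq_norm, dist_comm]; exact hy.le
    simpa using this
  tsupport_subset' := by
    refine (closure_minimal ?_ Metric.isClosed_closedBall).trans hz
    intro y hy
    have : z - y ∈ Function.support (ρ.normed volume) := hy
    rw [ρ.support_normed_eq] at this
    simp only [Metric.mem_closedBall, Metric.mem_ball, dist_zero_right] at this ⊢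
    rw [← dist_eq_norm, dist_comm] at this; exact this.le

theorem bumpAt_eq_zero {T : ℝ} {z : ℝ × ℝ}
    (hz : Metric.closedBall z ρ.rOut ⊆ slab T) {y : ℝ × ℝ} (hy : y ∉ Metric.closedBall z ρ.rOut) :
    bumpAt ρ z hz y = 0 := by
  have : z - y ∉ Function.support (ρ.normed volume) := by
    rw [ρ.support_normed_eq]
    simp only [Metric.mem_closedBall, not_le, Metric.mem_ball, dist_zero_right] at hy ⊢
    rw [not_lt, ← dist_eq_norm, dist_comm]; exact hy.le
  exact Function.notMem_support.1 this

theorem fderiv_bumpAt {T : ℝ} {z : ℝ × ℝ}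
    (hz : Metric.closedBall z ρ.rOut ⊆ slab T) (y : ℝ × ℝ) :
    fderiv ℝ (bumpAt ρ z hz) y = -fderiv ℝ (ρ.normed volume) (z - y) := by
  have h : HasFDerivAt (ρ.normed volume) (fderiv ℝ (ρ.normed volume) (z - y)) (z - y) :=
    ((ρ.contDiff_normed (n := 1)).differentiable (by simp) _).hasFDerivAt
  have h2 := h.comp y ((hasFDerivAt_id y).const_sub z)
  refine h2.fderiv.trans ?_
  ext <;> simp

theorem fderiv_bumpAt_eq_zero {T : ℝ} {z : ℝ × ℝ}
    (hz : Metric.closedBall z ρ.rOut ⊆ slab T) {y : ℝ × ℝ} (hy : y ∉ Metric.closedBall z ρ.rOut) :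
    fderiv ℝ (bumpAt ρ z hz) y = 0 := by
  refine image_eq_zero_of_notMem_tsupport (fun h => hy ?_)
  refine closure_minimal ?_ Metric.isClosed_closedBall (tsupport_fderiv_subset ℝ h)
  intro x hx
  by_contra hxb
  exact hx (bumpAt_eq_zero hz hxb)

/-- When the ball of radius `rOut` lies in `K` the truncation is invisible, and the mollification is
the pairing with an admissible test function. This is how the weak equations get applied to
mollifications. -/
theorem mollify_eq_integral_bumpAt {T : ℝ} {z : ℝ × ℝ}
    (hz : Metric.closedBall z ρ.rOut ⊆ slab T) (hzK : Metric.closedBall z ρ.rOut ⊆ K) :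
    mollify ρ K f z = ∫ y, bumpAt ρ z hz y * f y := by
  rw [mollify, convolution_eq_swap]
  refine integral_congr_ae (Eventually.of_forall fun y => ?_)
  simp only [ContinuousLinearMap.lsmul_apply, smul_eq_mul]
  by_cases hy : y ∈ Metric.closedBall z ρ.rOut
  · rw [indicator_of_mem (hzK hy)]; rfl
  · rw [bumpAt_eq_zero hz hy, show ρ.normed volume (z - y) = 0 from bumpAt_eq_zero hz hy,
      zero_mul, zero_mul]

/-- The derivative falls on the kernel; the minus sign comes from the test function being `ρ (z -
y)` as a function of `y`, and matches the sign in the definition of a distributional derivative. -/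
theorem fderiv_mollify_eq_integral_bumpAt {T : ℝ} {z : ℝ × ℝ} (hK : IsCompact K)
    (hf : IntegrableOn f K)
    (hz : Metric.closedBall z ρ.rOut ⊆ slab T) (hzK : Metric.closedBall z ρ.rOut ⊆ K)
    (v : ℝ × ℝ) :
    fderiv ℝ (mollify ρ K f) z v = -∫ y, fderiv ℝ (bumpAt ρ z hz) y v * f y := by
  have hfl : LocallyIntegrable (K.indicator f) :=
    (hf.integrable_indicator hK.measurableSet).locallyIntegrable
  have h := (ρ.hasCompactSupport_normed (μ := volume)).hasFDerivAt_convolution_left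
    (μ := volume) (ContinuousLinearMap.lsmul ℝ ℝ) ρ.contDiff_normed hfl z
  have hint : Integrable (fun y => ((ContinuousLinearMap.lsmul ℝ ℝ).precompL (ℝ × ℝ)
      (fderiv ℝ (ρ.normed volume) (z - y))) (K.indicator f y)) volume := by
    have := (((ρ.hasCompactSupport_normed (μ := volume)).fderiv (𝕜 := ℝ)).convolutionExists_left
      ((ContinuousLinearMap.lsmul ℝ ℝ).precompL (ℝ × ℝ))
      ((ρ.contDiff_normed (n := 1)).continuous_fderiv (by simp)) hfl z)
    exact this.integrable_swap
  rw [mollify, h.fderiv, convolution_eq_swap, ContinuousLinearMap.integral_apply hint,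
    ← integral_neg]
  refine integral_congr_ae (Eventually.of_forall fun y => ?_)
  simp only [ContinuousLinearMap.precompL_apply, ContinuousLinearMap.lsmul_apply, smul_eq_mul]
  by_cases hy : y ∈ Metric.closedBall z ρ.rOut
  · rw [indicator_of_mem (hzK hy), fderiv_bumpAt]
    simp
  · have h0 := fderiv_bumpAt_eq_zero hz hy
    have h1 := fderiv_bumpAt hz y
    rw [h0] at h1
    rw [h0, neg_eq_zero.1 h1.symm]
    simp

theorem abs_mollify_le {C : ℝ} (hC : 0 ≤ C) (hK : MeasurableSet K)
    (hf : ∀ᵐ z ∂volume.restrict K, |f z| ≤ C) (z : ℝ × ℝ) : |mollify ρ K f z| ≤ C := by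
  have hind : ∀ᵐ y, |K.indicator f y| ≤ C := by
    rw [ae_restrict_iff' hK] at hf
    filter_upwards [hf] with y hy
    by_cases hyK : y ∈ K
    · rw [indicator_of_mem hyK]; exact hy hyK
    · rw [indicator_of_notMem hyK]; simpa using hC
  have hind' : ∀ᵐ t, |K.indicator f (z - t)| ≤ C :=
    (quasiMeasurePreserving_sub_left volume z).ae hind
  rw [mollify, convolution, ← Real.norm_eq_abs]
  calc _ ≤ ∫ t, ρ.normed volume t * C := by
        refine norm_integral_le_of_norm_le (ρ.integrable_normed.mul_const C) ?_
        filter_upwards [hind'] with t ht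
        simp only [ContinuousLinearMap.lsmul_apply, smul_eq_mul, norm_mul, Real.norm_eq_abs]
        rw [abs_of_nonneg (ρ.nonneg_normed t)]
        exact mul_le_mul_of_nonneg_left ht (ρ.nonneg_normed t)
    _ = C := by rw [integral_mul_const, ρ.integral_normed, one_mul]

end Mollify

section MollifyLimit

variable {ρ : ℕ → ContDiffBump (0 : ℝ × ℝ)} {K K' : Set (ℝ × ℝ)}

theorem ae_tendsto_mollify (hρ : Tendsto (fun n => (ρ n).rOut) atTop (𝓝 0))
    (hρ' : ∀ n, (ρ n).rOut ≤ 2 * (ρ n).rIn) (hK' : IsCompact K')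
    {f : ℝ × ℝ → ℝ} (hf : IntegrableOn f K') :
    ∀ᵐ z, z ∈ K' → Tendsto (fun n => mollify (ρ n) K' f z) atTop (𝓝 (f z)) := by
  have := ContDiffBump.ae_convolution_tendsto_right_of_locallyIntegrable (μ := volume) (φ := ρ)
    (K := 2) hρ (Eventually.of_forall hρ')
    (hf.integrable_indicator hK'.measurableSet).locallyIntegrable
  filter_upwards [this] with z hz hzK
  rw [indicator_of_mem hzK] at hz
  exact hz

/-- Dominated convergence: it serves the case where `k` is merely integrable, so that Hölder duality
with norm convergence of the mollifications of `b` (which fails in `L^∞`) is not available. -/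
theorem tendsto_integral_mul_mollify_of_bdd (hρ : Tendsto (fun n => (ρ n).rOut) atTop (𝓝 0))
    (hρ' : ∀ n, (ρ n).rOut ≤ 2 * (ρ n).rIn) (hK' : IsCompact K') (hKK' : K ⊆ K')
    {k b : ℝ × ℝ → ℝ} (hk : Integrable k) (hk0 : ∀ z ∉ K, k z = 0) (hb : IntegrableOn b K')
    {C : ℝ} (hC : 0 ≤ C) (hbC : ∀ᵐ z ∂volume.restrict K', |b z| ≤ C) :
    Tendsto (fun n => ∫ z, k z * mollify (ρ n) K' b z) atTop (𝓝 (∫ z, k z * b z)) := by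
  refine tendsto_integral_of_dominated_convergence (fun z => ‖k z‖ * C) (fun n => ?_)
    (hk.norm.mul_const C) (fun n => ?_) ?_
  · exact hk.aestronglyMeasurable.mul (contDiff_mollify hK' hb).continuous.aestronglyMeasurable
  · refine Eventually.of_forall fun z => ?_
    rw [norm_mul]
    exact mul_le_mul_of_nonneg_left (abs_mollify_le hC hK'.measurableSet hbC z) (norm_nonneg _)
  · filter_upwards [ae_tendsto_mollify hρ hρ' hK' hb] with z hz
    by_cases hzK : z ∈ K
    · exact (hz (hKK' hzK)).const_mul _
    · simp [hk0 z hzK]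

/-- Hölder's inequality and the `Lᵖ` convergence of mollifications. It is used with the exponents
`(2, 2)` and `(∞, 1)`. -/
theorem tendsto_integral_mul_mollify (hρ : Tendsto (fun n => (ρ n).rOut) atTop (𝓝 0))
    (hK' : IsCompact K') (hKK' : K ⊆ K') {p : ℝ} {q : ℝ≥0∞} (hp : 1 ≤ p)
    [ENNReal.HolderTriple q (ENNReal.ofReal p) 1]
    {k g : ℝ × ℝ → ℝ} (hk : MemLp k q volume) (hk0 : ∀ z ∉ K, k z = 0)
    (hg : MemLp g (ENNReal.ofReal p) (volume.restrict K')) :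
    Tendsto (fun n => ∫ z, k z * mollify (ρ n) K' g z) atTop (𝓝 (∫ z, k z * g z)) := by
  have hp1 : 1 ≤ ENNReal.ofReal p := by simpa using hp
  have hgi : MemLp (K'.indicator g) (ENNReal.ofReal p) volume :=
    (memLp_indicator_iff_restrict hK'.measurableSet).2 hg
  have hgl := hgi.locallyIntegrable hp1
  have h1 := ContDiffBump.tendsto_eLpNorm_normed_convolution_sub hρ hp hgi
  have hcont : ∀ n, Continuous (mollify (ρ n) K' g) := fun n =>
    (ρ n).hasCompactSupport_normed.continuous_convolution_left _ (ρ n).continuous_normed hgl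
  have hlim : ∫ z, k z * g z = ∫ z, k z * K'.indicator g z := by
    refine integral_congr_ae (Eventually.of_forall fun z => ?_)
    by_cases hzK : z ∈ K
    · simp [hKK' hzK]
    · simp [hk0 z hzK]
  rw [hlim]
  have hm : ∀ n, MemLp (mollify (ρ n) K' g) (ENNReal.ofReal p) volume := fun n =>
    ⟨(hcont n).aestronglyMeasurable, (eLpNorm_normed_convolution_le (ρ n) hp
      hgi.aestronglyMeasurable).trans_lt hgi.2⟩
  refine tendsto_integral_of_L1 _ (hk.aestronglyMeasurable.mul hgi.aestronglyMeasurable)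
    (Eventually.of_forall fun n => hk.integrable_mul (hm n)) ?_
  have h2 : Tendsto (fun n => eLpNorm k q volume *
      eLpNorm (mollify (ρ n) K' g - K'.indicator g) (ENNReal.ofReal p) volume) atTop (𝓝 0) := by
    have := ENNReal.Tendsto.const_mul h1 (Or.inr hk.2.ne)
    rwa [mul_zero] at this
  refine tendsto_of_tendsto_of_tendsto_of_le_of_le tendsto_const_nhds h2 (fun n => zero_le)
    (fun n => ?_)
  have h3 := eLpNorm_smul_le_mul_eLpNorm (p := q) (q := ENNReal.ofReal p) (r := 1) (μ := volume)
    (f := mollify (ρ n) K' g - K'.indicator g) (φ := k)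
    ((hcont n).aestronglyMeasurable.sub hgi.aestronglyMeasurable) hk.aestronglyMeasurable
  rw [eLpNorm_one_eq_lintegral_enorm] at h3
  refine le_trans (le_of_eq ?_) h3
  refine lintegral_congr fun z => ?_
  simp [mul_sub]

end MollifyLimit

/-! ### Weakly regular functions and their product rule. -/

/-- `a` is a bounded function on the slab with `∂_x a = a'` and `∂_t a = -∂_x G + H` in the sense of
distributions, for `a', G ∈ L²_loc` and `H ∈ L¹_loc`. -/
structure WeakReg (T : ℝ) (a a' G H : ℝ × ℝ → ℝ) : Prop where
  meas : AEStronglyMeasurable a (volume.restrict (slab T))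
  bdd : ∃ C, 0 ≤ C ∧ ∀ᵐ z ∂volume.restrict (slab T : Set (ℝ × ℝ)), |a z| ≤ C
  memLp_dx : LocMemLp T 2 a'
  memLp_G : LocMemLp T 2 G
  memLp_H : LocMemLp T 1 H
  wdx : ∀ φ : 𝓓(slab T, ℝ), ∫ z, φ z * a' z = -∫ z, dx φ z * a z
  wdt : ∀ φ : 𝓓(slab T, ℝ), -∫ z, dt φ z * a z = ∫ z, (dx φ z * G z + φ z * H z)

theorem LocMemLp.mono_exponent {T : ℝ} {p q : ℝ≥0∞} {f : ℝ × ℝ → ℝ} (hf : LocMemLp T q f)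
    (hpq : p ≤ q) : LocMemLp T p f := fun K hK hKT => by
  have : IsFiniteMeasure (volume.restrict K) := ⟨by simpa using hK.measure_lt_top⟩
  exact (hf K hK hKT).mono_exponent hpq

theorem LocMemLp.integrableOn {T : ℝ} {f : ℝ × ℝ → ℝ} (hf : LocMemLp T 1 f) {K : Set (ℝ × ℝ)}
    (hK : IsCompact K) (hKT : K ⊆ slab T) : IntegrableOn f K :=
  memLp_one_iff_integrable.1 (hf K hK hKT)

theorem LocMemLp.add {T : ℝ} {p : ℝ≥0∞} {f g : ℝ × ℝ → ℝ} (hf : LocMemLp T p f)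
    (hg : LocMemLp T p g) : LocMemLp T p (fun z => f z + g z) :=
  fun K hK hKT => (hf K hK hKT).add (hg K hK hKT)

theorem LocMemLp.neg {T : ℝ} {p : ℝ≥0∞} {f : ℝ × ℝ → ℝ} (hf : LocMemLp T p f) :
    LocMemLp T p (fun z => -f z) :=
  fun K hK hKT => (hf K hK hKT).neg

theorem LocMemLp.mul {T : ℝ} {f g : ℝ × ℝ → ℝ} (hf : LocMemLp T 2 f)
    (hg : LocMemLp T 2 g) : LocMemLp T 1 (fun z => f z * g z) :=
  fun K hK hKT => by
    have := (hf K hK hKT).integrable_mul (hg K hK hKT)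
    exact memLp_one_iff_integrable.2 this

theorem LocMemLp.mul_bdd {T : ℝ} {p : ℝ≥0∞} {f a : ℝ × ℝ → ℝ} (hf : LocMemLp T p f)
    (ha : AEStronglyMeasurable a (volume.restrict (slab T : Set (ℝ × ℝ))))
    (hb : ∃ C, 0 ≤ C ∧ ∀ᵐ z ∂volume.restrict (slab T : Set (ℝ × ℝ)), |a z| ≤ C) :
    LocMemLp T p (fun z => f z * a z) := fun K hK hKT => by
  obtain ⟨C, -, hC⟩ := hb
  refine MemLp.of_le_mul (c := C) (hf K hK hKT)
    ((hf K hK hKT).aestronglyMeasurable.mul (ha.mono_set hKT)) ?_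
  filter_upwards [ae_restrict_of_ae_restrict_of_subset hKT hC] with z hz
  rw [norm_mul, mul_comm]
  exact mul_le_mul_of_nonneg_right hz (norm_nonneg _)

theorem LocMemLp.congr {T : ℝ} {p : ℝ≥0∞} {f g : ℝ × ℝ → ℝ} (hf : LocMemLp T p f)
    (hg : ∀ᵐ z ∂volume.restrict (slab T : Set (ℝ × ℝ)), f z = g z) : LocMemLp T p g :=
  fun K hK hKT => (memLp_congr_ae (ae_restrict_of_ae_restrict_of_subset hKT hg)).1 (hf K hK hKT)

theorem integral_congr_slab {T : ℝ} {ψ f g : ℝ × ℝ → ℝ}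
    (h : ∀ᵐ z ∂volume.restrict (slab T : Set (ℝ × ℝ)), f z = g z)
    (hψ : ∀ z ∉ slab T, ψ z = 0) : ∫ z, ψ z * f z = ∫ z, ψ z * g z := by
  rw [ae_restrict_iff' (slab T).isOpen.measurableSet] at h
  refine integral_congr_ae ?_
  filter_upwards [h] with z hz
  by_cases hzs : z ∈ slab T
  · rw [hz hzs]
  · rw [hψ z hzs, zero_mul, zero_mul]

section TestFacts

variable {T : ℝ} (φ : 𝓓(slab T, ℝ))

theorem TestFunction.zero_off {z : ℝ × ℝ} (hz : z ∉ tsupport φ) : φ z = 0 :=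
  image_eq_zero_of_notMem_tsupport hz

theorem TestFunction.zero_off_slab {z : ℝ × ℝ} (hz : z ∉ slab T) : φ z = 0 :=
  φ.zero_off fun h => hz (φ.tsupport_subset h)

theorem TestFunction.dx_zero_off_slab {z : ℝ × ℝ} (hz : z ∉ slab T) : dx φ z = 0 :=
  dx_eq_zero fun h => hz (φ.tsupport_subset h)

theorem TestFunction.dt_zero_off_slab {z : ℝ × ℝ} (hz : z ∉ slab T) : dt φ z = 0 :=
  dt_eq_zero fun h => hz (φ.tsupport_subset h)

variable {f : ℝ × ℝ → ℝ}

theorem LocMemLp.integrable_test (hf : LocMemLp T 1 f) : Integrable (fun z => φ z * f z) :=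
  integrable_mul_of_eq_zero_off φ.hasCompactSupport φ.continuous (fun _ h => φ.zero_off h)
    (hf.integrableOn φ.hasCompactSupport φ.tsupport_subset)

theorem LocMemLp.integrable_dx_test (hf : LocMemLp T 1 f) : Integrable (fun z => dx φ z * f z) :=
  integrable_mul_of_eq_zero_off φ.hasCompactSupport (continuous_dx φ.contDiff)
    (fun _ h => dx_eq_zero h) (hf.integrableOn φ.hasCompactSupport φ.tsupport_subset)

theorem LocMemLp.integrable_dt_test (hf : LocMemLp T 1 f) : Integrable (fun z => dt φ z * f z) :=
  integrable_mul_of_eq_zero_off φ.hasCompactSupport (continuous_dt φ.contDiff)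
    (fun _ h => dt_eq_zero h) (hf.integrableOn φ.hasCompactSupport φ.tsupport_subset)

end TestFacts

/-- A compact subset of the slab has a compact neighbourhood in it, and a sequence of mollifiers
supported in small balls. -/
theorem exists_mollifiers {T : ℝ} {K : Set (ℝ × ℝ)} (hK : IsCompact K) (hKT : K ⊆ slab T) :
    ∃ (K' : Set (ℝ × ℝ)) (ρ : ℕ → ContDiffBump (0 : ℝ × ℝ)), IsCompact K' ∧ K ⊆ K' ∧
      K' ⊆ slab T ∧ Tendsto (fun n => (ρ n).rOut) atTop (𝓝 0) ∧
      (∀ n, (ρ n).rOut ≤ 2 * (ρ n).rIn) ∧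
      ∀ n, ∀ z ∈ K, Metric.closedBall z (ρ n).rOut ⊆ K' := by
  obtain ⟨δ, hδ, hδT⟩ := hK.exists_cthickening_subset_open (slab T).isOpen hKT
  have hpos : ∀ n : ℕ, 0 < δ / (n + 1) := fun n => by positivity
  -- The inner radius is half the outer one: almost everywhere convergence of mollifications needs a
  -- bounded ratio of radii.
  refine ⟨Metric.cthickening δ K, fun n => ⟨δ / (n + 1) / 2, δ / (n + 1), half_pos (hpos n),
    half_lt_self (hpos n)⟩, hK.cthickening, Metric.self_subset_cthickening K, hδT, ?_, ?_, ?_⟩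
  · have := (tendsto_one_div_add_atTop_nhds_zero_nat (𝕜 := ℝ)).const_mul δ
    simpa [div_eq_mul_inv] using this
  · intro n
    show δ / (n + 1) ≤ 2 * (δ / (n + 1) / 2)
    linarith
  · intro n z hz y hy
    refine Metric.mem_cthickening_of_dist_le y z δ K hz ?_
    refine (Metric.mem_closedBall.1 hy).trans (div_le_self hδ.le ?_)
    have : (0 : ℝ) ≤ n := n.cast_nonneg
    linarith

namespace WeakReg

variable {T : ℝ} {a a' Ga Ha b b' Gb Hb : ℝ × ℝ → ℝ}

theorem locMemLp {p : ℝ≥0∞} (h : WeakReg T a a' Ga Ha) : LocMemLp T p a := fun K hK hKT => by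
  obtain ⟨C, hC0, hC⟩ := h.bdd
  have : IsFiniteMeasure (volume.restrict K) := ⟨by simpa using hK.measure_lt_top⟩
  exact MemLp.of_bound (h.meas.mono_set hKT) C (ae_restrict_of_ae_restrict_of_subset hKT hC)

/-- The `x`-derivative of a mollification. -/
theorem dx_mollify (h : WeakReg T b b' Gb Hb) {K : Set (ℝ × ℝ)} (hK : IsCompact K)
    (hKT : K ⊆ slab T) {ρ : ContDiffBump (0 : ℝ × ℝ)} {z : ℝ × ℝ}
    (hz : Metric.closedBall z ρ.rOut ⊆ K) :
    dx (mollify ρ K b) z = mollify ρ K b' z := by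
  have h1 := fderiv_mollify_eq_integral_bumpAt hK ((h.locMemLp (p := 1)).integrableOn hK hKT)
    (hz.trans hKT) hz (0, 1)
  rw [dx, h1, mollify_eq_integral_bumpAt (hz.trans hKT) hz]
  exact (h.wdx _).symm

/-- The `t`-derivative of a mollification. -/
theorem dt_mollify (h : WeakReg T b b' Gb Hb) {K : Set (ℝ × ℝ)} (hK : IsCompact K)
    (hKT : K ⊆ slab T) {ρ : ContDiffBump (0 : ℝ × ℝ)} {z : ℝ × ℝ}
    (hz : Metric.closedBall z ρ.rOut ⊆ K) :
    dt (mollify ρ K b) z = -dx (mollify ρ K Gb) z + mollify ρ K Hb z := by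
  have hG := h.memLp_G.mono_exponent (p := 1) (by norm_num)
  have h1 := fderiv_mollify_eq_integral_bumpAt hK ((h.locMemLp (p := 1)).integrableOn hK hKT)
    (hz.trans hKT) hz (1, 0)
  have h2 := fderiv_mollify_eq_integral_bumpAt hK (hG.integrableOn hK hKT)
    (hz.trans hKT) hz (0, 1)
  rw [dt, h1, dx, h2, mollify_eq_integral_bumpAt (hz.trans hKT) hz, neg_neg]
  exact (h.wdt _).trans (integral_add (hG.integrable_dx_test _) (h.memLp_H.integrable_test _))

theorem congr {c c' Gc Hc : ℝ × ℝ → ℝ} (h : WeakReg T a a' Ga Ha)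
    (h0 : ∀ᵐ z ∂volume.restrict (slab T : Set (ℝ × ℝ)), a z = c z)
    (h1 : ∀ᵐ z ∂volume.restrict (slab T : Set (ℝ × ℝ)), a' z = c' z)
    (h2 : ∀ᵐ z ∂volume.restrict (slab T : Set (ℝ × ℝ)), Ga z = Gc z)
    (h3 : ∀ᵐ z ∂volume.restrict (slab T : Set (ℝ × ℝ)), Ha z = Hc z) :
    WeakReg T c c' Gc Hc where
  meas := h.meas.congr h0
  bdd := by
    obtain ⟨C, hC0, hC⟩ := h.bdd
    refine ⟨C, hC0, ?_⟩
    filter_upwards [hC, h0] with z hz hz0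
    rwa [← hz0]
  memLp_dx := h.memLp_dx.congr h1
  memLp_G := h.memLp_G.congr h2
  memLp_H := h.memLp_H.congr h3
  wdx φ := by
    rw [← integral_congr_slab h1 (fun _ => φ.zero_off_slab),
      ← integral_congr_slab h0 (fun _ => φ.dx_zero_off_slab), h.wdx φ]
  wdt φ := by
    have hG := (h.memLp_G.congr h2).mono_exponent (p := 1) (by norm_num)
    have hG' := h.memLp_G.mono_exponent (p := 1) (by norm_num)
    rw [integral_add (hG.integrable_dx_test φ) ((h.memLp_H.congr h3).integrable_test φ),
      ← integral_congr_slab h0 (fun _ => φ.dt_zero_off_slab),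
      ← integral_congr_slab h2 (fun _ => φ.dx_zero_off_slab),
      ← integral_congr_slab h3 (fun _ => φ.zero_off_slab), h.wdt φ,
      integral_add (hG'.integrable_dx_test φ) (h.memLp_H.integrable_test φ)]

theorem add (ha : WeakReg T a a' Ga Ha) (hb : WeakReg T b b' Gb Hb) :
    WeakReg T (fun z => a z + b z) (fun z => a' z + b' z) (fun z => Ga z + Gb z)
      (fun z => Ha z + Hb z) where
  meas := ha.meas.add hb.meas
  bdd := by
    obtain ⟨C, hC0, hC⟩ := ha.bdd
    obtain ⟨D, hD0, hD⟩ := hb.bdd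
    refine ⟨C + D, by positivity, ?_⟩
    filter_upwards [hC, hD] with z h1 h2
    exact (abs_add_le _ _).trans (add_le_add h1 h2)
  memLp_dx := ha.memLp_dx.add hb.memLp_dx
  memLp_G := ha.memLp_G.add hb.memLp_G
  memLp_H := ha.memLp_H.add hb.memLp_H
  wdx φ := by
    simp only [mul_add]
    rw [integral_add ((ha.memLp_dx.mono_exponent (by norm_num)).integrable_test φ)
      ((hb.memLp_dx.mono_exponent (by norm_num)).integrable_test φ),
      integral_add (ha.locMemLp.integrable_dx_test φ) (hb.locMemLp.integrable_dx_test φ),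
      ha.wdx φ, hb.wdx φ]
    ring
  wdt φ := by
    have e : ∀ z, dx φ z * (Ga z + Gb z) + φ z * (Ha z + Hb z) =
      (dx φ z * Ga z + φ z * Ha z) + (dx φ z * Gb z + φ z * Hb z) := fun z => by ring
    have i1 : Integrable fun z => dx φ z * Ga z + φ z * Ha z :=
      ((ha.memLp_G.mono_exponent (p := 1) (by norm_num)).integrable_dx_test φ).add
      (ha.memLp_H.integrable_test φ)
    have i2 : Integrable fun z => dx φ z * Gb z + φ z * Hb z :=
      ((hb.memLp_G.mono_exponent (p := 1) (by norm_num)).integrable_dx_test φ).add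
      (hb.memLp_H.integrable_test φ)
    simp only [e]
    rw [integral_add i1 i2, ← ha.wdt φ, ← hb.wdt φ]
    simp only [mul_add]
    rw [integral_add (ha.locMemLp.integrable_dt_test φ) (hb.locMemLp.integrable_dt_test φ)]
    ring

theorem neg (ha : WeakReg T a a' Ga Ha) :
    WeakReg T (fun z => -a z) (fun z => -a' z) (fun z => -Ga z) (fun z => -Ha z) where
  meas := ha.meas.neg
  bdd := by
    obtain ⟨C, hC0, hC⟩ := ha.bdd
    exact ⟨C, hC0, by simpa only [abs_neg] using hC⟩
  memLp_dx := ha.memLp_dx.neg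
  memLp_G := ha.memLp_G.neg
  memLp_H := ha.memLp_H.neg
  wdx φ := by
    simp only [mul_neg, integral_neg]
    rw [ha.wdx φ]
  wdt φ := by
    have e : ∀ z, dx φ z * (-Ga z) + φ z * (-Ha z) = -(dx φ z * Ga z + φ z * Ha z) :=
      fun z => by ring
    simp only [e, integral_neg]
    rw [← ha.wdt φ]
    simp only [mul_neg, integral_neg]

/-- The equation of `a` is tested with `φ` times a mollification of `b`, which is smooth, and the
mollification parameter is sent to zero. Boundedness of `b` handles the term with `a'`, and `L²`
duality the term with `b'`. -/
theorem wdx_mul (ha : WeakReg T a a' Ga Ha) (hb : WeakReg T b b' Gb Hb) (φ : 𝓓(slab T, ℝ)) :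
    ∫ z, φ z * (a' z * b z + b' z * a z) = -∫ z, dx φ z * (a z * b z) := by
  obtain ⟨K', ρ, hK', hKK', hK'T, hρ, hρ', hball⟩ :=
    exists_mollifiers φ.hasCompactSupport φ.tsupport_subset
  set K := tsupport φ with hK
  have hKc : IsCompact K := φ.hasCompactSupport
  have hKT : K ⊆ slab T := φ.tsupport_subset
  obtain ⟨C, hC0, hC⟩ := hb.bdd
  have hCK := ae_restrict_of_ae_restrict_of_subset hK'T hC
  have hbi := (hb.locMemLp (p := 1)).integrableOn hK' hK'T
  have hb'i := (hb.memLp_dx.mono_exponent (p := 1) (by norm_num)).integrableOn hK' hK'T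
  have ha'1 := ha.memLp_dx.mono_exponent (p := 1) (by norm_num)
  have hsm : ∀ n, ContDiff ℝ ∞ (mollify (ρ n) K' b) := fun n => contDiff_mollify hK' hbi
  have hsm' : ∀ n, ContDiff ℝ ∞ (mollify (ρ n) K' b') := fun n => contDiff_mollify hK' hb'i
  have l1 := tendsto_integral_mul_mollify_of_bdd hρ hρ' hK' hKK' (ha'1.integrable_test φ)
    (fun z hz => by rw [φ.zero_off hz, zero_mul]) hbi hC0 hCK
  have l2 := tendsto_integral_mul_mollify_of_bdd hρ hρ' hK' hKK'
    (ha.locMemLp.integrable_dx_test φ)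
    (fun z hz => by rw [dx_eq_zero hz, zero_mul]) hbi hC0 hCK
  have : ENNReal.HolderTriple 2 (ENNReal.ofReal 2) 1 := by
    rw [ENNReal.ofReal_ofNat]; infer_instance
  have l3 := tendsto_integral_mul_mollify (p := 2) (q := 2) hρ hK' hKK' (by norm_num)
    (memLp_mul_of_eq_zero_off hKc φ.continuous (fun _ h => φ.zero_off h)
      (ha.locMemLp (p := 2) K hKc hKT))
    (fun z hz => by rw [φ.zero_off hz, zero_mul])
    (by rw [ENNReal.ofReal_ofNat]; exact hb.memLp_dx K' hK' hK'T)
  have key : ∀ n, ∫ z, φ z * a' z * mollify (ρ n) K' b z =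
      -((∫ z, dx φ z * a z * mollify (ρ n) K' b z) +
        ∫ z, φ z * a z * mollify (ρ n) K' b' z) := by
    intro n
    have h1 := ha.wdx (testMul φ _ (hsm n))
    have i1 : Integrable fun z => dx φ z * mollify (ρ n) K' b z * a z :=
      integrable_mul_of_eq_zero_off hKc ((continuous_dx φ.contDiff).mul (hsm n).continuous)
        (fun z hz => by rw [dx_eq_zero hz, zero_mul]) (ha.locMemLp.integrableOn hKc hKT)
    have i2 : Integrable fun z => φ z * mollify (ρ n) K' b' z * a z :=
      integrable_mul_of_eq_zero_off hKc (φ.continuous.mul (hsm' n).continuous)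
        (fun z hz => by rw [φ.zero_off hz, zero_mul]) (ha.locMemLp.integrableOn hKc hKT)
    have e : ∀ z, dx (testMul φ _ (hsm n)) z * a z =
        dx φ z * mollify (ρ n) K' b z * a z + φ z * mollify (ρ n) K' b' z * a z := by
      intro z
      rw [dx_testMul]
      by_cases hz : z ∈ K
      · rw [hb.dx_mollify hK' hK'T (hball n z hz)]; ring
      · rw [φ.zero_off hz]; ring
    simp only [e, testMul_apply] at h1
    rw [integral_add i1 i2] at h1
    simp only [mul_right_comm _ (a _), mul_right_comm _ (a' _)]
    exact h1
  have lim := tendsto_nhds_unique (l1.congr key) ((l2.add l3).neg)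
  have e1 : ∀ z, φ z * (a' z * b z + b' z * a z) = φ z * a' z * b z + φ z * a z * b' z :=
    fun z => by ring
  have i3 : Integrable fun z => φ z * a' z * b z := by
    simpa only [mul_assoc] using (ha'1.mul_bdd hb.meas hb.bdd).integrable_test φ
  have i4 : Integrable fun z => φ z * a z * b' z := by
    simpa only [mul_assoc] using ((ha.locMemLp (p := 2)).mul hb.memLp_dx).integrable_test φ
  simp only [e1]
  rw [integral_add i3 i4, lim]
  simp only [mul_assoc]
  ring

/-- Formally, `-b ∂_x Ga = -∂_x (Ga b) + Ga b'`, and likewise with the roles exchanged. Rigorously,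
the time equation of `a` is tested with `φ` times a mollification of `b`. Its time derivative is
given by the mollified equation of `b`, and each term that is left converges by one of the two limit
lemmas. -/
theorem wdt_mul (ha : WeakReg T a a' Ga Ha) (hb : WeakReg T b b' Gb Hb) (φ : 𝓓(slab T, ℝ)) :
    -∫ z, dt φ z * (a z * b z) = ∫ z, (dx φ z * (Ga z * b z + Gb z * a z) +
      φ z * (Ga z * b' z + Ha z * b z + Gb z * a' z + Hb z * a z)) := by
  obtain ⟨K', ρ, hK', hKK', hK'T, hρ, hρ', hball⟩ :=
    exists_mollifiers φ.hasCompactSupport φ.tsupport_subset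
  set K := tsupport φ with hK
  have hKc : IsCompact K := φ.hasCompactSupport
  have hKT : K ⊆ slab T := φ.tsupport_subset
  obtain ⟨C, hC0, hC⟩ := hb.bdd
  have hCK := ae_restrict_of_ae_restrict_of_subset hK'T hC
  have hb1 := hb.locMemLp (p := 1)
  have hb'1 := hb.memLp_dx.mono_exponent (p := 1) (by norm_num)
  have hGb1 := hb.memLp_G.mono_exponent (p := 1) (by norm_num)
  have ha1 := ha.locMemLp (p := 1)
  have ha'1 := ha.memLp_dx.mono_exponent (p := 1) (by norm_num)
  have hGa1 := ha.memLp_G.mono_exponent (p := 1) (by norm_num)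
  have hbi := hb1.integrableOn hK' hK'T
  have sb : ∀ n, ContDiff ℝ ∞ (mollify (ρ n) K' b) := fun n => contDiff_mollify hK' hbi
  have sb' : ∀ n, ContDiff ℝ ∞ (mollify (ρ n) K' b') := fun n =>
    contDiff_mollify hK' (hb'1.integrableOn hK' hK'T)
  have sG : ∀ n, ContDiff ℝ ∞ (mollify (ρ n) K' Gb) := fun n =>
    contDiff_mollify hK' (hGb1.integrableOn hK' hK'T)
  have sH : ∀ n, ContDiff ℝ ∞ (mollify (ρ n) K' Hb) := fun n =>
    contDiff_mollify hK' (hb.memLp_H.integrableOn hK' hK'T)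
  have φ0 : ∀ z ∉ K, φ z = 0 := fun z hz => φ.zero_off hz
  have φx0 : ∀ z ∉ K, dx φ z = 0 := fun z hz => dx_eq_zero hz
  have φt0 : ∀ z ∉ K, dt φ z = 0 := fun z hz => dt_eq_zero hz
  have cφ : Continuous φ := φ.continuous
  have cx := continuous_dx φ.contDiff
  have ct := continuous_dt φ.contDiff
  have : ENNReal.HolderTriple 2 (ENNReal.ofReal 2) 1 := by
    rw [ENNReal.ofReal_ofNat]; infer_instance
  have : ENNReal.HolderTriple ⊤ (ENNReal.ofReal 1) 1 := by
    rw [ENNReal.ofReal_one]; infer_instance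
  have two : ∀ {g : ℝ × ℝ → ℝ}, LocMemLp T 2 g →
      MemLp g (ENNReal.ofReal 2) (volume.restrict K') := fun hg => by
    rw [ENNReal.ofReal_ofNat]; exact hg K' hK' hK'T
  have l1 := tendsto_integral_mul_mollify_of_bdd hρ hρ' hK' hKK' (ha1.integrable_dt_test φ)
    (fun z hz => by rw [φt0 z hz, zero_mul]) hbi hC0 hCK
  have l2 := tendsto_integral_mul_mollify (p := 2) (q := 2) hρ hK' hKK' (by norm_num)
    (memLp_mul_of_eq_zero_off hKc cφ φ0 (ha.memLp_dx K hKc hKT))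
    (fun z hz => by rw [φ0 z hz, zero_mul]) (two hb.memLp_G)
  have l3 := tendsto_integral_mul_mollify (p := 2) (q := 2) hρ hK' hKK' (by norm_num)
    (memLp_mul_of_eq_zero_off hKc cx φx0 (ha.locMemLp K hKc hKT))
    (fun z hz => by rw [φx0 z hz, zero_mul]) (two hb.memLp_G)
  -- `Hb` is only in `L¹_loc`, so here the boundedness of `a` supplies the dual exponent.
  have l4 := tendsto_integral_mul_mollify (p := 1) (q := ⊤) hρ hK' hKK' le_rfl
    (memLp_mul_of_eq_zero_off hKc cφ φ0 (ha.locMemLp K hKc hKT))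
    (fun z hz => by rw [φ0 z hz, zero_mul])
    (by rw [ENNReal.ofReal_one]; exact hb.memLp_H K' hK' hK'T)
  have l5 := tendsto_integral_mul_mollify_of_bdd hρ hρ' hK' hKK' (hGa1.integrable_dx_test φ)
    (fun z hz => by rw [φx0 z hz, zero_mul]) hbi hC0 hCK
  have l6 := tendsto_integral_mul_mollify (p := 2) (q := 2) hρ hK' hKK' (by norm_num)
    (memLp_mul_of_eq_zero_off hKc cφ φ0 (ha.memLp_G K hKc hKT))
    (fun z hz => by rw [φ0 z hz, zero_mul]) (two hb.memLp_dx)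
  have l7 := tendsto_integral_mul_mollify_of_bdd hρ hρ' hK' hKK' (ha.memLp_H.integrable_test φ)
    (fun z hz => by rw [φ0 z hz, zero_mul]) hbi hC0 hCK
  have key : ∀ n, -∫ z, dt φ z * a z * mollify (ρ n) K' b z =
      (∫ z, φ z * a' z * mollify (ρ n) K' Gb z) + (∫ z, dx φ z * a z * mollify (ρ n) K' Gb z) +
      (∫ z, φ z * a z * mollify (ρ n) K' Hb z) + (∫ z, dx φ z * Ga z * mollify (ρ n) K' b z) +
      (∫ z, φ z * Ga z * mollify (ρ n) K' b' z) + ∫ z, φ z * Ha z * mollify (ρ n) K' b z := by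
    intro n
    have h1 := ha.wdt (testMul φ _ (sb n))
    -- The term with `∂_x` of the mollified `Gb` has no limit of its own. The equation `∂_x a = a'`,
    -- tested with `φ` times the mollified `Gb`, moves this derivative onto `φ` and `a`.
    have h2 := ha.wdx (testMul φ _ (sG n))
    have I : ∀ {ψ m f : ℝ × ℝ → ℝ}, Continuous ψ → (∀ z ∉ K, ψ z = 0) → Continuous m →
        LocMemLp T 1 f → Integrable fun z => ψ z * m z * f z := fun hψ h0 hm hf =>
      integrable_mul_of_eq_zero_off hKc (hψ.mul hm)
        (fun z hz => by rw [h0 z hz, zero_mul]) (hf.integrableOn hKc hKT)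
    have i1 := I ct φt0 (sb n).continuous ha1
    have i2 := I cφ φ0 (continuous_dx (sG n)) ha1
    have i3 := I cφ φ0 (sH n).continuous ha1
    have i4 := I cx φx0 (sG n).continuous ha1
    have i5 := I cx φx0 (sb n).continuous hGa1
    have i6 := I cφ φ0 (sb' n).continuous hGa1
    have i7 := I cφ φ0 (sb n).continuous ha.memLp_H
    have e1 : ∀ z, dt (testMul φ _ (sb n)) z * a z =
        dt φ z * mollify (ρ n) K' b z * a z - φ z * dx (mollify (ρ n) K' Gb) z * a z
          + φ z * mollify (ρ n) K' Hb z * a z := by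
      intro z
      rw [dt_testMul]
      by_cases hz : z ∈ K
      · rw [hb.dt_mollify hK' hK'T (hball n z hz)]; ring
      · rw [φ0 z hz]; ring
    have e2 : ∀ z, dx (testMul φ _ (sb n)) z * Ga z + testMul φ _ (sb n) z * Ha z =
        dx φ z * mollify (ρ n) K' b z * Ga z + φ z * mollify (ρ n) K' b' z * Ga z +
          φ z * mollify (ρ n) K' b z * Ha z := by
      intro z
      rw [dx_testMul, testMul_apply]
      by_cases hz : z ∈ K
      · rw [hb.dx_mollify hK' hK'T (hball n z hz)]; ring
      · rw [φ0 z hz]; ring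
    have e3 : ∀ z, dx (testMul φ _ (sG n)) z * a z =
        dx φ z * mollify (ρ n) K' Gb z * a z + φ z * dx (mollify (ρ n) K' Gb) z * a z := by
      intro z
      rw [dx_testMul]; ring
    have i12 : Integrable fun z => dt φ z * mollify (ρ n) K' b z * a z -
        φ z * dx (mollify (ρ n) K' Gb) z * a z := i1.sub i2
    have i56 : Integrable fun z => dx φ z * mollify (ρ n) K' b z * Ga z +
        φ z * mollify (ρ n) K' b' z * Ga z := i5.add i6
    simp only [e1, e2] at h1
    simp only [e3] at h2
    simp only [testMul_apply] at h2
    rw [integral_add i12 i3, integral_sub i1 i2, integral_add i56 i7, integral_add i5 i6] at h1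
    rw [integral_add i4 i2] at h2
    simp only [mul_right_comm _ (a _), mul_right_comm _ (a' _), mul_right_comm _ (Ga _),
      mul_right_comm _ (Ha _)]
    linarith
  have lim := tendsto_nhds_unique (l1.neg.congr key)
    (((((l2.add l3).add l4).add l5).add l6).add l7)
  have J1 : Integrable fun z => φ z * a' z * Gb z := by
    simpa only [mul_assoc] using (ha.memLp_dx.mul hb.memLp_G).integrable_test φ
  have J2 : Integrable fun z => dx φ z * a z * Gb z := by
    simpa only [mul_assoc] using ((ha.locMemLp (p := 2)).mul hb.memLp_G).integrable_dx_test φ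
  have J3 : Integrable fun z => φ z * a z * Hb z := by
    have := (hb.memLp_H.mul_bdd ha.meas ha.bdd).integrable_test φ
    simpa only [mul_assoc, mul_comm (Hb _)] using this
  have J4 : Integrable fun z => dx φ z * Ga z * b z := by
    simpa only [mul_assoc] using (hGa1.mul_bdd hb.meas hb.bdd).integrable_dx_test φ
  have J5 : Integrable fun z => φ z * Ga z * b' z := by
    simpa only [mul_assoc] using (ha.memLp_G.mul hb.memLp_dx).integrable_test φ
  have J6 : Integrable fun z => φ z * Ha z * b z := by
    simpa only [mul_assoc] using (ha.memLp_H.mul_bdd hb.meas hb.bdd).integrable_test φ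
  have J12 : Integrable fun z => φ z * a' z * Gb z + dx φ z * a z * Gb z := J1.add J2
  have J13 : Integrable fun z => φ z * a' z * Gb z + dx φ z * a z * Gb z + φ z * a z * Hb z :=
    J12.add J3
  have J14 : Integrable fun z => φ z * a' z * Gb z + dx φ z * a z * Gb z + φ z * a z * Hb z +
    dx φ z * Ga z * b z := J13.add J4
  have J15 : Integrable fun z => φ z * a' z * Gb z + dx φ z * a z * Gb z + φ z * a z * Hb z +
    dx φ z * Ga z * b z + φ z * Ga z * b' z := J14.add J5
  have e : ∀ z, dx φ z * (Ga z * b z + Gb z * a z) +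
      φ z * (Ga z * b' z + Ha z * b z + Gb z * a' z + Hb z * a z) =
      φ z * a' z * Gb z + dx φ z * a z * Gb z + φ z * a z * Hb z +
        dx φ z * Ga z * b z + φ z * Ga z * b' z + φ z * Ha z * b z := fun z => by ring
  simp only [e]
  rw [integral_add J15 J6, integral_add J14 J5, integral_add J13 J4, integral_add J12 J3,
    integral_add J1 J2, ← lim]
  simp only [mul_assoc]

/-- The integrability classes are matched so as to be stable: bounded times `L²` stays `L²` in the
derivative and in the flux, while `L²` times `L²` and bounded times `L¹` stay `L¹` in the source. -/
theorem mul (ha : WeakReg T a a' Ga Ha) (hb : WeakReg T b b' Gb Hb) :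
    WeakReg T (fun z => a z * b z) (fun z => a' z * b z + b' z * a z)
      (fun z => Ga z * b z + Gb z * a z)
      (fun z => Ga z * b' z + Ha z * b z + Gb z * a' z + Hb z * a z) where
  meas := ha.meas.mul hb.meas
  bdd := by
    obtain ⟨C, hC0, hC⟩ := ha.bdd
    obtain ⟨D, hD0, hD⟩ := hb.bdd
    refine ⟨C * D, by positivity, ?_⟩
    filter_upwards [hC, hD] with z h1 h2
    rw [abs_mul]
    exact mul_le_mul h1 h2 (abs_nonneg _) hC0
  memLp_dx := (ha.memLp_dx.mul_bdd hb.meas hb.bdd).add (hb.memLp_dx.mul_bdd ha.meas ha.bdd)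
  memLp_G := (ha.memLp_G.mul_bdd hb.meas hb.bdd).add (hb.memLp_G.mul_bdd ha.meas ha.bdd)
  memLp_H := (((ha.memLp_G.mul hb.memLp_dx).add (ha.memLp_H.mul_bdd hb.meas hb.bdd)).add
    (hb.memLp_G.mul ha.memLp_dx)).add (hb.memLp_H.mul_bdd ha.meas ha.bdd)
  wdx := ha.wdx_mul hb
  wdt := ha.wdt_mul hb

end WeakReg

/-! ### Algebra of the cross product and of orthonormal pairs. -/

section Cross

theorem fin3_cases (i : Fin 3) : i = 0 ∨ i = 1 ∨ i = 2 := by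
  fin_cases i <;> simp

theorem fin3_one_add_one : (1 : Fin 3) + 1 = 2 := rfl
theorem fin3_one_add_two : (1 : Fin 3) + 2 = 0 := rfl
theorem fin3_two_add_one : (2 : Fin 3) + 1 = 0 := rfl
theorem fin3_two_add_two : (2 : Fin 3) + 2 = 1 := rfl

/-- Indices are cyclic modulo 3, so that one formula covers all three coordinates. -/
theorem cross_apply_add (a b : E3) (i : Fin 3) :
    cross a b i = a (i + 1) * b (i + 2) - a (i + 2) * b (i + 1) := by
  fin_cases i <;> simp [cross, cross_apply]

theorem E3.norm_sq (a : E3) : ‖a‖ ^ 2 = a 0 ^ 2 + a 1 ^ 2 + a 2 ^ 2 := by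
  rw [EuclideanSpace.norm_sq_eq]
  simp [Fin.sum_univ_three]

theorem E3.inner_eq (a b : E3) : inner ℝ a b = a 0 * b 0 + a 1 * b 1 + a 2 * b 2 := by
  simp [PiLp.inner_apply, Fin.sum_univ_three, mul_comm]

/-- `(u, e)` is an orthonormal pair. -/
def IsOrthoPair (u e : E3) : Prop := ‖u‖ = 1 ∧ ‖e‖ = 1 ∧ inner ℝ u e = 0

theorem E3.abs_apply_le (a : E3) (i : Fin 3) : |a i| ≤ ‖a‖ := by
  simpa using PiLp.norm_apply_le a i

namespace IsOrthoPair

variable {u e : E3}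

theorem sum_sq_left (h : IsOrthoPair u e) : u 0 ^ 2 + u 1 ^ 2 + u 2 ^ 2 = 1 := by
  rw [← E3.norm_sq, h.1, one_pow]

theorem sum_sq_right (h : IsOrthoPair u e) : e 0 ^ 2 + e 1 ^ 2 + e 2 ^ 2 = 1 := by
  rw [← E3.norm_sq, h.2.1, one_pow]

theorem sum_mul (h : IsOrthoPair u e) : u 0 * e 0 + u 1 * e 1 + u 2 * e 2 = 0 := by
  rw [← E3.inner_eq, h.2.2]

theorem norm_cross (h : IsOrthoPair u e) : ‖cross u e‖ = 1 := by
  have h1 := h.sum_sq_left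
  have h2 := h.sum_sq_right
  have h3 := h.sum_mul
  have : ‖cross u e‖ ^ 2 = 1 := by
    rw [E3.norm_sq]
    simp only [cross_apply_add, zero_add, fin3_one_add_one, fin3_one_add_two,
      fin3_two_add_one, fin3_two_add_two]
    linear_combination (e 0 ^ 2 + e 1 ^ 2 + e 2 ^ 2) * h1 + h2 -
      (u 0 * e 0 + u 1 * e 1 + u 2 * e 2) * h3
  rwa [pow_eq_one_iff_of_nonneg (norm_nonneg _) two_ne_zero] at this

/-- `(u × e) × e = (u · e) e - |e|² u`. This and its companion with `u` reduce the derivatives of `u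
× e` given by the product rule to the frame equations of `u × e`. -/
theorem cross_cross_right (h : IsOrthoPair u e) (i : Fin 3) :
    cross u e (i + 1) * e (i + 2) - cross u e (i + 2) * e (i + 1) = -u i := by
  have h2 := h.sum_sq_right
  have h3 := h.sum_mul
  obtain rfl | rfl | rfl := fin3_cases i <;>
    simp only [cross_apply_add, zero_add, fin3_one_add_one, fin3_one_add_two,
      fin3_two_add_one, fin3_two_add_two]
  · linear_combination e 0 * h3 - u 0 * h2
  · linear_combination e 1 * h3 - u 1 * h2
  · linear_combination e 2 * h3 - u 2 * h2

theorem cross_cross_left (h : IsOrthoPair u e) (i : Fin 3) :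
    cross u e (i + 1) * u (i + 2) - cross u e (i + 2) * u (i + 1) = e i := by
  have h2 := h.sum_sq_left
  have h3 := h.sum_mul
  obtain rfl | rfl | rfl := fin3_cases i <;>
    simp only [cross_apply_add, zero_add, fin3_one_add_one, fin3_one_add_two,
      fin3_two_add_one, fin3_two_add_two]
  · linear_combination e 0 * h2 - u 0 * h3
  · linear_combination e 1 * h2 - u 1 * h3
  · linear_combination e 2 * h2 - u 2 * h3

end IsOrthoPair

end Cross

/-! ### Coordinates, slices and uniqueness of weak derivatives. -/

section Components

variable {T : ℝ}

theorem slab_coe (T : ℝ) : (slab T : Set (ℝ × ℝ)) = Ioo (-T) T ×ˢ univ := rfl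

theorem MemL2L2loc.memLp {F : Type*} [NormedAddCommGroup F] {w : ℝ × ℝ → F} (hw : MemL2L2loc T w)
    {K : Set (ℝ × ℝ)} (hK : IsCompact K) (hKT : K ⊆ slab T) : MemLp w 2 (volume.restrict K) := by
  refine (hw (Prod.snd '' K) (hK.image continuous_snd)).mono_measure (Measure.restrict_mono ?_ le_rfl)
  exact fun z hz => ⟨(hKT hz).1, mem_image_of_mem _ hz⟩

theorem MemL2L2loc.aestronglyMeasurable {F : Type*} [NormedAddCommGroup F] {w : ℝ × ℝ → F}
    (hw : MemL2L2loc T w) :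
    AEStronglyMeasurable w (volume.restrict (slab T : Set (ℝ × ℝ))) := by
  have : (slab T : Set (ℝ × ℝ)) = ⋃ n : ℕ, Ioo (-T) T ×ˢ Icc (-(n : ℝ)) n := by
    rw [slab_coe, ← prod_iUnion]
    congr 1
    refine (eq_univ_of_forall fun x => mem_iUnion.2 ?_).symm
    obtain ⟨n, hn⟩ := exists_nat_ge |x|
    exact ⟨n, abs_le.1 hn⟩
  rw [this, aestronglyMeasurable_iUnion_iff]
  exact fun n => (hw _ isCompact_Icc).aestronglyMeasurable

theorem MemL2L2loc.locMemLp {w : ℝ × ℝ → E3} (hw : MemL2L2loc T w) (i : Fin 3) :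
    LocMemLp T 2 (fun z => w z i) := fun _ hK hKT => (hw.memLp hK hKT).eval_piLp i

theorem MemL2L2loc.locMemLp_re {q : ℝ × ℝ → ℂ} (hq : MemL2L2loc T q) :
    LocMemLp T 2 (fun z => (q z).re) := fun _ hK hKT => (hq.memLp hK hKT).re

theorem MemL2L2loc.locMemLp_im {q : ℝ × ℝ → ℂ} (hq : MemL2L2loc T q) :
    LocMemLp T 2 (fun z => (q z).im) := fun _ hK hKT => (hq.memLp hK hKT).im

theorem ae_slab_iff {p : ℝ × ℝ → Prop} : (∀ᵐ z ∂volume.restrict (slab T : Set (ℝ × ℝ)), p z) ↔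
    ∀ᵐ z ∂((volume.restrict (Ioo (-T) T)).prod (volume : Measure ℝ)), p z := by
  rw [slab_coe, Measure.volume_eq_prod, ← Measure.prod_restrict, Measure.restrict_univ]

theorem ae_ae_of_ae_slab {p : ℝ × ℝ → Prop}
    (h : ∀ᵐ z ∂volume.restrict (slab T : Set (ℝ × ℝ)), p z) :
    ∀ᵐ t ∂volume.restrict (Ioo (-T) T), ∀ᵐ x : ℝ, p (t, x) :=
  Measure.ae_ae_of_ae_prod (ae_slab_iff.1 h)

/-- A property of a measurable function that holds at almost every `x`, for all `t`, holds almost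
everywhere in space-time. -/
theorem ae_slab_of_forall_ae {F : Type*} [NormedAddCommGroup F] [MeasurableSpace F] [BorelSpace F]
    {w : ℝ × ℝ → F} (hw : AEStronglyMeasurable w (volume.restrict (slab T : Set (ℝ × ℝ))))
    {S : Set F} (hS : MeasurableSet S) (h : ∀ t ∈ Ioo (-T) T, ∀ᵐ x : ℝ, w (t, x) ∈ S) :
    ∀ᵐ z ∂volume.restrict (slab T : Set (ℝ × ℝ)), w z ∈ S := by
  have h1 := hw.ae_eq_mk
  have h2 := ae_ae_of_ae_slab h1
  have hm : Measurable (hw.mk w) := hw.stronglyMeasurable_mk.measurable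
  -- Passing from slices to space-time by Fubini needs a measurable set, hence the measurable
  -- representative.
  have h3 : ∀ᵐ z ∂volume.restrict (slab T : Set (ℝ × ℝ)), z ∈ (hw.mk w) ⁻¹' S := by
    rw [ae_slab_iff, Measure.ae_prod_mem_iff_ae_ae_mem (hm hS)]
    filter_upwards [h2, ae_restrict_mem measurableSet_Ioo] with t ht htT
    filter_upwards [ht, h t htT] with x hx hxS
    rw [mem_preimage, ← hx]; exact hxS
  filter_upwards [h1, h3] with z hz hzS
  rw [hz]; exact hzS

theorem integral_smul_apply {ψ : ℝ × ℝ → ℝ} {w : ℝ × ℝ → E3}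
    (h : ∀ i, Integrable (fun z => ψ z * w z i)) (i : Fin 3) :
    (∫ z, ψ z • w z) i = ∫ z, ψ z * w z i := by
  rw [eval_integral_piLp (by simpa using h)]
  simp

theorem HasWeakDx.apply {w w' : ℝ × ℝ → E3} (h : HasWeakDx T w w')
    (hw : ∀ i, LocMemLp T 1 (fun z => w z i)) (hw' : ∀ i, LocMemLp T 1 (fun z => w' z i))
    (φ : 𝓓(slab T, ℝ)) (i : Fin 3) : ∫ z, φ z * w' z i = -∫ z, dx φ z * w z i := by
  rw [← integral_smul_apply (fun i => (hw' i).integrable_test φ),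
    ← integral_smul_apply (fun i => (hw i).integrable_dx_test φ), h φ]
  simp

/-- Locally integrable functions are determined by their integrals against test functions. -/
theorem ae_eq_of_forall_integral_test {f g : ℝ × ℝ → ℝ} (hf : LocMemLp T 1 f) (hg : LocMemLp T 1 g)
    (h : ∀ φ : 𝓓(slab T, ℝ), ∫ z, φ z * f z = ∫ z, φ z * g z) :
    ∀ᵐ z ∂volume.restrict (slab T : Set (ℝ × ℝ)), f z = g z := by
  rw [ae_restrict_iff' (slab T).isOpen.measurableSet]
  have hl : LocallyIntegrableOn (fun z => f z - g z) (slab T : Set (ℝ × ℝ)) := by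
    rw [locallyIntegrableOn_iff (slab T).isOpen.isLocallyClosed]
    exact fun K hK hKc => (hf.integrableOn hKc hK).sub (hg.integrableOn hKc hK)
  have := (slab T).isOpen.ae_eq_zero_of_integral_contDiff_smul_eq_zero hl (fun ψ h1 h2 h3 => by
    have h4 := h ⟨ψ, h1, h2, h3⟩
    have i1 := hf.integrable_test ⟨ψ, h1, h2, h3⟩
    have i2 := hg.integrable_test ⟨ψ, h1, h2, h3⟩
    simp only [smul_eq_mul, mul_sub]
    exact (integral_sub i1 i2).trans (sub_eq_zero.2 h4))
  filter_upwards [this] with z hz hzs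
  exact sub_eq_zero.1 (hz hzs)

end Components

/-! ### The frame system in scalar divergence form. -/

/-- The scalar form of the frame system: `(y₀, y₁, y₂)` are the `j`-th coordinates of
`(u, e, u × e)`. -/
structure FrameReg (T : ℝ) (q : ℝ × ℝ → ℂ) (y₀ y₁ y₂ : ℝ × ℝ → ℝ) : Prop where
  reg₀ : WeakReg T y₀ (fun z => (q z).re * y₁ z + (q z).im * y₂ z)
    (fun z => (q z).im * y₁ z - (q z).re * y₂ z) (fun _ => 0)
  reg₁ : WeakReg T y₁ (fun z => -((q z).re * y₀ z)) (fun z => -((q z).im * y₀ z))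
    (fun z => -((q z).im * ((q z).re * y₁ z + (q z).im * y₂ z)) - 1 / 2 * ‖q z‖ ^ 2 * y₂ z)
  reg₂ : WeakReg T y₂ (fun z => -((q z).im * y₀ z)) (fun z => (q z).re * y₀ z)
    (fun z => (q z).re * ((q z).re * y₁ z + (q z).im * y₂ z) + 1 / 2 * ‖q z‖ ^ 2 * y₁ z)

/-- Both triples are moved by the same skew matrices, so that after the product rule the derivative,
the flux and the source all cancel identically. Orthonormality is not needed. -/
theorem FrameReg.inner {T : ℝ} {q : ℝ × ℝ → ℂ} {y₀ y₁ y₂ x₀ x₁ x₂ : ℝ × ℝ → ℝ}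
    (hy : FrameReg T q y₀ y₁ y₂) (hx : FrameReg T q x₀ x₁ x₂) :
    WeakReg T (fun z => y₀ z * x₀ z + y₁ z * x₁ z + y₂ z * x₂ z) (fun _ => 0) (fun _ => 0)
      (fun _ => 0) := by
  refine (((hy.reg₀.mul hx.reg₀).add (hy.reg₁.mul hx.reg₁)).add (hy.reg₂.mul hx.reg₂)).congr
    (Eventually.of_forall fun z => rfl) (Eventually.of_forall fun z => ?_)
    (Eventually.of_forall fun z => ?_) (Eventually.of_forall fun z => ?_)
  · ring
  · ring
  · ring

section FrameSolution

variable {T : ℝ} {q : ℝ × ℝ → ℂ} {u e : ℝ × ℝ → E3}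

theorem IsFrameSolution.ae_isOrthoPair (h : IsFrameSolution T q u e) :
    ∀ t ∈ Ioo (-T) T, ∀ᵐ x : ℝ, IsOrthoPair (u (t, x)) (e (t, x)) := fun t ht => by
  filter_upwards [h.norm_u t ht, h.norm_e t ht, h.orthogonal t ht] with x h1 h2 h3
  exact ⟨h1, h2, h3⟩

theorem measurableSet_isOrthoPair : MeasurableSet {p : E3 × E3 | IsOrthoPair p.1 p.2} := by
  have h1 : IsClosed {p : E3 × E3 | ‖p.1‖ = 1} := isClosed_eq (by fun_prop) continuous_const
  have h2 : IsClosed {p : E3 × E3 | ‖p.2‖ = 1} := isClosed_eq (by fun_prop) continuous_const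
  have h3 : IsClosed {p : E3 × E3 | inner ℝ p.1 p.2 = 0} :=
    isClosed_eq (by fun_prop) continuous_const
  exact (h1.inter (h2.inter h3)).measurableSet

theorem ae_slab_isOrthoPair
    (hu : AEStronglyMeasurable u (volume.restrict (slab T : Set (ℝ × ℝ))))
    (he : AEStronglyMeasurable e (volume.restrict (slab T : Set (ℝ × ℝ))))
    (h : ∀ t ∈ Ioo (-T) T, ∀ᵐ x : ℝ, IsOrthoPair (u (t, x)) (e (t, x))) :
    ∀ᵐ z ∂volume.restrict (slab T : Set (ℝ × ℝ)), IsOrthoPair (u z) (e z) :=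
  ae_slab_of_forall_ae (w := fun z => (u z, e z)) (hu.prodMk he) measurableSet_isOrthoPair h

theorem bdd_of_ae_norm_eq {w : ℝ × ℝ → E3}
    (h : ∀ᵐ z ∂volume.restrict (slab T : Set (ℝ × ℝ)), ‖w z‖ = 1) (i : Fin 3) :
    ∃ C, 0 ≤ C ∧ ∀ᵐ z ∂volume.restrict (slab T : Set (ℝ × ℝ)), |w z i| ≤ C := by
  refine ⟨1, zero_le_one, ?_⟩
  filter_upwards [h] with z hz
  exact (E3.abs_apply_le _ i).trans hz.le

/-- The cross product of two maps with weakly regular coordinates. -/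
theorem WeakReg.cross {u' Gu Hu e' Ge He : Fin 3 → ℝ × ℝ → ℝ}
    (hu : ∀ i, WeakReg T (fun z => u z i) (u' i) (Gu i) (Hu i))
    (he : ∀ i, WeakReg T (fun z => e z i) (e' i) (Ge i) (He i)) (i : Fin 3) :
    WeakReg T (fun z => cross (u z) (e z) i)
      (fun z => (u' (i + 1) z * e z (i + 2) + e' (i + 2) z * u z (i + 1)) +
        -(u' (i + 2) z * e z (i + 1) + e' (i + 1) z * u z (i + 2)))
      (fun z => (Gu (i + 1) z * e z (i + 2) + Ge (i + 2) z * u z (i + 1)) +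
        -(Gu (i + 2) z * e z (i + 1) + Ge (i + 1) z * u z (i + 2)))
      (fun z => (Gu (i + 1) z * e' (i + 2) z + Hu (i + 1) z * e z (i + 2) +
          Ge (i + 2) z * u' (i + 1) z + He (i + 2) z * u z (i + 1)) +
        -(Gu (i + 2) z * e' (i + 1) z + Hu (i + 2) z * e z (i + 1) +
          Ge (i + 1) z * u' (i + 2) z + He (i + 1) z * u z (i + 2))) := by
  refine (((hu (i + 1)).mul (he (i + 2))).add ((hu (i + 2)).mul (he (i + 1))).neg).congr
    (Eventually.of_forall fun z => ?_) (Eventually.of_forall fun z => rfl)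
    (Eventually.of_forall fun z => rfl) (Eventually.of_forall fun z => rfl)
  simp only [cross_apply_add]; ring

/-- The weak derivative in the definition of the product is an unnamed witness. It is carried along
here and identified later, once the equation of `w` is known. -/
theorem IsDxMul.apply {g : ℝ × ℝ → ℝ} {w : ℝ × ℝ → E3} {D : 𝓓(slab T, ℝ) → E3}
    (hg : LocMemLp T 2 g) (h : IsDxMul T g w D) :
    ∃ w' : ℝ × ℝ → E3, (∀ i, LocMemLp T 2 (fun z => w' z i)) ∧
      (∀ (φ : 𝓓(slab T, ℝ)) i, ∫ z, φ z * w' z i = -∫ z, dx φ z * w z i) ∧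
      ∀ (φ : 𝓓(slab T, ℝ)) i, D φ i =
        -∫ z, (dx φ z * (g z * w z i) + φ z * (g z * w' z i)) := by
  obtain ⟨w', hw, hw', hd, hD⟩ := h
  refine ⟨w', hw'.locMemLp, hd.apply (fun i => (hw.locMemLp i).mono_exponent (by norm_num))
    (fun i => (hw'.locMemLp i).mono_exponent (by norm_num)), fun φ i => ?_⟩
  rw [hD φ]
  have hint : ∀ i, Integrable (fun z => (g z • (dx φ z • w z + φ z • w' z)) i) := fun i => by
    have i1 := (hg.mul (hw.locMemLp i)).integrable_dx_test φ
    have i2 := (hg.mul (hw'.locMemLp i)).integrable_test φ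
    refine (i1.add i2).congr (Eventually.of_forall fun z => ?_)
    simp; ring
  rw [PiLp.neg_apply, eval_integral_piLp hint]
  congr 1
  refine integral_congr_ae (Eventually.of_forall fun z => ?_)
  simp; ring

/-- The coordinates of a solution of the frame system solve the scalar frame system. -/
theorem IsFrameSolution.frameReg (hq : MemL2L2loc T q) (h : IsFrameSolution T q u e) (i : Fin 3) :
    FrameReg T q (fun z => u z i) (fun z => e z i) (fun z => cross (u z) (e z) i) := by
  have hu2 := h.u_memL2H1loc.1
  have he2 := h.e_memL2H1loc.1
  have hum := hu2.aestronglyMeasurable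
  have hem := he2.aestronglyMeasurable
  have hort := ae_slab_isOrthoPair hum hem h.ae_isOrthoPair
  have hq1 := hq.locMemLp_re
  have hq2 := hq.locMemLp_im
  have hu1 : ∀ i, LocMemLp T 1 (fun z => u z i) := fun i =>
    (hu2.locMemLp i).mono_exponent (by norm_num)
  have he1 : ∀ i, LocMemLp T 1 (fun z => e z i) := fun i =>
    (he2.locMemLp i).mono_exponent (by norm_num)
  have mu : ∀ i, AEStronglyMeasurable (fun z => u z i) (volume.restrict (slab T : Set (ℝ × ℝ))) :=
    fun i => (PiLp.continuous_apply 2 _ i).comp_aestronglyMeasurable hum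
  have me : ∀ i, AEStronglyMeasurable (fun z => e z i) (volume.restrict (slab T : Set (ℝ × ℝ))) :=
    fun i => (PiLp.continuous_apply 2 _ i).comp_aestronglyMeasurable hem
  have mf : ∀ i, AEStronglyMeasurable (fun z => cross (u z) (e z) i)
      (volume.restrict (slab T : Set (ℝ × ℝ))) := fun i => by
    simp only [cross_apply_add]
    exact ((mu _).mul (me _)).sub ((mu _).mul (me _))
  have bu := bdd_of_ae_norm_eq (w := u) (hort.mono fun z hz => hz.1)
  have be := bdd_of_ae_norm_eq (w := e) (hort.mono fun z hz => hz.2.1)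
  have bf := bdd_of_ae_norm_eq (w := fun z => cross (u z) (e z)) (hort.mono fun z hz => hz.norm_cross)
  have n2 : LocMemLp T 1 (fun z => ‖q z‖ ^ 2) := fun K hK hKT =>
    memLp_one_iff_integrable.2 ((hq.memLp hK hKT).integrable_norm_pow (by norm_num))
  have hf1 : ∀ i, LocMemLp T 1 (fun z => cross (u z) (e z) i) := fun i K hK hKT => by
    obtain ⟨C, hC0, hC⟩ := bf i
    have : IsFiniteMeasure (volume.restrict K) := ⟨by simpa using hK.measure_lt_top⟩
    exact MemLp.of_bound ((mf i).mono_set hKT) C (ae_restrict_of_ae_restrict_of_subset hKT hC)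
  have dux : ∀ i, LocMemLp T 2 (fun z => (q z).re * e z i + (q z).im * cross (u z) (e z) i) :=
    fun i => (hq1.mul_bdd (me i) (be i)).add (hq2.mul_bdd (mf i) (bf i))
  have dex : ∀ i, LocMemLp T 2 (fun z => -((q z).re * u z i)) :=
    fun i => (hq1.mul_bdd (mu i) (bu i)).neg
  have wu : ∀ (φ : 𝓓(slab T, ℝ)) i, ∫ z, φ z * ((q z).re * e z i + (q z).im *
      cross (u z) (e z) i) = -∫ z, dx φ z * u z i := fun φ i => by
    simpa using h.dx_u.apply hu1 (fun i => by
      simpa using (dux i).mono_exponent (p := 1) (by norm_num)) φ i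
  have we : ∀ (φ : 𝓓(slab T, ℝ)) i, ∫ z, φ z * (-((q z).re * u z i)) =
      -∫ z, dx φ z * e z i := fun φ i => by
    simpa using h.dx_e.apply he1 (fun i => by
      simpa using (dex i).mono_exponent (p := 1) (by norm_num)) φ i
  obtain ⟨P₁, P₂, hP₁, hP₂, hut⟩ := h.dt_u
  obtain ⟨P, hP, het⟩ := h.dt_e
  obtain ⟨e', e'2, e'w, hP₁'⟩ := hP₁.apply hq2.neg
  obtain ⟨f', f'2, f'w, hP₂'⟩ := hP₂.apply hq1
  obtain ⟨u', u'2, u'w, hP'⟩ := hP.apply hq2.neg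
  have ee' : ∀ i, ∀ᵐ z ∂volume.restrict (slab T : Set (ℝ × ℝ)), e' z i = -((q z).re * u z i) :=
    fun i => ae_eq_of_forall_integral_test ((e'2 i).mono_exponent (by norm_num))
      ((dex i).mono_exponent (by norm_num)) fun φ => by rw [e'w, we]
  have uu' : ∀ i, ∀ᵐ z ∂volume.restrict (slab T : Set (ℝ × ℝ)),
      u' z i = (q z).re * e z i + (q z).im * cross (u z) (e z) i :=
    fun i => ae_eq_of_forall_integral_test ((u'2 i).mono_exponent (by norm_num))
      ((dux i).mono_exponent (by norm_num)) fun φ => by rw [u'w, wu]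
  -- At this stage `f'`, the weak derivative of `u × e`, is not yet identified. It enters only the
  -- source, where membership in `L²_loc` is enough to have a weakly regular function.
  have ru : ∀ i, WeakReg T (fun z => u z i)
      (fun z => (q z).re * e z i + (q z).im * cross (u z) (e z) i)
      (fun z => (q z).im * e z i - (q z).re * cross (u z) (e z) i)
      (fun z => (q z).im * e' z i - (q z).re * f' z i) := fun i => by
    have g1 := hq2.mul_bdd (me i) (be i)
    have g2 := hq1.mul_bdd (mf i) (bf i)
    have k1 := hq2.mul (e'2 i)
    have k2 := hq1.mul (f'2 i)
    refine ⟨mu i, bu i, dux i, ?_, ?_, fun φ => wu φ i, fun φ => ?_⟩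
    · simpa only [sub_eq_add_neg] using g1.add g2.neg
    · simpa only [sub_eq_add_neg] using k1.add k2.neg
    · have h1 := congrArg (fun v : E3 => v i) (hut φ)
      simp only [PiLp.neg_apply, PiLp.add_apply] at h1
      rw [integral_smul_apply (fun i => (hu1 i).integrable_dt_test φ), hP₁', hP₂'] at h1
      rw [h1, ← neg_add, ← integral_add, ← integral_neg]
      · refine integral_congr_ae (Eventually.of_forall fun z => ?_)
        simp only; ring
      · simp only [neg_mul]
        exact ((g1.neg.mono_exponent (by norm_num)).integrable_dx_test φ).add
          (k1.neg.integrable_test φ)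
      · exact ((g2.mono_exponent (by norm_num)).integrable_dx_test φ).add
          (k2.integrable_test φ)
  have re : ∀ i, WeakReg T (fun z => e z i) (fun z => -((q z).re * u z i))
      (fun z => -((q z).im * u z i))
      (fun z => -((q z).im * u' z i) - 1 / 2 * ‖q z‖ ^ 2 * cross (u z) (e z) i) := fun i => by
    have g1 := (hq2.mul_bdd (mu i) (bu i)).neg
    have k1 := (hq2.mul (u'2 i)).neg
    have k2 : ∀ i, LocMemLp T 1 (fun z => ‖q z‖ ^ 2 * cross (u z) (e z) i) := fun i =>
      n2.mul_bdd (mf i) (bf i)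
    have k2' : ∀ i, LocMemLp T 1 (fun z => (-(1 / 2) * ‖q z‖ ^ 2) * cross (u z) (e z) i) := by
      intro i K hK hKT
      have := (k2 i K hK hKT).const_mul (-(1 / 2))
      simpa only [mul_assoc] using this
    refine ⟨me i, be i, dex i, g1, ?_, fun φ => we φ i, fun φ => ?_⟩
    · refine (k1.add (k2' i)).congr (Eventually.of_forall fun z => ?_)
      simp only; ring
    · have h1 := congrArg (fun v : E3 => v i) (het φ)
      simp only [PiLp.neg_apply, PiLp.add_apply] at h1
      rw [integral_smul_apply (fun i => (he1 i).integrable_dt_test φ), hP',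
        integral_smul_apply (fun i => by simpa using (k2' i).integrable_test φ)] at h1
      rw [eq_sub_of_add_eq h1, sub_neg_eq_add, ← integral_add]
      · refine integral_congr_ae (Eventually.of_forall fun z => ?_)
        simp only [PiLp.smul_apply, smul_eq_mul]; ring
      · simpa using (k2' i).integrable_test φ
      · simp only [neg_mul]
        exact ((g1.mono_exponent (by norm_num)).integrable_dx_test φ).add
          (k1.integrable_test φ)
  -- The product rule now computes `∂_x (u × e)`, and uniqueness of weak derivatives identifies `f'`
  -- with `-q₂ u`. Only after this does the source in the equation of `u` reduce to zero.
  have rf := WeakReg.cross ru re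
  have ff' : ∀ i, ∀ᵐ z ∂volume.restrict (slab T : Set (ℝ × ℝ)), f' z i = -((q z).im * u z i) := by
    intro i
    have h1 := ae_eq_of_forall_integral_test ((f'2 i).mono_exponent (by norm_num))
      ((rf i).memLp_dx.mono_exponent (by norm_num)) fun φ => by rw [f'w, (rf i).wdx]
    filter_upwards [h1, hort] with z hz ho
    rw [hz]
    have h2 := ho.cross_cross_right i
    linear_combination (q z).im * h2
  have ru' : ∀ i, WeakReg T (fun z => u z i)
      (fun z => (q z).re * e z i + (q z).im * cross (u z) (e z) i)
      (fun z => (q z).im * e z i - (q z).re * cross (u z) (e z) i) (fun _ => 0) := fun i => by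
    refine (ru i).congr (Eventually.of_forall fun z => rfl) (Eventually.of_forall fun z => rfl)
      (Eventually.of_forall fun z => rfl) ?_
    filter_upwards [ee' i, ff' i] with z h1 h2
    rw [h1, h2]; ring
  have re' : ∀ i, WeakReg T (fun z => e z i) (fun z => -((q z).re * u z i))
      (fun z => -((q z).im * u z i))
      (fun z => -((q z).im * ((q z).re * e z i + (q z).im * cross (u z) (e z) i)) -
        1 / 2 * ‖q z‖ ^ 2 * cross (u z) (e z) i) := fun i => by
    refine (re i).congr (Eventually.of_forall fun z => rfl) (Eventually.of_forall fun z => rfl)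
      (Eventually.of_forall fun z => rfl) ?_
    filter_upwards [uu' i] with z h1
    rw [h1]
  -- The equation of `u × e` is not part of the frame system; it follows from the product rule
  -- applied to the simplified equations of `u` and `e`.
  refine ⟨ru' i, re' i, (WeakReg.cross ru' re' i).congr (Eventually.of_forall fun z => rfl) ?_ ?_ ?_⟩
  · filter_upwards [hort] with z ho
    linear_combination (q z).im * ho.cross_cross_right i
  · filter_upwards [hort] with z ho
    linear_combination -(q z).re * ho.cross_cross_right i
  · filter_upwards [hort] with z ho
    have h2 := ho.cross_cross_left i
    have h3 := cross_apply_add (u z) (e z) i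
    linear_combination ((q z).re ^ 2 + 1 / 2 * ‖q z‖ ^ 2) * h2 - (q z).re * (q z).im * h3

end FrameSolution

/-! ### Constancy of functions with vanishing weak derivatives. -/

section Constancy

variable {T : ℝ} {a : ℝ × ℝ → ℝ}

theorem fderiv_eq_zero_of_dt_dx {f : ℝ × ℝ → ℝ} {z : ℝ × ℝ} (h1 : dt f z = 0) (h2 : dx f z = 0) :
    fderiv ℝ f z = 0 := by
  ext
  · simpa [dt] using h1
  · simpa [dx] using h2

theorem mollify_zero (ρ : ContDiffBump (0 : ℝ × ℝ)) (K : Set (ℝ × ℝ)) :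
    mollify ρ K (fun _ => 0) = fun _ => 0 := by
  ext z
  simp [mollify, convolution]

/-- The mollifications have zero gradient on `K`, hence are constant there by convexity, and they
converge to `a` almost everywhere. -/
theorem WeakReg.exists_const_of_convex (h : WeakReg T a (fun _ => 0) (fun _ => 0) (fun _ => 0))
    {K : Set (ℝ × ℝ)} (hK : IsCompact K) (hKT : K ⊆ slab T) (hc : Convex ℝ K) :
    ∃ c : ℝ, ∀ᵐ z ∂volume.restrict K, a z = c := by
  rcases K.eq_empty_or_nonempty with rfl | ⟨z₀, hz₀⟩
  · exact ⟨0, by simp⟩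
  obtain ⟨K', ρ, hK', hKK', hK'T, hρ, hρ', hball⟩ := exists_mollifiers hK hKT
  have hi := (h.locMemLp (p := 1)).integrableOn hK' hK'T
  have hconst : ∀ n, ∀ z ∈ K, mollify (ρ n) K' a z = mollify (ρ n) K' a z₀ := by
    intro n z hz
    have hd : ∀ y ∈ K, fderiv ℝ (mollify (ρ n) K' a) y = 0 := fun y hy => by
      apply fderiv_eq_zero_of_dt_dx
      · rw [h.dt_mollify hK' hK'T (hball n y hy), mollify_zero]
        simp [dx]
      · rw [h.dx_mollify hK' hK'T (hball n y hy), mollify_zero]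
    have := hc.norm_image_sub_le_of_norm_fderiv_le (C := 0) (𝕜 := ℝ)
      (fun y _ => (contDiff_mollify hK' hi).differentiable (by simp) y)
      (fun y hy => by rw [hd y hy]; simp) hz₀ hz
    simpa [sub_eq_zero] using this
  -- The limit exists as soon as one point of `K` is a point of convergence. If there is none, `K`
  -- is a null set and the default value of `limUnder` is harmless.
  refine ⟨limUnder atTop fun n => mollify (ρ n) K' a z₀, ?_⟩
  rw [ae_restrict_iff' hK.measurableSet]
  filter_upwards [ae_tendsto_mollify hρ hρ' hK' hi] with z hz hzK
  have := hz (hKK' hzK)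
  simp only [hconst _ z hzK] at this
  exact this.limUnder_eq.symm

/-- A weakly regular function with vanishing derivatives is constant. -/
theorem WeakReg.exists_const (hT : 0 < T)
    (h : WeakReg T a (fun _ => 0) (fun _ => 0) (fun _ => 0)) :
    ∃ c : ℝ, ∀ᵐ z ∂volume.restrict (slab T : Set (ℝ × ℝ)), a z = c := by
  -- Boxes that exhaust the slab; the shifts `n + 2` and `n + 1` give the smallest of them positive
  -- measure.
  set K : ℕ → Set (ℝ × ℝ) := fun n =>
    Icc (-(T - T / (n + 2))) (T - T / (n + 2)) ×ˢ Icc (-((n : ℝ) + 1)) (n + 1) with hKdef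
  have hpos : ∀ n : ℕ, 0 < T / (n + 2) := fun n => by positivity
  have hKc : ∀ n, IsCompact (K n) := fun n => isCompact_Icc.prod isCompact_Icc
  have hKT : ∀ n, K n ⊆ slab T := fun n z hz =>
    ⟨⟨by linarith [hz.1.1, hpos n], by linarith [hz.1.2, hpos n]⟩, mem_univ _⟩
  have hK0 : ∀ n, K 0 ⊆ K n := fun n z hz => by
    have h2 : T / ((n : ℝ) + 2) ≤ T / (((0 : ℕ) : ℝ) + 2) := by
      gcongr; exact_mod_cast Nat.zero_le n
    have h3 : ((0 : ℕ) : ℝ) ≤ n := by exact_mod_cast Nat.zero_le n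
    obtain ⟨⟨h4, h5⟩, h6, h7⟩ := hz
    exact ⟨⟨by linarith, by linarith⟩, by linarith, by linarith⟩
  choose c hc using fun n => h.exists_const_of_convex (hKc n) (hKT n)
    ((convex_Icc _ _).prod (convex_Icc _ _))
  have hvol : volume (K 0) ≠ 0 := by
    rw [hKdef]
    simp only [Measure.volume_eq_prod, Measure.prod_prod, Real.volume_Icc]
    refine mul_ne_zero ?_ ?_ <;> rw [Ne, ENNReal.ofReal_eq_zero, not_le]
    · norm_num; linarith
    · norm_num
  -- All boxes contain `K 0`, whose positive measure forces their constants to agree.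
  have hcn : ∀ n, c n = c 0 := by
    intro n
    have h1 := ae_restrict_of_ae_restrict_of_subset (hK0 n) (hc n)
    have : (ae (volume.restrict (K 0))).NeBot := by
      rw [ae_neBot]; simpa using hvol
    obtain ⟨z, hz1, hz2⟩ := (h1.and (hc 0)).exists
    rw [← hz1, hz2]
  refine ⟨c 0, ?_⟩
  have hU : (slab T : Set (ℝ × ℝ)) ⊆ ⋃ n, K n := by
    intro z hz
    have h1 : |z.1| < T := abs_lt.2 hz.1
    obtain ⟨n, hn⟩ := exists_nat_gt (max |z.2| (T / (T - |z.1|)))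
    have h2 : 0 < T - |z.1| := by linarith
    have h3 : T / ((n : ℝ) + 2) ≤ T - |z.1| := by
      have h4 := (le_max_right _ _).trans hn.le
      rw [div_le_iff₀ h2] at h4
      rw [div_le_iff₀ (by positivity)]
      nlinarith
    have h5 := (le_max_left _ _).trans hn.le
    refine mem_iUnion.2 ⟨n, ?_, ?_⟩
    · exact abs_le.1 (by linarith)
    · exact abs_le.1 (by linarith)
  refine ae_restrict_of_ae_restrict_of_subset hU ?_
  rw [ae_restrict_iUnion_iff]
  intro n
  filter_upwards [hc n] with z hz
  rw [hz, hcn]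

end Constancy

/-! ### From almost every time to every time. -/

section ContL2

variable {T : ℝ}

/-- Two maps in `C(L²_loc)` that agree for almost every time agree for every time. -/
theorem ContL2loc.ae_eq_of_ae_ae_eq {v w : ℝ × ℝ → E3} (hv : ContL2loc T v) (hw : ContL2loc T w)
    (h : ∀ᵐ t ∂volume.restrict (Ioo (-T) T), ∀ᵐ x : ℝ, v (t, x) = w (t, x)) :
    ∀ t ∈ Ioo (-T) T, ∀ᵐ x : ℝ, v (t, x) = w (t, x) := by
  intro t₀ ht₀
  have hK : ∀ K : Set ℝ, IsCompact K → ∀ᵐ x ∂volume.restrict K, v (t₀, x) = w (t₀, x) := by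
    intro K hK
    obtain ⟨mv, lv⟩ := hv K hK t₀ ht₀
    obtain ⟨mw, lw⟩ := hw K hK t₀ ht₀
    -- A set of full measure is dense, so times of agreement accumulate at `t₀`, where continuity in
    -- `L²_loc` takes over.
    have hfreq : ∃ᶠ t in 𝓝 t₀, t ∈ Ioo (-T) T ∧ ∀ᵐ x : ℝ, v (t, x) = w (t, x) := by
      rw [ae_restrict_iff' measurableSet_Ioo] at h
      have h1 : ∃ᶠ t in 𝓝 t₀, t ∈ Ioo (-T) T → ∀ᵐ x : ℝ, v (t, x) = w (t, x) := by
        have := Measure.dense_of_ae h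
        exact mem_closure_iff_frequently.1 (this t₀)
      exact (h1.and_eventually (isOpen_Ioo.mem_nhds ht₀)).mono fun t ht => ⟨ht.2, ht.1 ht.2⟩
    have hle : ∀ ε : ℝ≥0∞, 0 < ε → eLpNorm (fun x => v (t₀, x) - w (t₀, x)) 2
        (volume.restrict K) ≤ ε + ε := by
      intro ε hε
      obtain ⟨t, ⟨htT, hte⟩, h1, h2⟩ := (hfreq.and_eventually
        ((lv.eventually (ge_mem_nhds hε)).and (lw.eventually (ge_mem_nhds hε)))).exists
      have mvt := (hv K hK t htT).1.aestronglyMeasurable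
      have mwt := (hw K hK t htT).1.aestronglyMeasurable
      have e1 : eLpNorm (fun x => v (t₀, x) - w (t₀, x)) 2 (volume.restrict K) =
          eLpNorm ((fun x => w (t, x) - w (t₀, x)) - (fun x => v (t, x) - v (t₀, x))) 2
            (volume.restrict K) := by
        refine eLpNorm_congr_ae ?_
        filter_upwards [ae_restrict_of_ae hte] with x hx
        simp only [Pi.sub_apply, hx]
        abel
      rw [e1]
      exact (eLpNorm_sub_le (mwt.sub mw.aestronglyMeasurable) (mvt.sub mv.aestronglyMeasurable)
        (by norm_num)).trans (add_le_add h2 h1)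
    have h0 : eLpNorm (fun x => v (t₀, x) - w (t₀, x)) 2 (volume.restrict K) = 0 := by
      refine le_antisymm (ENNReal.le_of_forall_pos_le_add fun ε hε _ => ?_) zero_le
      have := hle (ε / 2) (ENNReal.div_pos (by simpa using hε.ne') (by norm_num))
      rwa [ENNReal.add_halves, ← zero_add (ε : ℝ≥0∞)] at this
    have h1 := (eLpNorm_eq_zero_iff (p := 2) (mv.aestronglyMeasurable.sub mw.aestronglyMeasurable)
      two_ne_zero).1 h0
    filter_upwards [h1] with x hx
    exact sub_eq_zero.1 hx
  have hU : (⋃ n : ℕ, Icc (-(n : ℝ)) n) = univ := by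
    refine eq_univ_of_forall fun x => mem_iUnion.2 ?_
    obtain ⟨n, hn⟩ := exists_nat_ge |x|
    exact ⟨n, abs_le.1 hn⟩
  rw [← Measure.restrict_univ (μ := (volume : Measure ℝ)), ← hU, ae_restrict_iUnion_iff]
  exact fun n => hK _ isCompact_Icc

theorem ContL2loc.comp_isometry {v : ℝ × ℝ → E3} (hv : ContL2loc T v) (ρ : E3 ≃ₗᵢ[ℝ] E3) :
    ContL2loc T (fun z => ρ (v z)) := by
  intro K hK t₀ ht₀
  obtain ⟨m, l⟩ := hv K hK t₀ ht₀
  refine ⟨?_, l.congr fun t => eLpNorm_congr_norm_ae (Eventually.of_forall fun x => ?_)⟩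
  · exact m.of_le (ρ.continuous.comp_aestronglyMeasurable m.aestronglyMeasurable)
      (Eventually.of_forall fun x => (ρ.norm_map _).le)
  · rw [← map_sub, ρ.norm_map]

end ContL2

/-! ### Rotations between frames, and uniqueness. -/

section Rotation

/-- The matrix with rows `u`, `e`, `u × e`. -/
def frameMatrix (u e : E3) : Matrix (Fin 3) (Fin 3) ℝ :=
  Matrix.of ![u.ofLp, e.ofLp, (cross u e).ofLp]

variable {u e v f : E3}

theorem frameMatrix_mul_transpose (h : IsOrthoPair u e) :
    frameMatrix u e * (frameMatrix u e)ᵀ = 1 := by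
  have h1 := h.sum_sq_left
  have h2 := h.sum_sq_right
  have h3 := h.sum_mul
  have h4 := E3.norm_sq (cross u e)
  rw [h.norm_cross] at h4
  have c0 : cross u e 0 = u 1 * e 2 - u 2 * e 1 := cross_apply_add u e 0
  have c1 : cross u e 1 = u 2 * e 0 - u 0 * e 2 := cross_apply_add u e 1
  have c2 : cross u e 2 = u 0 * e 1 - u 1 * e 0 := cross_apply_add u e 2
  have h5 : u 0 * cross u e 0 + u 1 * cross u e 1 + u 2 * cross u e 2 = 0 := by
    rw [c0, c1, c2]; ring
  have h6 : e 0 * cross u e 0 + e 1 * cross u e 1 + e 2 * cross u e 2 = 0 := by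
    rw [c0, c1, c2]; ring
  ext i j
  obtain rfl | rfl | rfl := fin3_cases i <;> obtain rfl | rfl | rfl := fin3_cases j <;>
    simp [frameMatrix, Matrix.mul_apply, Fin.sum_univ_three] <;>
    linarith

/-- The triple product of `u`, `e`, `u × e` is `|u × e|²`. -/
theorem det_frameMatrix (h : IsOrthoPair u e) : (frameMatrix u e).det = 1 := by
  have h4 := E3.norm_sq (cross u e)
  rw [h.norm_cross] at h4
  have c0 : cross u e 0 = u 1 * e 2 - u 2 * e 1 := cross_apply_add u e 0
  have c1 : cross u e 1 = u 2 * e 0 - u 0 * e 2 := cross_apply_add u e 1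
  have c2 : cross u e 2 = u 0 * e 1 - u 1 * e 0 := cross_apply_add u e 2
  rw [Matrix.det_fin_three]
  simp only [frameMatrix, Matrix.of_apply, Matrix.cons_val_zero, Matrix.cons_val_one,
    Matrix.cons_val]
  rw [c0, c1, c2] at h4 ⊢
  linear_combination -h4

/-- The rotation that maps one orthonormal pair to another one. -/
theorem exists_rotation (h : IsOrthoPair u e) (h' : IsOrthoPair v f) :
    ∃ ρ : E3 ≃ₗᵢ[ℝ] E3, LinearMap.det (ρ.toLinearEquiv : E3 →ₗ[ℝ] E3) = 1 ∧
      ∀ (w : E3) (i : Fin 3), ρ w i = ∑ j, (v i * u j + f i * e j + cross v f i * cross u e j) *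
        w j := by
  -- This matrix maps `u`, `e`, `u × e` to `v`, `f`, `v × f`. Its entries are exactly the sums that
  -- `FrameReg.inner` controls.
  set A : Matrix (Fin 3) (Fin 3) ℝ := (frameMatrix v f)ᵀ * frameMatrix u e with hA
  have hAA : Aᵀ * A = 1 := by
    rw [hA, Matrix.transpose_mul, Matrix.transpose_transpose, Matrix.mul_assoc,
      ← Matrix.mul_assoc (frameMatrix v f), frameMatrix_mul_transpose h', Matrix.one_mul]
    exact mul_eq_one_comm.1 (frameMatrix_mul_transpose h)
  have hnorm : ∀ w : E3, ‖Matrix.toLpLin 2 2 A w‖ = ‖w‖ := by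
    intro w
    have : ‖Matrix.toLpLin 2 2 A w‖ ^ 2 = ‖w‖ ^ 2 := by
      have e1 : ∀ x : E3, ‖x‖ ^ 2 = x.ofLp ⬝ᵥ x.ofLp := fun x => by
        rw [EuclideanSpace.norm_sq_eq]; simp [dotProduct, sq]
      rw [e1, e1, Matrix.ofLp_toLpLin, Matrix.toLin'_apply, Matrix.dotProduct_mulVec,
        Matrix.vecMul_mulVec, hAA, Matrix.vecMul_one]
    exact (pow_left_inj₀ (norm_nonneg _) (norm_nonneg _) two_ne_zero).1 this
  let ρ : E3 ≃ₗᵢ[ℝ] E3 :=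
    LinearIsometry.toLinearIsometryEquiv ⟨Matrix.toLpLin 2 2 A, hnorm⟩ rfl
  refine ⟨ρ, ?_, fun w i => ?_⟩
  · have : (ρ.toLinearEquiv : E3 →ₗ[ℝ] E3) = Matrix.toLpLin 2 2 A := by
      ext w : 1
      rfl
    rw [this, Matrix.toLpLin_eq_toLin, LinearMap.det_toLin, hA, Matrix.det_mul,
      Matrix.det_transpose, det_frameMatrix h, det_frameMatrix h', one_mul]
  · have : ρ w i = (A *ᵥ w.ofLp) i := rfl
    rw [this, Matrix.mulVec, dotProduct]
    refine Finset.sum_congr rfl fun j _ => ?_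
    simp [hA, Matrix.mul_apply, frameMatrix, Fin.sum_univ_three]

end Rotation

/-- Two solutions of the frame system differ by a rotation. -/
theorem IsFrameSolution.exists_rotation {T : ℝ} (hT : 0 < T) {q : ℝ × ℝ → ℂ}
    (hq : MemL2L2loc T q) {u e u' e' : ℝ × ℝ → E3} (h : IsFrameSolution T q u e)
    (h' : IsFrameSolution T q u' e') :
    ∃ ρ : E3 ≃ₗᵢ[ℝ] E3, LinearMap.det (ρ.toLinearEquiv : E3 →ₗ[ℝ] E3) = 1 ∧
      ∀ t ∈ Ioo (-T) T, ∀ᵐ x : ℝ, u' (t, x) = ρ (u (t, x)) ∧ e' (t, x) = ρ (e (t, x)) := by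
  have hort := ae_slab_isOrthoPair h.u_memL2H1loc.1.aestronglyMeasurable
    h.e_memL2H1loc.1.aestronglyMeasurable h.ae_isOrthoPair
  have hort' := ae_slab_isOrthoPair h'.u_memL2H1loc.1.aestronglyMeasurable
    h'.e_memL2H1loc.1.aestronglyMeasurable h'.ae_isOrthoPair
  -- Row `i` of the second frame is paired with row `j` of the first: the nine constants are the
  -- entries of the rotation.
  choose c hc using fun i j : Fin 3 => ((h'.frameReg hq i).inner (h.frameReg hq j)).exists_const hT
  have hc' : ∀ᵐ z ∂volume.restrict (slab T : Set (ℝ × ℝ)), ∀ i j, u' z i * u z j + e' z i * e z j +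
      cross (u' z) (e' z) i * cross (u z) (e z) j = c i j :=
    ae_all_iff.2 fun i => ae_all_iff.2 fun j => hc i j
  have hne : (ae (volume.restrict (slab T : Set (ℝ × ℝ)))).NeBot := by
    rw [ae_neBot, Ne, Measure.restrict_eq_zero]
    exact ((slab T).isOpen.measure_pos volume
      ⟨(0, 0), ⟨by constructor <;> simpa using hT, mem_univ _⟩⟩).ne'
  obtain ⟨z₀, ho, ho', hz₀⟩ := (hort.and (hort'.and hc')).exists
  obtain ⟨ρ, hdet, hρ⟩ := _root_.exists_rotation ho ho'
  have hmain : ∀ᵐ z ∂volume.restrict (slab T : Set (ℝ × ℝ)), u' z = ρ (u z) ∧ e' z = ρ (e z) := by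
    filter_upwards [hort, hc'] with z h1 h2
    have e1 := h1.sum_sq_left
    have e2 := h1.sum_sq_right
    have e3 := h1.sum_mul
    have c0 : cross (u z) (e z) 0 = u z 1 * e z 2 - u z 2 * e z 1 := cross_apply_add _ _ 0
    have c1 : cross (u z) (e z) 1 = u z 2 * e z 0 - u z 0 * e z 2 := cross_apply_add _ _ 1
    have c2 : cross (u z) (e z) 2 = u z 0 * e z 1 - u z 1 * e z 0 := cross_apply_add _ _ 2
    -- The entries of `ρ`, computed at `z₀`, are replaced by the equal sums at `z`; orthonormality
    -- of the frame at `z` then collapses the product to the vector of the second frame.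
    constructor <;> ext i <;> rw [hρ] <;> simp only [hz₀] <;> simp only [← h2] <;>
      rw [Fin.sum_univ_three, c0, c1, c2]
    · linear_combination -(u' z i) * e1 - (e' z i) * e3
    · linear_combination -(u' z i) * e3 - (e' z i) * e2
  have hae := ae_ae_of_ae_slab hmain
  have hu := h'.u_contL2loc.ae_eq_of_ae_ae_eq (h.u_contL2loc.comp_isometry ρ)
    (hae.mono fun t ht => ht.mono fun x hx => hx.1)
  have he := h'.e_contL2loc.ae_eq_of_ae_ae_eq (h.e_contL2loc.comp_isometry ρ)
    (hae.mono fun t ht => ht.mono fun x hx => hx.2)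
  refine ⟨ρ, hdet, fun t ht => ?_⟩
  filter_upwards [hu t ht, he t ht] with x h1 h2
  exact ⟨h1, h2⟩

/-! ### Linear ordinary differential equations by Picard series. -/

section LinearODE

variable {V : Type*} [NormedAddCommGroup V] [NormedSpace ℝ V]

/-- The iterated integrals of a linear differential equation. -/
def picardTerm (a : ℝ → V →L[ℝ] V) (y₀ : V) : ℕ → ℝ → V
  | 0, _ => y₀
  | n + 1, s => ∫ r in (0 : ℝ)..s, a r (picardTerm a y₀ n r)

variable {a : ℝ → V →L[ℝ] V} {y₀ : V}

theorem continuous_picardTerm (ha : Continuous a) (n : ℕ) : Continuous (picardTerm a y₀ n) := by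
  induction n with
  | zero => exact continuous_const
  | succ n ih =>
    exact intervalIntegral.continuous_primitive
      (fun _ _ => (ha.clm_apply ih).intervalIntegrable _ _) 0

theorem hasDerivAt_picardTerm [CompleteSpace V] (ha : Continuous a) (n : ℕ) (s : ℝ) :
    HasDerivAt (picardTerm a y₀ (n + 1)) (a s (picardTerm a y₀ n s)) s :=
  ((ha.clm_apply (continuous_picardTerm ha n)).integral_hasStrictDerivAt 0 s).hasDerivAt

/-- Each integration of `|r|ⁿ` gains a factor `1 / (n + 1)`. The factorial makes the series converge
on intervals of any length, so that the solution is global. -/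
theorem norm_picardTerm_le {K R : ℝ} (hK : ∀ s, |s| ≤ R → ‖a s‖ ≤ K) (n : ℕ) :
    ∀ s, |s| ≤ R → ‖picardTerm a y₀ n s‖ ≤ ‖y₀‖ * ((K * |s|) ^ n / n.factorial) := by
  induction n with
  | zero => intro s _; simp [picardTerm]
  | succ n ih =>
    intro s hs
    have hK0 : 0 ≤ K := (norm_nonneg _).trans (hK s hs)
    have hb : ∀ r ∈ uIoc 0 s, ‖a r (picardTerm a y₀ n r)‖ ≤
        ‖y₀‖ * K ^ (n + 1) / n.factorial * |r - 0| ^ n := by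
      intro r hr
      have hrs : |r| ≤ |s| := by
        have := abs_sub_left_of_mem_uIcc (uIoc_subset_uIcc hr)
        simpa using this
      refine ((a r).le_opNorm _).trans ?_
      refine (mul_le_mul (hK r (hrs.trans hs)) (ih r (hrs.trans hs)) (norm_nonneg _) hK0).trans
        (le_of_eq ?_)
      rw [sub_zero, mul_pow]; ring
    have h1 : ‖picardTerm a y₀ (n + 1) s‖ ≤
        ∫ r in uIoc 0 s, ‖y₀‖ * K ^ (n + 1) / n.factorial * |r - 0| ^ n := by
      have hi : IntervalIntegrable (fun r : ℝ => ‖y₀‖ * K ^ (n + 1) / n.factorial * |r - 0| ^ n)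
          volume 0 s := by
        apply Continuous.intervalIntegrable; fun_prop
      rw [picardTerm, intervalIntegral.norm_integral_eq_norm_integral_uIoc]
      exact norm_integral_le_of_norm_le hi.def'
        ((ae_restrict_iff' measurableSet_uIoc).2 (Eventually.of_forall hb))
    refine h1.trans (le_of_eq ?_)
    rw [integral_const_mul, integral_pow_abs_sub_uIoc, sub_zero, Nat.factorial_succ]
    push_cast
    field_simp
    ring

/-- A linear differential equation with continuous coefficients has a global solution. -/
theorem exists_linear_ode_solution [CompleteSpace V] (ha : Continuous a) (y₀ : V) :
    ∃ y : ℝ → V, y 0 = y₀ ∧ ∀ s, HasDerivAt y (a s (y s)) s := by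
  refine ⟨fun s => ∑' n, picardTerm a y₀ n s, ?_, fun s => ?_⟩
  · show ∑' n, picardTerm a y₀ n 0 = y₀
    rw [tsum_eq_single 0]
    · rfl
    · intro n hn
      obtain ⟨m, rfl⟩ := Nat.exists_eq_succ_of_ne_zero hn
      simp [picardTerm]
  set R := |s| + 1
  obtain ⟨K, hK⟩ := (isCompact_Icc (a := -R) (b := R)).exists_bound_of_continuousOn ha.continuousOn
  have hK' : ∀ s, |s| ≤ R → ‖a s‖ ≤ K := fun r hr => hK r (abs_le.1 hr)
  have hs : s ∈ Ioo (-R) R := abs_lt.1 (lt_add_one _)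
  have hR0 : 0 ≤ R := by positivity
  have hK0 : 0 ≤ K := (norm_nonneg _).trans (hK' s (lt_add_one _).le)
  have hsum0 : ∀ C : ℝ, Summable fun n : ℕ => C * ((K * R) ^ n / n.factorial) := fun C =>
    (Real.summable_pow_div_factorial (K * R)).mul_left C
  have hle : ∀ n, ∀ r ∈ Ioo (-R) R, ‖picardTerm a y₀ n r‖ ≤
      ‖y₀‖ * ((K * R) ^ n / n.factorial) := fun n r hr => by
    have hr' : |r| ≤ R := (abs_lt.2 hr).le
    refine (norm_picardTerm_le hK' n r hr').trans ?_
    gcongr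
  -- The zeroth term is constant, and the derivative of every later term is `a` applied to its
  -- predecessor. The index shift turns the differentiated series into `a` applied to the series.
  let g' : ℕ → ℝ → V := fun n r => Nat.casesOn n 0 fun m => a r (picardTerm a y₀ m r)
  let b : ℕ → ℝ := fun n => Nat.casesOn n 0 fun m => K * ‖y₀‖ * ((K * R) ^ m / m.factorial)
  have hb : Summable b := (summable_nat_add_iff 1).1 (hsum0 (K * ‖y₀‖))
  have hd := hasDerivAt_tsum_of_isPreconnected (g := picardTerm a y₀) (g' := g') hb isOpen_Ioo
    isPreconnected_Ioo (fun n r _ => ?_) (fun n r hr => ?_) hs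
    (Summable.of_norm_bounded (hsum0 ‖y₀‖) fun n => hle n s hs) hs
  · convert hd using 1
    have hsm : Summable fun n => picardTerm a y₀ n s :=
      Summable.of_norm_bounded (hsum0 ‖y₀‖) fun n => hle n s hs
    have hsg : Summable fun n => g' n s := (summable_nat_add_iff 1).1 (hsm.mapL (a s))
    rw [hsg.tsum_eq_zero_add]
    exact ((a s).map_tsum hsm).trans (zero_add _).symm
  · cases n with
    | zero => exact hasDerivAt_const r y₀
    | succ m => exact hasDerivAt_picardTerm ha m r
  · cases n with
    | zero => simp [g', b]
    | succ m =>
      have hr' : |r| ≤ R := (abs_lt.2 hr).le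
      refine ((a r).le_opNorm _).trans ?_
      simp only [b]
      rw [mul_assoc]
      exact mul_le_mul (hK' r hr') (hle m r hr) (norm_nonneg _) hK0

/-- Grönwall's inequality on the unit interval. Requiring `1 ≤ K` removes the division by `K` and
leaves a bound linear in `δ` and `ε`. -/
theorem norm_le_of_deriv_le {f f' : ℝ → V} {K ε δ : ℝ} (hK : 1 ≤ K) (hε : 0 ≤ ε) (hδ : 0 ≤ δ)
    (hf : ∀ s ∈ Icc (0 : ℝ) 1, HasDerivAt f (f' s) s) (h0 : ‖f 0‖ ≤ δ)
    (hf' : ∀ s ∈ Icc (0 : ℝ) 1, ‖f' s‖ ≤ K * ‖f s‖ + ε) :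
    ∀ s ∈ Icc (0 : ℝ) 1, ‖f s‖ ≤ (δ + ε) * Real.exp K := by
  intro s hs
  have h1 := norm_le_gronwallBound_of_norm_deriv_right_le (δ := δ) (K := K) (ε := ε)
    (fun r hr => (hf r hr).continuousAt.continuousWithinAt)
    (fun r hr => (hf r ⟨hr.1, hr.2.le⟩).hasDerivWithinAt) h0
    (fun r hr => hf' r ⟨hr.1, hr.2.le⟩) s hs
  refine h1.trans ?_
  rw [gronwallBound_of_K_ne_0 (by positivity)]
  have h2 : Real.exp (K * (s - 0)) ≤ Real.exp K :=
    Real.exp_le_exp.2 (by nlinarith [hs.2])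
  have h3 : ε / K ≤ ε := div_le_self hε hK
  have h4 : 0 ≤ Real.exp (K * (s - 0)) - 1 := by
    rw [sub_nonneg, Real.one_le_exp_iff]
    have := hs.1
    nlinarith
  have h5 : ε / K * (Real.exp (K * (s - 0)) - 1) ≤ ε * (Real.exp K) := by
    refine mul_le_mul h3 (by linarith) h4 hε
  nlinarith

end LinearODE

/-! ### Parallel sections of flat connections on convex sets. -/

section FlatConnection

set_option maxSynthPendingDepth 3

variable {E V : Type*} [NormedAddCommGroup E] [NormedSpace ℝ E]
  [NormedAddCommGroup V] [NormedSpace ℝ V]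
  {S : Set E} {Γ : E → E →L[ℝ] V →L[ℝ] V} {z₀ : E}

theorem ray_mem (hS : Convex ℝ S) (hz₀ : z₀ ∈ S) {z : E} (hz : z ∈ S) {s : ℝ}
    (hs : s ∈ Icc (0 : ℝ) 1) : z₀ + s • (z - z₀) ∈ S :=
  hS.add_smul_sub_mem hz₀ hz hs

/-- Parallel transport along the rays from a point of a convex set. -/
theorem exists_radial_solution [CompleteSpace V] (hS : Convex ℝ S) (hz₀ : z₀ ∈ S)
    (hΓ : ContinuousOn Γ S) (y₀ : V) :
    ∃ Y : E → ℝ → V, ∀ z ∈ S, Y z 0 = y₀ ∧ ∀ s ∈ Icc (0 : ℝ) 1,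
      HasDerivAt (Y z) (Γ (z₀ + s • (z - z₀)) (z - z₀) (Y z s)) s := by
  have : ∀ z : E, ∃ y : ℝ → V, z ∈ S → y 0 = y₀ ∧ ∀ s ∈ Icc (0 : ℝ) 1,
      HasDerivAt y (Γ (z₀ + s • (z - z₀)) (z - z₀) (y s)) s := by
    intro z
    by_cases hz : z ∈ S
    -- Projection of the parameter to `[0, 1]` extends the coefficient continuously to the line,
    -- since the ray may leave `S` outside this interval.
    · have hc : Continuous fun s : ℝ =>
          Γ (z₀ + (projIcc (0 : ℝ) 1 zero_le_one s : ℝ) • (z - z₀)) (z - z₀) := by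
        refine Continuous.clm_apply (hΓ.comp_continuous ?_ fun s => ?_) continuous_const
        · exact continuous_const.add
            ((continuous_subtype_val.comp continuous_projIcc).smul continuous_const)
        · exact ray_mem hS hz₀ hz (projIcc (0 : ℝ) 1 zero_le_one s).2
      obtain ⟨y, h0, hy⟩ := exists_linear_ode_solution hc y₀
      refine ⟨y, fun _ => ⟨h0, fun s hs => ?_⟩⟩
      have := hy s
      rwa [projIcc_of_mem zero_le_one hs] at this
    · exact ⟨fun _ => 0, fun h => absurd h hz⟩
  choose Y hY using this
  exact ⟨Y, hY⟩

/-- Uniform differentiability near a compact subset of an open set. -/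
theorem exists_uniform_taylor {F : Type*} [NormedAddCommGroup F] [NormedSpace ℝ F]
    [ProperSpace E] {f : E → F} (hS : IsOpen S) (hf : ContDiffOn ℝ 1 f S) {K : Set E}
    (hK : IsCompact K) (hKS : K ⊆ S) {η : ℝ} (hη : 0 < η) :
    ∃ δ > 0, ∀ z ∈ K, ∀ k : E, ‖k‖ ≤ δ →
      ‖f (z + k) - f z - fderiv ℝ f z k‖ ≤ η * ‖k‖ := by
  obtain ⟨r, hr, hrS⟩ := hK.exists_cthickening_subset_open hS hKS
  set K' := Metric.cthickening r K
  have hK' : IsCompact K' := hK.cthickening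
  have hd : ContinuousOn (fderiv ℝ f) K' :=
    (hf.continuousOn_fderiv_of_isOpen hS le_rfl).mono hrS
  obtain ⟨d, hd0, hdη⟩ := Metric.uniformContinuousOn_iff.1
    (hK'.uniformContinuousOn_of_continuous hd) η hη
  refine ⟨min r (d / 2), lt_min hr (half_pos hd0), fun z hz k hk => ?_⟩
  have hball : ∀ x ∈ Metric.closedBall z ‖k‖, x ∈ K' := fun x hx =>
    Metric.mem_cthickening_of_dist_le x z r K hz
      ((Metric.mem_closedBall.1 hx).trans (hk.trans (min_le_left _ _)))
  have hzK' : z ∈ K' := Metric.self_subset_cthickening K hz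
  have := (convex_closedBall z ‖k‖).norm_image_sub_le_of_norm_fderiv_le' (𝕜 := ℝ) (f := f)
    (φ := fderiv ℝ f z) (C := η) (x := z) (y := z + k)
    (fun x hx => (hf.differentiableOn one_ne_zero).differentiableAt
      (hS.mem_nhds (hrS (hball x hx)))) (fun x hx => ?_)
    (Metric.mem_closedBall_self (norm_nonneg k)) (by simp)
  · simpa using this
  · rw [← dist_eq_norm]
    refine (hdη x (hball x hx) z hzK' ?_).le
    exact ((Metric.mem_closedBall.1 hx).trans (hk.trans (min_le_right _ _))).trans_lt
      (half_lt_self hd0)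

set_option maxHeartbeats 1600000 in
/-- The radial solutions of a flat connection are parallel. -/
theorem hasFDerivAt_radial_solution [ProperSpace E] (hSo : IsOpen S) (hS : Convex ℝ S)
    (hz₀ : z₀ ∈ S) (hΓ : ContDiffOn ℝ 1 Γ S)
    (hflat : ∀ z ∈ S, ∀ v h : E, ∀ y : V, fderiv ℝ Γ z v h y + Γ z h (Γ z v y) =
      fderiv ℝ Γ z h v y + Γ z v (Γ z h y)) {y₀ : V} {Y : E → ℝ → V}
    (hY : ∀ z ∈ S, Y z 0 = y₀ ∧ ∀ s ∈ Icc (0 : ℝ) 1,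
      HasDerivAt (Y z) (Γ (z₀ + s • (z - z₀)) (z - z₀) (Y z s)) s) {z : E} (hz : z ∈ S) :
    HasFDerivAt (fun z => Y z 1) ((Γ z).flip (Y z 1)) z := by
  set v := z - z₀ with hv
  set p : ℝ → E := fun s => z₀ + s • v with hp
  have hpc : Continuous p := by fun_prop
  have hpS : ∀ s ∈ Icc (0 : ℝ) 1, p s ∈ S := fun s hs => ray_mem hS hz₀ hz hs
  set C := p '' Icc 0 1 with hC
  have hCc : IsCompact C := isCompact_Icc.image hpc
  have hCS : C ⊆ S := by rintro _ ⟨s, hs, rfl⟩; exact hpS s hs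
  obtain ⟨r, hr, hrS⟩ := hCc.exists_cthickening_subset_open hSo hCS
  have hK' : IsCompact (Metric.cthickening r C) := hCc.cthickening
  obtain ⟨K₀, hK₀⟩ := hK'.exists_bound_of_continuousOn (f := Γ) (hΓ.continuousOn.mono hrS)
  obtain ⟨K₁, hK₁⟩ := hCc.exists_bound_of_continuousOn
    ((hΓ.continuousOn_fderiv_of_isOpen hSo le_rfl).mono hCS)
  -- `K` bounds `Γ` near the ray and `L` bounds its derivative on the ray. `N` bounds `v`, and also
  -- `v + h` when `‖h‖ ≤ 1`. The maxima ensure `1 ≤ K * N`, as Grönwall's inequality asks, and `0 ≤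
  -- L`.
  set K := max K₀ 1
  set L := max K₁ 0
  set N := ‖v‖ + 1 with hN
  have hN1 : 1 ≤ N := by have := norm_nonneg v; linarith
  have hK1 : 1 ≤ K := le_max_right _ _
  have hL0 : 0 ≤ L := le_max_right _ _
  have hKN : 1 ≤ K * N := by nlinarith
  have hΓK : ∀ x ∈ Metric.cthickening r C, ‖Γ x‖ ≤ K := fun x hx => (hK₀ x hx).trans (le_max_left _ _)
  have hΓC : ∀ x ∈ C, ‖Γ x‖ ≤ K := fun x hx => hΓK x (Metric.self_subset_cthickening C hx)
  have hDC : ∀ x ∈ C, ‖fderiv ℝ Γ x‖ ≤ L := fun x hx => (hK₁ x hx).trans (le_max_left _ _)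
  set X := Real.exp (K * N) with hX
  have hX0 : 0 < X := Real.exp_pos _
  -- `B` bounds the solutions along both rays, and `C2` is the Lipschitz constant in `hclose`; both
  -- come from Grönwall's inequality.
  set B := ‖y₀‖ * X with hB
  have hB0 : 0 ≤ B := by positivity
  set C2 := ((L + 1) * N + K) * B * X with hC2
  have hC20 : 0 ≤ C2 := by positivity
  -- the main estimate
  have main : ∀ η : ℝ, 0 < η → η ≤ 1 → ∃ δ > 0, ∀ h : E, ‖h‖ ≤ δ →
      ‖Y (z + h) 1 - Y z 1 - Γ z h (Y z 1)‖ ≤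
        (η * (N * B) + ‖h‖ * (L * N * C2 + L * B + K * C2)) * X * ‖h‖ := by
    intro η hη hη1
    obtain ⟨δ, hδ, hT⟩ := exists_uniform_taylor hSo hΓ hCc hCS hη
    refine ⟨min δ (min r 1), lt_min hδ (lt_min hr one_pos), fun h hh => ?_⟩
    have hhδ : ‖h‖ ≤ δ := hh.trans (min_le_left _ _)
    have hhr : ‖h‖ ≤ r := hh.trans ((min_le_right _ _).trans (min_le_left _ _))
    have hh1 : ‖h‖ ≤ 1 := hh.trans ((min_le_right _ _).trans (min_le_right _ _))
    have hsh : ∀ s ∈ Icc (0 : ℝ) 1, ‖s • h‖ ≤ ‖h‖ := fun s hs => by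
      rw [norm_smul, Real.norm_of_nonneg hs.1]
      exact mul_le_of_le_one_left (norm_nonneg _) hs.2
    have hmem : ∀ s ∈ Icc (0 : ℝ) 1, p s + s • h ∈ Metric.cthickening r C := fun s hs =>
      Metric.mem_cthickening_of_dist_le _ (p s) r C (mem_image_of_mem p hs)
        (by rw [dist_eq_norm, add_sub_cancel_left]; exact (hsh s hs).trans hhr)
    have hzh : z + h ∈ S := by
      have := hrS (hmem 1 ⟨zero_le_one, le_rfl⟩)
      simpa [hp, hv] using this
    obtain ⟨a0, ad⟩ := hY z hz
    obtain ⟨b0, bd⟩ := hY (z + h) hzh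
    set y := Y z with hy
    set x := Y (z + h) with hx
    have hvh : z + h - z₀ = v + h := by rw [hv]; abel
    have hph : ∀ s : ℝ, z₀ + s • (z + h - z₀) = p s + s • h := fun s => by
      rw [hvh, smul_add, hp]; simp only; abel
    simp only [hvh] at hph
    simp only [hvh, hph] at bd
    have hvhN : ‖v + h‖ ≤ N := (norm_add_le _ _).trans (by linarith)
    have hvN : ‖v‖ ≤ N := by linarith
    have bound : ∀ (w : E) (k : E) (Z : V) {c d : ℝ}, ‖Γ w‖ ≤ c → ‖k‖ ≤ d →
        ‖Γ w k Z‖ ≤ c * d * ‖Z‖ := fun w k Z c d hc hd => by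
      refine ((Γ w k).le_opNorm _).trans (mul_le_mul_of_nonneg_right ?_ (norm_nonneg _))
      refine ((Γ w).le_opNorm _).trans (mul_le_mul hc hd (norm_nonneg _) ((norm_nonneg _).trans hc))
    -- bounds on the solutions
    have hyB : ∀ s ∈ Icc (0 : ℝ) 1, ‖y s‖ ≤ B := fun s hs => by
      have := norm_le_of_deriv_le (K := K * N) (ε := 0) (δ := ‖y₀‖) hKN le_rfl (norm_nonneg _) ad
        (by rw [a0]) (fun s hs => by
          rw [add_zero]; exact bound _ _ _ (hΓC _ (mem_image_of_mem p hs)) hvN) s hs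
      rwa [add_zero] at this
    have hxB : ∀ s ∈ Icc (0 : ℝ) 1, ‖x s‖ ≤ B := fun s hs => by
      have := norm_le_of_deriv_le (K := K * N) (ε := 0) (δ := ‖y₀‖) hKN le_rfl (norm_nonneg _) bd
        (by rw [b0]) (fun s hs => by
          rw [add_zero]; exact bound _ _ _ (hΓK _ (hmem s hs)) hvhN) s hs
      rwa [add_zero] at this
    have hlip : ∀ s ∈ Icc (0 : ℝ) 1, ‖Γ (p s + s • h) - Γ (p s)‖ ≤ (L + 1) * ‖h‖ := fun s hs => by
      have h1 := hT (p s) (mem_image_of_mem p hs) (s • h) ((hsh s hs).trans hhδ)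
      have h2 : ‖fderiv ℝ Γ (p s) (s • h)‖ ≤ L * ‖h‖ :=
        ((fderiv ℝ Γ (p s)).le_opNorm _).trans
          (mul_le_mul (hDC _ (mem_image_of_mem p hs)) (hsh s hs) (norm_nonneg _) hL0)
      have h3 : η * ‖s • h‖ ≤ 1 * ‖h‖ := mul_le_mul hη1 (hsh s hs) (norm_nonneg _) zero_le_one
      have h4 := norm_add_le (Γ (p s + s • h) - Γ (p s) - fderiv ℝ Γ (p s) (s • h))
        (fderiv ℝ Γ (p s) (s • h))
      rw [sub_add_cancel] at h4
      linarith
    have hclose : ∀ s ∈ Icc (0 : ℝ) 1, ‖x s - y s‖ ≤ C2 * ‖h‖ := fun s hs => by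
      have := norm_le_of_deriv_le (f := fun s => x s - y s) (K := K * N)
        (ε := ((L + 1) * N + K) * B * ‖h‖) (δ := 0) hKN (by positivity) le_rfl
        (fun s hs => (bd s hs).sub (ad s hs)) (by simp [a0, b0]) (fun s hs => by
          have e : Γ (p s + s • h) (v + h) (x s) - Γ (p s) v (y s) =
              Γ (p s) v (x s - y s) + ((Γ (p s + s • h) - Γ (p s)) (v + h) (x s) +
                Γ (p s) h (x s)) := by
            simp only [map_add, map_sub, _root_.add_apply, _root_.sub_apply]
            abel
          show ‖Γ (p s + s • h) (v + h) (x s) - Γ (p s) v (y s)‖ ≤ _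
          rw [e]
          have n1 := bound (p s) v (x s - y s) (hΓC _ (mem_image_of_mem p hs)) hvN
          have n2 : ‖(Γ (p s + s • h) - Γ (p s)) (v + h) (x s)‖ ≤ (L + 1) * ‖h‖ * N * B := by
            refine (((Γ (p s + s • h) - Γ (p s)) (v + h)).le_opNorm _).trans
              (mul_le_mul ?_ (hxB s hs) (norm_nonneg _) (by positivity))
            exact ((Γ (p s + s • h) - Γ (p s)).le_opNorm _).trans
              (mul_le_mul (hlip s hs) hvhN (norm_nonneg _) (by positivity))
          have n3 : ‖Γ (p s) h (x s)‖ ≤ K * ‖h‖ * B :=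
            (bound (p s) h (x s) (hΓC _ (mem_image_of_mem p hs)) le_rfl).trans
              (mul_le_mul_of_nonneg_left (hxB s hs) (by positivity))
          refine (norm_add_le _ _).trans ((add_le_add n1 (norm_add_le _ _)).trans ?_)
          linarith) s hs
      rw [zero_add] at this
      refine this.trans (le_of_eq ?_)
      rw [hC2]; ring
    have hΓd : ∀ s ∈ Icc (0 : ℝ) 1,
        HasDerivAt (fun s => Γ (p s)) (fderiv ℝ Γ (p s) v) s := fun s hs => by
      have h1 : HasFDerivAt Γ (fderiv ℝ Γ (p s)) (p s) :=
        ((hΓ.differentiableOn one_ne_zero).differentiableAt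
          (hSo.mem_nhds (hpS s hs))).hasFDerivAt
      have h2 : HasDerivAt p v s := by
        have := ((hasDerivAt_id s).smul_const v).const_add z₀
        simpa [hp] using this
      exact h1.comp_hasDerivAt s h2
    -- Moving the endpoint by `h` moves the point at parameter `s` by `s • h`, so the expected first
    -- variation is `s • Γ (p s) h (y s)`. The remainder starts from zero and is shown to solve the
    -- same linear equation up to an error `o(‖h‖)`.
    have hfin := norm_le_of_deriv_le (f := fun s => x s - y s - s • Γ (p s) h (y s)) (K := K * N)
      (ε := (η * (N * B) + ‖h‖ * (L * N * C2 + L * B + K * C2)) * ‖h‖) (δ := 0)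
      (f' := fun s => Γ (p s + s • h) (v + h) (x s) - Γ (p s) v (y s) -
        (s • (fderiv ℝ Γ (p s) v h (y s) + Γ (p s) h (Γ (p s) v (y s))) +
          (1 : ℝ) • Γ (p s) h (y s))) hKN (by positivity) le_rfl
      (fun s hs => by
        have h1 : HasDerivAt (fun s => Γ (p s) h) (fderiv ℝ Γ (p s) v h) s := by
          have := (hΓd s hs).clm_apply (hasDerivAt_const s h)
          simpa using this
        have h2 := h1.clm_apply (ad s hs)
        exact ((bd s hs).sub (ad s hs)).sub ((hasDerivAt_id s).smul h2))
      (by simp [a0, b0]) (fun s hs => by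
        have hps : p s ∈ C := mem_image_of_mem p hs
        -- Flatness exchanges `v` and `h` in the derivative of the candidate variation. This is what
        -- makes it satisfy the linearised equation, whose source contains `fderiv ℝ Γ` in the
        -- direction `h`.
        rw [hflat (p s) (hpS s hs)]
        set D := fderiv ℝ Γ (p s) with hD
        have e : Γ (p s + s • h) (v + h) (x s) - Γ (p s) v (y s) -
            (s • (D h v (y s) + Γ (p s) v (Γ (p s) h (y s))) + (1 : ℝ) • Γ (p s) h (y s)) =
            Γ (p s) v (x s - y s - s • Γ (p s) h (y s)) +
            ((Γ (p s + s • h) - Γ (p s) - D (s • h)) (v + h) (x s) +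
            (s • D h (v + h) (x s - y s) + (s • D h h (y s) + Γ (p s) h (x s - y s)))) := by
          simp only [map_add, map_sub, _root_.add_apply, _root_.sub_apply, map_smul,
            _root_.smul_apply]
          module
        rw [e]
        have n1 := bound (p s) v (x s - y s - s • Γ (p s) h (y s)) (hΓC _ hps) hvN
        have n2 : ‖(Γ (p s + s • h) - Γ (p s) - D (s • h)) (v + h) (x s)‖ ≤ η * ‖h‖ * N * B := by
          refine (((Γ (p s + s • h) - Γ (p s) - D (s • h)) (v + h)).le_opNorm _).trans
            (mul_le_mul ?_ (hxB s hs) (norm_nonneg _) (by positivity))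
          refine ((Γ (p s + s • h) - Γ (p s) - D (s • h)).le_opNorm _).trans
            (mul_le_mul ?_ hvhN (norm_nonneg _) (by positivity))
          exact (hT (p s) hps (s • h) ((hsh s hs).trans hhδ)).trans
            (mul_le_mul_of_nonneg_left (hsh s hs) hη.le)
        have bD : ∀ (k : E) (Z : V) {d : ℝ}, ‖k‖ ≤ d → ‖s • D h k Z‖ ≤ L * ‖h‖ * d * ‖Z‖ := by
          intro k Z d hd
          rw [norm_smul, Real.norm_of_nonneg hs.1]
          refine (mul_le_of_le_one_left (norm_nonneg _) hs.2).trans ?_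
          refine ((D h k).le_opNorm _).trans (mul_le_mul_of_nonneg_right ?_ (norm_nonneg _))
          refine ((D h).le_opNorm _).trans (mul_le_mul ?_ hd (norm_nonneg _) (by positivity))
          exact (D.le_opNorm _).trans (mul_le_mul_of_nonneg_right (hDC _ hps) (norm_nonneg _))
        have n3 : ‖s • D h (v + h) (x s - y s)‖ ≤ L * ‖h‖ * N * (C2 * ‖h‖) :=
          (bD _ _ hvhN).trans (mul_le_mul_of_nonneg_left (hclose s hs) (by positivity))
        have n4 : ‖s • D h h (y s)‖ ≤ L * ‖h‖ * ‖h‖ * B :=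
          (bD _ _ le_rfl).trans (mul_le_mul_of_nonneg_left (hyB s hs) (by positivity))
        have n5 : ‖Γ (p s) h (x s - y s)‖ ≤ K * ‖h‖ * (C2 * ‖h‖) :=
          (bound (p s) h _ (hΓC _ hps) le_rfl).trans
            (mul_le_mul_of_nonneg_left (hclose s hs) (by positivity))
        refine (norm_add_le _ _).trans ((add_le_add n1 ((norm_add_le _ _).trans
          (add_le_add n2 ((norm_add_le _ _).trans (add_le_add n3 ((norm_add_le _ _).trans
            (add_le_add n4 n5))))))).trans ?_)
        refine le_of_eq ?_
        ring) 1 ⟨zero_le_one, le_rfl⟩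
    have hp1 : p 1 = z := by simp [hp, hv]
    simp only [hp1, one_smul, zero_add] at hfin
    refine hfin.trans (le_of_eq ?_)
    ring
  rw [hasFDerivAt_iff_isLittleO_nhds_zero, Asymptotics.isLittleO_iff]
  intro ε hε
  set A := N * B * X with hA
  set A' := (L * N * C2 + L * B + K * C2) * X with hA'
  have hA0 : 0 ≤ A := by positivity
  have hA'0 : 0 ≤ A' := by positivity
  obtain ⟨δ, hδ, hmain⟩ := main (min 1 (ε / (2 * (A + 1)))) (by positivity) (min_le_left _ _)
  have hsmall : 0 < min δ (ε / (2 * (A' + 1))) := by positivity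
  filter_upwards [Metric.closedBall_mem_nhds (0 : E) hsmall] with h hh
  rw [mem_closedBall_zero_iff] at hh
  refine (hmain h (hh.trans (min_le_left _ _))).trans
    (mul_le_mul_of_nonneg_right ?_ (norm_nonneg _))
  have h1 : min 1 (ε / (2 * (A + 1))) * A ≤ ε / 2 := by
    calc _ ≤ ε / (2 * (A + 1)) * A := mul_le_mul_of_nonneg_right (min_le_right _ _) hA0
      _ ≤ ε / 2 := by
        rw [div_mul_eq_mul_div, div_le_div_iff₀ (by positivity) (by norm_num)]; nlinarith
  have h2 : ‖h‖ * A' ≤ ε / 2 := by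
    calc _ ≤ ε / (2 * (A' + 1)) * A' :=
        mul_le_mul_of_nonneg_right (hh.trans (min_le_right _ _)) hA'0
      _ ≤ ε / 2 := by
        rw [div_mul_eq_mul_div, div_le_div_iff₀ (by positivity) (by norm_num)]; nlinarith
  calc _ = min 1 (ε / (2 * (A + 1))) * A + ‖h‖ * A' := by rw [hA, hA']; ring
    _ ≤ ε := by linarith

/-- A smooth flat connection on a convex open set has parallel sections with any given value at a
given point. -/
theorem exists_parallel_section [ProperSpace E] [CompleteSpace V] (hSo : IsOpen S)
    (hS : Convex ℝ S) (hz₀ : z₀ ∈ S) (hΓ : ContDiffOn ℝ ∞ Γ S)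
    (hflat : ∀ z ∈ S, ∀ v h : E, ∀ y : V, fderiv ℝ Γ z v h y + Γ z h (Γ z v y) =
      fderiv ℝ Γ z h v y + Γ z v (Γ z h y)) (y₀ : V) :
    ∃ y : E → V, y z₀ = y₀ ∧ ContDiffOn ℝ ∞ y S ∧
      ∀ z ∈ S, HasFDerivAt y ((Γ z).flip (y z)) z := by
  obtain ⟨Y, hY⟩ := exists_radial_solution hS hz₀ hΓ.continuousOn y₀
  have hd : ∀ z ∈ S, HasFDerivAt (fun z => Y z 1) ((Γ z).flip (Y z 1)) z := fun z hz =>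
    hasFDerivAt_radial_solution hSo hS hz₀ (hΓ.of_le (by simp)) hflat hY hz
  refine ⟨fun z => Y z 1, ?_, ?_, hd⟩
  · obtain ⟨h0, h1⟩ := hY z₀ hz₀
    -- The ray from `z₀` to itself is constant, so the transport does not move `y₀`.
    have := norm_le_of_deriv_le (f := fun s => Y z₀ s - y₀) (K := 1) (ε := 0) (δ := 0) le_rfl le_rfl
      le_rfl (fun s hs => (h1 s hs).sub_const y₀) (by simp [h0]) (fun s hs => by
        simp) 1 ⟨zero_le_one, le_rfl⟩
    simpa [sub_eq_zero] using this
  · rw [contDiffOn_infty]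
    intro n
    -- Bootstrap: the derivative is bilinear in `Γ` and the section, hence as regular as the
    -- section, which gains one order per step.
    induction n with
    | zero =>
      refine contDiffOn_zero.2 fun z hz => (hd z hz).continuousAt.continuousWithinAt
    | succ n ih =>
      rw [Nat.cast_succ, contDiffOn_succ_iff_fderiv_of_isOpen hSo]
      refine ⟨fun z hz => (hd z hz).differentiableAt.differentiableWithinAt, by simp, ?_⟩
      have h1 : ContDiffOn ℝ n (fun z => (Γ z).flip (Y z 1)) S := by
        have h2 : ContDiffOn ℝ n (fun z => (Γ z).flip) S :=
          (ContinuousLinearMap.flipₗᵢ ℝ E V V).toContinuousLinearEquiv.contDiff.comp_contDiffOn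
            (contDiffOn_infty.1 hΓ n)
        exact h2.clm_apply ih
      exact h1.congr fun z hz => (hd z hz).fderiv

end FlatConnection

/-! ### Smooth frames of smooth solutions of the NLS. -/

/-- `(u, e, f)` is a smooth orthonormal positively oriented frame on the slab, with
`∂_x u = a₁ e + a₂ f`, `∂_x e = -a₁ u`, `∂_x f = -a₂ u` and
`∂_t u = p₁ e + p₂ f`, `∂_t e = -p₁ u - c f`, `∂_t f = -p₂ u + c e`. -/
structure IsSmoothFrame (T : ℝ) (a₁ a₂ p₁ p₂ c : ℝ × ℝ → ℝ) (u e f : ℝ × ℝ → E3) : Prop where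
  smooth_u : ContDiffOn ℝ ∞ u (slab T)
  smooth_e : ContDiffOn ℝ ∞ e (slab T)
  smooth_f : ContDiffOn ℝ ∞ f (slab T)
  ortho : ∀ z ∈ slab T, IsOrthoPair (u z) (e z)
  f_eq : ∀ z ∈ slab T, f z = cross (u z) (e z)
  dx_u : ∀ z ∈ slab T, dx u z = a₁ z • e z + a₂ z • f z
  dx_e : ∀ z ∈ slab T, dx e z = -(a₁ z • u z)
  dx_f : ∀ z ∈ slab T, dx f z = -(a₂ z • u z)
  dt_u : ∀ z ∈ slab T, dt u z = p₁ z • e z + p₂ z • f z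
  dt_e : ∀ z ∈ slab T, dt e z = -(p₁ z • u z) - c z • f z
  dt_f : ∀ z ∈ slab T, dt f z = -(p₂ z • u z) + c z • e z

theorem fderiv_apply_eq {F : Type*} [NormedAddCommGroup F] [NormedSpace ℝ F] (w : ℝ × ℝ → F)
    (z v : ℝ × ℝ) : fderiv ℝ w z v = v.1 • dt w z + v.2 • dx w z := by
  have : v = v.1 • ((1 : ℝ), (0 : ℝ)) + v.2 • ((0 : ℝ), (1 : ℝ)) := by ext <;> simp
  conv_lhs => rw [this]
  rw [map_add, map_smul, map_smul]
  rfl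

section Rows

/-- The generators of the rotations of a frame `(u, e, f)`, in the planes `(u, e)`, `(u, f)` and
`(e, f)`. -/
def rotGen₁ : E3 × E3 × E3 →L[ℝ] E3 × E3 × E3 :=
  ((ContinuousLinearMap.fst ℝ E3 E3).comp (ContinuousLinearMap.snd ℝ E3 (E3 × E3))).prod
    ((-ContinuousLinearMap.fst ℝ E3 (E3 × E3)).prod 0)

def rotGen₂ : E3 × E3 × E3 →L[ℝ] E3 × E3 × E3 :=
  ((ContinuousLinearMap.snd ℝ E3 E3).comp (ContinuousLinearMap.snd ℝ E3 (E3 × E3))).prod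
    ((0 : E3 × E3 × E3 →L[ℝ] E3).prod (-ContinuousLinearMap.fst ℝ E3 (E3 × E3)))

def rotGen₃ : E3 × E3 × E3 →L[ℝ] E3 × E3 × E3 :=
  (0 : E3 × E3 × E3 →L[ℝ] E3).prod
    ((-(ContinuousLinearMap.snd ℝ E3 E3).comp (ContinuousLinearMap.snd ℝ E3 (E3 × E3))).prod
      ((ContinuousLinearMap.fst ℝ E3 E3).comp (ContinuousLinearMap.snd ℝ E3 (E3 × E3))))

theorem rotGen₁_apply (y : E3 × E3 × E3) : rotGen₁ y = (y.2.1, -y.1, 0) := rfl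
theorem rotGen₂_apply (y : E3 × E3 × E3) : rotGen₂ y = (y.2.2, 0, -y.1) := rfl
theorem rotGen₃_apply (y : E3 × E3 × E3) : rotGen₃ y = (0, -y.2.2, y.2.1) := rfl

end Rows

section Connection

set_option maxSynthPendingDepth 3

/-- The connection form of the frame system. -/
def frameConnection (a₁ a₂ p₁ p₂ c : ℝ × ℝ → ℝ) (z : ℝ × ℝ) :
    ℝ × ℝ →L[ℝ] (E3 × E3 × E3 →L[ℝ] E3 × E3 × E3) :=
  p₁ z • (ContinuousLinearMap.fst ℝ ℝ ℝ).smulRight rotGen₁ +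
  p₂ z • (ContinuousLinearMap.fst ℝ ℝ ℝ).smulRight rotGen₂ +
  c z • (ContinuousLinearMap.fst ℝ ℝ ℝ).smulRight rotGen₃ +
  a₁ z • (ContinuousLinearMap.snd ℝ ℝ ℝ).smulRight rotGen₁ +
  a₂ z • (ContinuousLinearMap.snd ℝ ℝ ℝ).smulRight rotGen₂

variable {a₁ a₂ p₁ p₂ c : ℝ × ℝ → ℝ}

theorem frameConnection_apply (z v : ℝ × ℝ) (y : E3 × E3 × E3) :
    frameConnection a₁ a₂ p₁ p₂ c z v y =
      ((v.1 * p₁ z + v.2 * a₁ z) • y.2.1 + (v.1 * p₂ z + v.2 * a₂ z) • y.2.2,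
        -((v.1 * p₁ z + v.2 * a₁ z) • y.1) - (v.1 * c z) • y.2.2,
        -((v.1 * p₂ z + v.2 * a₂ z) • y.1) + (v.1 * c z) • y.2.1) := by
  simp only [frameConnection, _root_.add_apply, _root_.smul_apply,
    ContinuousLinearMap.smulRight_apply, ContinuousLinearMap.coe_fst', ContinuousLinearMap.coe_snd',
    rotGen₁_apply, rotGen₂_apply, rotGen₃_apply, Prod.smul_mk, Prod.mk_add_mk]
  refine Prod.ext ?_ (Prod.ext ?_ ?_) <;> simp only <;> module

theorem contDiffOn_frameConnection {S : Set (ℝ × ℝ)} (h1 : ContDiffOn ℝ ∞ a₁ S)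
    (h2 : ContDiffOn ℝ ∞ a₂ S) (h3 : ContDiffOn ℝ ∞ p₁ S) (h4 : ContDiffOn ℝ ∞ p₂ S)
    (h5 : ContDiffOn ℝ ∞ c S) : ContDiffOn ℝ ∞ (frameConnection a₁ a₂ p₁ p₂ c) S :=
  ((((h3.smul contDiffOn_const).add (h4.smul contDiffOn_const)).add
    (h5.smul contDiffOn_const)).add (h1.smul contDiffOn_const)).add (h2.smul contDiffOn_const)

/-- The connection form depends linearly on its five coefficients, so differentiating it amounts to
differentiating them. -/
theorem fderiv_frameConnection {z : ℝ × ℝ} (h1 : DifferentiableAt ℝ a₁ z)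
    (h2 : DifferentiableAt ℝ a₂ z) (h3 : DifferentiableAt ℝ p₁ z) (h4 : DifferentiableAt ℝ p₂ z)
    (h5 : DifferentiableAt ℝ c z) (v : ℝ × ℝ) :
    fderiv ℝ (frameConnection a₁ a₂ p₁ p₂ c) z v =
      frameConnection (fun z => fderiv ℝ a₁ z v) (fun z => fderiv ℝ a₂ z v)
        (fun z => fderiv ℝ p₁ z v) (fun z => fderiv ℝ p₂ z v) (fun z => fderiv ℝ c z v) z := by
  have := (((((h3.hasFDerivAt.smul_const ((ContinuousLinearMap.fst ℝ ℝ ℝ).smulRight rotGen₁)).add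
    (h4.hasFDerivAt.smul_const ((ContinuousLinearMap.fst ℝ ℝ ℝ).smulRight rotGen₂))).add
    (h5.hasFDerivAt.smul_const ((ContinuousLinearMap.fst ℝ ℝ ℝ).smulRight rotGen₃))).add
    (h1.hasFDerivAt.smul_const ((ContinuousLinearMap.snd ℝ ℝ ℝ).smulRight rotGen₁))).add
    (h2.hasFDerivAt.smul_const ((ContinuousLinearMap.snd ℝ ℝ ℝ).smulRight rotGen₂)))
  have h6 : HasFDerivAt (frameConnection a₁ a₂ p₁ p₂ c) _ z := this
  rw [h6.fderiv]
  rfl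

/-- The connection of the frame system is flat if the compatibility conditions hold. -/
theorem frameConnection_flat {z : ℝ × ℝ} (h1 : DifferentiableAt ℝ a₁ z)
    (h2 : DifferentiableAt ℝ a₂ z) (h3 : DifferentiableAt ℝ p₁ z) (h4 : DifferentiableAt ℝ p₂ z)
    (h5 : DifferentiableAt ℝ c z)
    (e1 : dx p₁ z = dt a₁ z + c z * a₂ z) (e2 : dx p₂ z = dt a₂ z - c z * a₁ z)
    (e3 : dx c z = a₁ z * p₂ z - a₂ z * p₁ z) (v h : ℝ × ℝ) (y : E3 × E3 × E3) :
    fderiv ℝ (frameConnection a₁ a₂ p₁ p₂ c) z v h y +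
      frameConnection a₁ a₂ p₁ p₂ c z h (frameConnection a₁ a₂ p₁ p₂ c z v y) =
    fderiv ℝ (frameConnection a₁ a₂ p₁ p₂ c) z h v y +
      frameConnection a₁ a₂ p₁ p₂ c z v (frameConnection a₁ a₂ p₁ p₂ c z h y) := by
  rw [fderiv_frameConnection h1 h2 h3 h4 h5, fderiv_frameConnection h1 h2 h3 h4 h5]
  simp only [frameConnection_apply, fderiv_apply_eq, smul_eq_mul, e1, e2, e3, Prod.mk_add_mk]
  refine Prod.ext ?_ (Prod.ext ?_ ?_) <;> simp only <;> module

end Connection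

theorem convex_slab (T : ℝ) : Convex ℝ (slab T : Set (ℝ × ℝ)) :=
  (convex_Ioo _ _).prod convex_univ

theorem eq_of_fderiv_eq_zero_slab {T : ℝ} {g : ℝ × ℝ → ℝ} (hg : DifferentiableOn ℝ g (slab T))
    (h : ∀ z ∈ slab T, dt g z = 0 ∧ dx g z = 0) {z z₀ : ℝ × ℝ} (hz : z ∈ slab T)
    (hz₀ : z₀ ∈ slab T) : g z = g z₀ :=
  (slab T).isOpen.is_const_of_fderiv_eq_zero (𝕜 := ℝ) (convex_slab T).isPreconnected hg
    (fun y hy => fderiv_eq_zero_of_dt_dx (h y hy).1 (h y hy).2) hz hz₀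

theorem dx_coord {w : ℝ × ℝ → E3} {z : ℝ × ℝ} (hw : DifferentiableAt ℝ w z) (i : Fin 3) :
    dx (fun z => w z i) z = dx w z i := by
  have := ((EuclideanSpace.proj i : E3 →L[ℝ] ℝ).hasFDerivAt.comp z
    hw.hasFDerivAt).fderiv
  exact congrArg (fun L => L (0, 1)) this

theorem dt_coord {w : ℝ × ℝ → E3} {z : ℝ × ℝ} (hw : DifferentiableAt ℝ w z) (i : Fin 3) :
    dt (fun z => w z i) z = dt w z i := by
  have := ((EuclideanSpace.proj i : E3 →L[ℝ] ℝ).hasFDerivAt.comp z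
    hw.hasFDerivAt).fderiv
  exact congrArg (fun L => L (1, 0)) this

theorem dx_add {f g : ℝ × ℝ → ℝ} {z : ℝ × ℝ} (hf : DifferentiableAt ℝ f z)
    (hg : DifferentiableAt ℝ g z) : dx (fun z => f z + g z) z = dx f z + dx g z := by
  simp only [dx, fderiv_fun_add hf hg, _root_.add_apply]

theorem dt_add {f g : ℝ × ℝ → ℝ} {z : ℝ × ℝ} (hf : DifferentiableAt ℝ f z)
    (hg : DifferentiableAt ℝ g z) : dt (fun z => f z + g z) z = dt f z + dt g z := by
  simp only [dt, fderiv_fun_add hf hg, _root_.add_apply]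

/-- If the columns of `(u, e, f)` are orthonormal, and `(u, e, f)` has determinant `1`, then
`(u, e)` is orthonormal and `f = u × e`. -/
theorem isOrthoPair_of_columns {u e f : E3}
    (h : ∀ i j, u i * u j + e i * e j + f i * f j = (1 : Matrix (Fin 3) (Fin 3) ℝ) i j)
    (hdet : f 0 * (u 1 * e 2 - u 2 * e 1) + f 1 * (u 2 * e 0 - u 0 * e 2) +
      f 2 * (u 0 * e 1 - u 1 * e 0) = 1) : IsOrthoPair u e ∧ f = cross u e := by
  set M : Matrix (Fin 3) (Fin 3) ℝ := Matrix.of ![u.ofLp, e.ofLp, f.ofLp] with hM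
  have h1 : Mᵀ * M = 1 := by
    ext i j
    rw [← h i j]
    simp [hM, Matrix.mul_apply, Fin.sum_univ_three]
  have h2 : M * Mᵀ = 1 := mul_eq_one_comm.1 h1
  have entry : ∀ i j, M i 0 * M j 0 + M i 1 * M j 1 + M i 2 * M j 2 =
      (1 : Matrix (Fin 3) (Fin 3) ℝ) i j := fun i j => by
    rw [← h2]; simp [Matrix.mul_apply, Fin.sum_univ_three]
  have uu := entry 0 0
  have ee := entry 1 1
  have ff := entry 2 2
  have ue := entry 0 1
  simp [hM] at uu ee ff ue
  have ho : IsOrthoPair u e := by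
    refine ⟨?_, ?_, ?_⟩
    · rw [← pow_eq_one_iff_of_nonneg (norm_nonneg _) two_ne_zero, E3.norm_sq]; linarith
    · rw [← pow_eq_one_iff_of_nonneg (norm_nonneg _) two_ne_zero, E3.norm_sq]; linarith
    · rw [E3.inner_eq]; exact ue
  refine ⟨ho, ?_⟩
  have h3 := E3.norm_sq (cross u e)
  rw [ho.norm_cross] at h3
  have c0 : cross u e 0 = u 1 * e 2 - u 2 * e 1 := cross_apply_add u e 0
  have c1 : cross u e 1 = u 2 * e 0 - u 0 * e 2 := cross_apply_add u e 1
  have c2 : cross u e 2 = u 0 * e 1 - u 1 * e 0 := cross_apply_add u e 2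
  rw [← c0, ← c1, ← c2] at hdet
  -- `|f - u × e|² = |f|² - 2 f · (u × e) + |u × e|² = 1 - 2 + 1`: the determinant fixes the sign.
  have h4 : ‖f - cross u e‖ ^ 2 = 0 := by
    rw [E3.norm_sq]
    simp only [PiLp.sub_apply]
    linear_combination ff - 2 * hdet - h3
  exact sub_eq_zero.1 (norm_eq_zero.1 (pow_eq_zero_iff two_ne_zero |>.1 h4))

/-- The three compatibility conditions are the flatness of the connection. Its values are
infinitesimal rotations, so a parallel section that starts as the standard basis remains orthonormal
and positively oriented. -/
theorem exists_smooth_frame {T : ℝ} {a₁ a₂ p₁ p₂ c : ℝ × ℝ → ℝ} (h1 : ContDiffOn ℝ ∞ a₁ (slab T))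
    (h2 : ContDiffOn ℝ ∞ a₂ (slab T)) (h3 : ContDiffOn ℝ ∞ p₁ (slab T))
    (h4 : ContDiffOn ℝ ∞ p₂ (slab T)) (h5 : ContDiffOn ℝ ∞ c (slab T))
    (e1 : ∀ z ∈ slab T, dx p₁ z = dt a₁ z + c z * a₂ z)
    (e2 : ∀ z ∈ slab T, dx p₂ z = dt a₂ z - c z * a₁ z)
    (e3 : ∀ z ∈ slab T, dx c z = a₁ z * p₂ z - a₂ z * p₁ z) {z₀ : ℝ × ℝ} (hz₀ : z₀ ∈ slab T) :
    ∃ u e f : ℝ × ℝ → E3, IsSmoothFrame T a₁ a₂ p₁ p₂ c u e f ∧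
      u z₀ = EuclideanSpace.single 0 1 ∧ e z₀ = EuclideanSpace.single 1 1 := by
  have da : ∀ {F : Type} [NormedAddCommGroup F] [NormedSpace ℝ F] {g : ℝ × ℝ → F},
      ContDiffOn ℝ ∞ g (slab T) → ∀ z ∈ slab T, DifferentiableAt ℝ g z := fun hg z hz =>
    (hg.differentiableOn (by simp)).differentiableAt ((slab T).isOpen.mem_nhds hz)
  obtain ⟨y, hy0, hys, hyd⟩ := exists_parallel_section (slab T).isOpen (convex_slab T) hz₀
    (contDiffOn_frameConnection h1 h2 h3 h4 h5)
    (fun z hz => frameConnection_flat (da h1 z hz) (da h2 z hz) (da h3 z hz) (da h4 z hz)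
      (da h5 z hz) (e1 z hz) (e2 z hz) (e3 z hz))
    ((EuclideanSpace.single 0 1, EuclideanSpace.single 1 1, EuclideanSpace.single 2 1) :
      E3 × E3 × E3)
  set u : ℝ × ℝ → E3 := fun z => (y z).1
  set e : ℝ × ℝ → E3 := fun z => (y z).2.1
  set f : ℝ × ℝ → E3 := fun z => (y z).2.2
  have su : ContDiffOn ℝ ∞ u (slab T) := contDiff_fst.comp_contDiffOn hys
  have se : ContDiffOn ℝ ∞ e (slab T) := (contDiff_fst.comp contDiff_snd).comp_contDiffOn hys
  have sf : ContDiffOn ℝ ∞ f (slab T) := (contDiff_snd.comp contDiff_snd).comp_contDiffOn hys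
  have dy : ∀ z ∈ slab T, ∀ v, fderiv ℝ u z v = (frameConnection a₁ a₂ p₁ p₂ c z v (y z)).1 ∧
      fderiv ℝ e z v = (frameConnection a₁ a₂ p₁ p₂ c z v (y z)).2.1 ∧
      fderiv ℝ f z v = (frameConnection a₁ a₂ p₁ p₂ c z v (y z)).2.2 := by
    intro z hz v
    have hu := ((ContinuousLinearMap.fst ℝ E3 (E3 × E3)).hasFDerivAt.comp z (hyd z hz)).fderiv
    have he := (((ContinuousLinearMap.fst ℝ E3 E3).comp
      (ContinuousLinearMap.snd ℝ E3 (E3 × E3))).hasFDerivAt.comp z (hyd z hz)).fderiv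
    have hf := (((ContinuousLinearMap.snd ℝ E3 E3).comp
      (ContinuousLinearMap.snd ℝ E3 (E3 × E3))).hasFDerivAt.comp z (hyd z hz)).fderiv
    exact ⟨congrArg (fun L => L v) hu, congrArg (fun L => L v) he, congrArg (fun L => L v) hf⟩
  have xu : ∀ z ∈ slab T, dx u z = a₁ z • e z + a₂ z • f z := fun z hz => by
    rw [dx, (dy z hz _).1, frameConnection_apply]; simp [e, f]
  have xe : ∀ z ∈ slab T, dx e z = -(a₁ z • u z) := fun z hz => by
    rw [dx, (dy z hz _).2.1, frameConnection_apply]; simp [u]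
  have xf : ∀ z ∈ slab T, dx f z = -(a₂ z • u z) := fun z hz => by
    rw [dx, (dy z hz _).2.2, frameConnection_apply]; simp [u]
  have tu : ∀ z ∈ slab T, dt u z = p₁ z • e z + p₂ z • f z := fun z hz => by
    rw [dt, (dy z hz _).1, frameConnection_apply]; simp [e, f]
  have te : ∀ z ∈ slab T, dt e z = -(p₁ z • u z) - c z • f z := fun z hz => by
    rw [dt, (dy z hz _).2.1, frameConnection_apply]; simp [u, f]
  have tf : ∀ z ∈ slab T, dt f z = -(p₂ z • u z) + c z • e z := fun z hz => by
    rw [dt, (dy z hz _).2.2, frameConnection_apply]; simp [u, e]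
  have cd : ∀ {w : ℝ × ℝ → E3}, ContDiffOn ℝ ∞ w (slab T) → ∀ i, ∀ z ∈ slab T,
      DifferentiableAt ℝ (fun z => w z i) z := fun hw i z hz =>
    (EuclideanSpace.proj i : E3 →L[ℝ] ℝ).differentiableAt.comp z (da hw z hz)
  have xui : ∀ z ∈ slab T, ∀ i, dx (fun z => u z i) z = a₁ z * e z i + a₂ z * f z i :=
    fun z hz i => by rw [dx_coord (da su z hz), xu z hz]; simp
  have xei : ∀ z ∈ slab T, ∀ i, dx (fun z => e z i) z = -(a₁ z * u z i) :=
    fun z hz i => by rw [dx_coord (da se z hz), xe z hz]; simp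
  have xfi : ∀ z ∈ slab T, ∀ i, dx (fun z => f z i) z = -(a₂ z * u z i) :=
    fun z hz i => by rw [dx_coord (da sf z hz), xf z hz]; simp
  have tui : ∀ z ∈ slab T, ∀ i, dt (fun z => u z i) z = p₁ z * e z i + p₂ z * f z i :=
    fun z hz i => by rw [dt_coord (da su z hz), tu z hz]; simp
  have tei : ∀ z ∈ slab T, ∀ i, dt (fun z => e z i) z = -(p₁ z * u z i) - c z * f z i :=
    fun z hz i => by rw [dt_coord (da se z hz), te z hz]; simp
  have tfi : ∀ z ∈ slab T, ∀ i, dt (fun z => f z i) z = -(p₂ z * u z i) + c z * e z i :=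
    fun z hz i => by rw [dt_coord (da sf z hz), tf z hz]; simp
  -- The products of columns have identically vanishing derivatives, whereas the inner products of
  -- the frame vectors would only solve a linear system and need a further uniqueness argument.
  have hcol : ∀ z ∈ slab T, ∀ i j, u z i * u z j + e z i * e z j + f z i * f z j =
      (1 : Matrix (Fin 3) (Fin 3) ℝ) i j := by
    intro z hz i j
    have d1 : ∀ z ∈ slab T, DifferentiableAt ℝ (fun z => u z i * u z j) z := fun z hz =>
      (cd su i z hz).mul (cd su j z hz)
    have d2 : ∀ z ∈ slab T, DifferentiableAt ℝ (fun z => e z i * e z j) z := fun z hz =>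
      (cd se i z hz).mul (cd se j z hz)
    have d3 : ∀ z ∈ slab T, DifferentiableAt ℝ (fun z => f z i * f z j) z := fun z hz =>
      (cd sf i z hz).mul (cd sf j z hz)
    have := eq_of_fderiv_eq_zero_slab (g := fun z => u z i * u z j + e z i * e z j + f z i * f z j)
      (fun z hz => (((d1 z hz).fun_add (d2 z hz)).add (d3 z hz)).differentiableWithinAt)
      (fun z hz => by
        constructor
        · rw [dt_add ((d1 z hz).fun_add (d2 z hz)) (d3 z hz), dt_add (d1 z hz) (d2 z hz),
            dt_mul (cd su i z hz) (cd su j z hz), dt_mul (cd se i z hz) (cd se j z hz),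
            dt_mul (cd sf i z hz) (cd sf j z hz)]
          simp only [tui z hz, tei z hz, tfi z hz]; ring
        · rw [dx_add ((d1 z hz).fun_add (d2 z hz)) (d3 z hz), dx_add (d1 z hz) (d2 z hz),
            dx_mul (cd su i z hz) (cd su j z hz), dx_mul (cd se i z hz) (cd se j z hz),
            dx_mul (cd sf i z hz) (cd sf j z hz)]
          simp only [xui z hz, xei z hz, xfi z hz]; ring) hz hz₀
    rw [this]
    simp only [u, e, f, hy0]
    obtain rfl | rfl | rfl := fin3_cases i <;> obtain rfl | rfl | rfl := fin3_cases j <;> simp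
  have hdet : ∀ z ∈ slab T, f z 0 * (u z 1 * e z 2 - u z 2 * e z 1) +
      f z 1 * (u z 2 * e z 0 - u z 0 * e z 2) + f z 2 * (u z 0 * e z 1 - u z 1 * e z 0) = 1 := by
    intro z hz
    have m : ∀ i j, ∀ z ∈ slab T, DifferentiableAt ℝ (fun z => u z i * e z j) z :=
      fun i j z hz => (cd su i z hz).mul (cd se j z hz)
    -- The minors are written as `uᵢ eⱼ + eᵢ (-uⱼ)`, so that the sum and product rules suffice to
    -- differentiate the determinant.
    have m' : ∀ i j, ∀ z ∈ slab T, DifferentiableAt ℝ (fun z => e z i * -u z j) z :=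
      fun i j z hz => (cd se i z hz).mul (cd su j z hz).fun_neg
    have g : ∀ i j, ∀ z ∈ slab T,
        DifferentiableAt ℝ (fun z => u z i * e z j + e z i * -u z j) z :=
      fun i j z hz => (m i j z hz).add (m' i j z hz)
    have k : ∀ l i j, ∀ z ∈ slab T,
        DifferentiableAt ℝ (fun z => f z l * (u z i * e z j + e z i * -u z j)) z :=
      fun l i j z hz => (cd sf l z hz).mul (g i j z hz)
    have tn : ∀ z ∈ slab T, ∀ i, dt (fun z => -u z i) z = -(p₁ z * e z i + p₂ z * f z i) :=
      fun z hz i => by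
        rw [← tui z hz]; simp [dt]
    have xn : ∀ z ∈ slab T, ∀ i, dx (fun z => -u z i) z = -(a₁ z * e z i + a₂ z * f z i) :=
      fun z hz i => by
        rw [← xui z hz]; simp [dx]
    have tk : ∀ z ∈ slab T, ∀ l i j,
        dt (fun z => f z l * (u z i * e z j + e z i * -u z j)) z =
        dt (fun z => f z l) z * (u z i * e z j + e z i * -u z j) +
        f z l * (dt (fun z => u z i) z * e z j + u z i * dt (fun z => e z j) z +
          (dt (fun z => e z i) z * -u z j + e z i * dt (fun z => -u z j) z)) :=
      fun z hz l i j => by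
        rw [dt_mul (cd sf l z hz) (g i j z hz), dt_add (m i j z hz) (m' i j z hz),
          dt_mul (cd su i z hz) (cd se j z hz), dt_mul (cd se i z hz) (cd su j z hz).fun_neg]
    have xk : ∀ z ∈ slab T, ∀ l i j,
        dx (fun z => f z l * (u z i * e z j + e z i * -u z j)) z =
        dx (fun z => f z l) z * (u z i * e z j + e z i * -u z j) +
        f z l * (dx (fun z => u z i) z * e z j + u z i * dx (fun z => e z j) z +
          (dx (fun z => e z i) z * -u z j + e z i * dx (fun z => -u z j) z)) :=
      fun z hz l i j => by
        rw [dx_mul (cd sf l z hz) (g i j z hz), dx_add (m i j z hz) (m' i j z hz),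
          dx_mul (cd su i z hz) (cd se j z hz), dx_mul (cd se i z hz) (cd su j z hz).fun_neg]
    have := eq_of_fderiv_eq_zero_slab
      (g := fun z => f z 0 * (u z 1 * e z 2 + e z 1 * -u z 2) +
        f z 1 * (u z 2 * e z 0 + e z 2 * -u z 0) + f z 2 * (u z 0 * e z 1 + e z 0 * -u z 1))
      (fun z hz => (((k 0 1 2 z hz).fun_add (k 1 2 0 z hz)).add (k 2 0 1 z hz)).differentiableWithinAt)
      (fun z hz => by
        constructor
        · rw [dt_add ((k 0 1 2 z hz).fun_add (k 1 2 0 z hz)) (k 2 0 1 z hz),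
            dt_add (k 0 1 2 z hz) (k 1 2 0 z hz), tk z hz, tk z hz, tk z hz]
          simp only [tui z hz, tei z hz, tfi z hz, tn z hz]; ring
        · rw [dx_add ((k 0 1 2 z hz).fun_add (k 1 2 0 z hz)) (k 2 0 1 z hz),
            dx_add (k 0 1 2 z hz) (k 1 2 0 z hz), xk z hz, xk z hz, xk z hz]
          simp only [xui z hz, xei z hz, xfi z hz, xn z hz]; ring) hz hz₀
    have h0 : f z 0 * (u z 1 * e z 2 - u z 2 * e z 1) +
        f z 1 * (u z 2 * e z 0 - u z 0 * e z 2) + f z 2 * (u z 0 * e z 1 - u z 1 * e z 0) =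
        f z 0 * (u z 1 * e z 2 + e z 1 * -u z 2) +
        f z 1 * (u z 2 * e z 0 + e z 2 * -u z 0) + f z 2 * (u z 0 * e z 1 + e z 0 * -u z 1) := by
      ring
    rw [h0]
    refine this.trans ?_
    simp [u, e, f, hy0]
  have hres := fun z hz => isOrthoPair_of_columns (hcol z hz) (hdet z hz)
  refine ⟨u, e, f, ⟨su, se, sf, fun z hz => (hres z hz).1, fun z hz => (hres z hz).2,
    xu, xe, xf, tu, te, tf⟩, ?_, ?_⟩
  · simp [u, hy0]
  · simp [e, hy0]

/-- A smooth solution of the NLS has a smooth frame. -/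
theorem IsSmoothNLS.exists_smooth_frame {T : ℝ} {q : ℝ × ℝ → ℂ} (hq : IsSmoothNLS T q)
    {z₀ : ℝ × ℝ} (hz₀ : z₀ ∈ slab T) :
    ∃ u e f : ℝ × ℝ → E3, IsSmoothFrame T (fun z => (q z).re) (fun z => (q z).im)
      (fun z => -dx (fun z => (q z).im) z) (dx fun z => (q z).re)
      (fun z => 1 / 2 * ‖q z‖ ^ 2) u e f ∧
      u z₀ = EuclideanSpace.single 0 1 ∧ e z₀ = EuclideanSpace.single 1 1 := by
  obtain ⟨hs, heq⟩ := hq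
  set a₁ : ℝ × ℝ → ℝ := fun z => (q z).re with ha₁
  set a₂ : ℝ × ℝ → ℝ := fun z => (q z).im with ha₂
  have hS := (slab T).isOpen
  have s1 : ContDiffOn ℝ ∞ a₁ (slab T) := Complex.reCLM.contDiff.comp_contDiffOn hs
  have s2 : ContDiffOn ℝ ∞ a₂ (slab T) := Complex.imCLM.contDiff.comp_contDiffOn hs
  have sd : ∀ {F : Type} [NormedAddCommGroup F] [NormedSpace ℝ F] {g : ℝ × ℝ → F},
      ContDiffOn ℝ ∞ g (slab T) → ContDiffOn ℝ ∞ (dx g) (slab T) := fun hg =>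
    ((contDiffOn_infty_iff_fderiv_of_isOpen hS).1 hg).2.clm_apply contDiffOn_const
  have da : ∀ {F : Type} [NormedAddCommGroup F] [NormedSpace ℝ F] {g : ℝ × ℝ → F},
      ContDiffOn ℝ ∞ g (slab T) → ∀ z ∈ slab T, DifferentiableAt ℝ g z := fun hg z hz =>
    (hg.differentiableOn (by simp)).differentiableAt (hS.mem_nhds hz)
  have fre : ∀ {g : ℝ × ℝ → ℂ} {z : ℝ × ℝ}, DifferentiableAt ℝ g z → ∀ v,
      fderiv ℝ (fun z => (g z).re) z v = (fderiv ℝ g z v).re := fun hg v =>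
    congrArg (fun L => L v) (Complex.reCLM.hasFDerivAt.comp _ hg.hasFDerivAt).fderiv
  have fim : ∀ {g : ℝ × ℝ → ℂ} {z : ℝ × ℝ}, DifferentiableAt ℝ g z → ∀ v,
      fderiv ℝ (fun z => (g z).im) z v = (fderiv ℝ g z v).im := fun hg v =>
    congrArg (fun L => L v) (Complex.imCLM.hasFDerivAt.comp _ hg.hasFDerivAt).fderiv
  have xx1 : ∀ z ∈ slab T, dx (dx a₁) z = (dx (dx q) z).re := fun z hz => by
    have : dx a₁ =ᶠ[𝓝 z] fun z => (dx q z).re := by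
      filter_upwards [hS.mem_nhds hz] with w hw using fre (da hs w hw) _
    rw [dx, this.fderiv_eq, fre (da (sd hs) z hz)]
    rfl
  have xx2 : ∀ z ∈ slab T, dx (dx a₂) z = (dx (dx q) z).im := fun z hz => by
    have : dx a₂ =ᶠ[𝓝 z] fun z => (dx q z).im := by
      filter_upwards [hS.mem_nhds hz] with w hw using fim (da hs w hw) _
    rw [dx, this.fderiv_eq, fim (da (sd hs) z hz)]
    rfl
  have hn : ∀ z, ‖q z‖ ^ 2 = a₁ z * a₁ z + a₂ z * a₂ z := fun z => by
    rw [← Complex.normSq_eq_norm_sq, Complex.normSq_apply]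
  have hc : (fun z => 1 / 2 * ‖q z‖ ^ 2) = fun z => (1 / 2 * a₁ z) * a₁ z + (1 / 2 * a₂ z) * a₂ z := by
    ext z; rw [hn]; ring
  -- With `p = i ∂_x q`, the real and imaginary parts of the NLS are the first two compatibility
  -- conditions; the third one is the derivative of `½ |q|²`.
  have n1 : ∀ z ∈ slab T, dt a₁ z = -(dx (dx a₂) z + 1 / 2 * ‖q z‖ ^ 2 * a₂ z) := fun z hz => by
    have h1 := congrArg Complex.re (heq z hz)
    rw [show dt a₁ z = (dt q z).re from fre (da hs z hz) _, h1, xx2 z hz]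
    have : ((1 / 2 : ℂ) * (‖q z‖ : ℂ) ^ 2 * q z).im = 1 / 2 * ‖q z‖ ^ 2 * a₂ z := by
      have h2 : (1 / 2 : ℂ) * (‖q z‖ : ℂ) ^ 2 = ((1 / 2 * ‖q z‖ ^ 2 : ℝ) : ℂ) := by push_cast; ring
      rw [h2, Complex.im_ofReal_mul]
    rw [Complex.I_mul_re, Complex.add_im, this]
  have n2 : ∀ z ∈ slab T, dt a₂ z = dx (dx a₁) z + 1 / 2 * ‖q z‖ ^ 2 * a₁ z := fun z hz => by
    have h1 := congrArg Complex.im (heq z hz)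
    rw [show dt a₂ z = (dt q z).im from fim (da hs z hz) _, h1, xx1 z hz]
    have : ((1 / 2 : ℂ) * (‖q z‖ : ℂ) ^ 2 * q z).re = 1 / 2 * ‖q z‖ ^ 2 * a₁ z := by
      have h2 : (1 / 2 : ℂ) * (‖q z‖ : ℂ) ^ 2 = ((1 / 2 * ‖q z‖ ^ 2 : ℝ) : ℂ) := by push_cast; ring
      rw [h2, Complex.re_ofReal_mul]
    rw [Complex.I_mul_im, Complex.add_re, this]
  have k1 : ∀ z ∈ slab T, DifferentiableAt ℝ (fun z => 1 / 2 * a₁ z) z := fun z hz =>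
    (da s1 z hz).const_mul _
  have k2 : ∀ z ∈ slab T, DifferentiableAt ℝ (fun z => 1 / 2 * a₂ z) z := fun z hz =>
    (da s2 z hz).const_mul _
  refine _root_.exists_smooth_frame s1 s2 (sd s2).neg (sd s1) ?_ (fun z hz => ?_) (fun z hz => ?_)
    (fun z hz => ?_) hz₀
  · rw [hc]
    exact ((contDiffOn_const.mul s1).mul s1).add ((contDiffOn_const.mul s2).mul s2)
  · have : dx (fun z => -dx a₂ z) z = -dx (dx a₂) z := by
      rw [dx, fderiv_fun_neg]; rfl
    rw [this, n1 z hz]; ring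
  · rw [n2 z hz]; ring
  · have dk : ∀ {g : ℝ × ℝ → ℝ}, DifferentiableAt ℝ g z →
        dx (fun z => 1 / 2 * g z) z = 1 / 2 * dx g z := fun hg => by
      rw [dx, fderiv_const_mul hg]; simp [dx]
    rw [hc, dx_add ((k1 z hz).fun_mul (da s1 z hz)) ((k2 z hz).fun_mul (da s2 z hz)),
      dx_mul (k1 z hz) (da s1 z hz), dx_mul (k2 z hz) (da s2 z hz), dk (da s1 z hz),
      dk (da s2 z hz)]
    ring

/-! ### Smooth frames as solutions of the scalar frame system. -/

section SmoothFacts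

variable {T : ℝ} {F : Type*} [NormedAddCommGroup F] [NormedSpace ℝ F]

theorem ContDiffOn.differentiableAt_slab {g : ℝ × ℝ → F} (hg : ContDiffOn ℝ ∞ g (slab T)) {z : ℝ × ℝ}
    (hz : z ∈ slab T) : DifferentiableAt ℝ g z :=
  (hg.differentiableOn (by simp)).differentiableAt ((slab T).isOpen.mem_nhds hz)

theorem ContDiffOn.dx_slab {g : ℝ × ℝ → F} (hg : ContDiffOn ℝ ∞ g (slab T)) :
    ContDiffOn ℝ ∞ (dx g) (slab T) :=
  ((contDiffOn_infty_iff_fderiv_of_isOpen (slab T).isOpen).1 hg).2.clm_apply contDiffOn_const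

theorem ContDiffOn.dt_slab {g : ℝ × ℝ → F} (hg : ContDiffOn ℝ ∞ g (slab T)) :
    ContDiffOn ℝ ∞ (dt g) (slab T) :=
  ((contDiffOn_infty_iff_fderiv_of_isOpen (slab T).isOpen).1 hg).2.clm_apply contDiffOn_const

theorem ContinuousOn.locMemLp {g : ℝ × ℝ → ℝ} (hg : ContinuousOn g (slab T)) (p : ℝ≥0∞) :
    LocMemLp T p g := fun K hK hKT => by
  have : IsFiniteMeasure (volume.restrict K) := ⟨by simpa using hK.measure_lt_top⟩
  obtain ⟨C, hC⟩ := hK.exists_bound_of_continuousOn (hg.mono hKT)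
  refine MemLp.of_bound ((hg.mono hKT).aestronglyMeasurable hK.measurableSet) C ?_
  exact (ae_restrict_iff' hK.measurableSet).2 (Eventually.of_forall hC)

/-- Integration by parts needs differentiability of `g` only on the support of `φ`, so the behaviour
of `g` off the slab does not matter. -/
theorem integral_test_mul_fderiv {g : ℝ × ℝ → ℝ} (hg : ContDiffOn ℝ ∞ g (slab T))
    (φ : 𝓓(slab T, ℝ)) (v : ℝ × ℝ) :
    ∫ z, φ z * fderiv ℝ g z v = -∫ z, fderiv ℝ φ z v * g z := by
  have h1 : ContinuousOn (fun z => fderiv ℝ g z v) (slab T) :=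
    (((contDiffOn_infty_iff_fderiv_of_isOpen (slab T).isOpen).1 hg).2.clm_apply
      contDiffOn_const).continuousOn
  refine integral_mul_fderiv_eq_neg_fderiv_mul_of_integrable ?_
    ((h1.locMemLp 1).integrable_test φ) ((hg.continuousOn.locMemLp 1).integrable_test φ)
    (fun z _ => φ.differentiable z) (fun z hz => hg.differentiableAt_slab (φ.tsupport_subset hz))
  refine integrable_mul_of_eq_zero_off φ.hasCompactSupport
    ((φ.contDiff.continuous_fderiv (by simp)).clm_apply continuous_const) (fun z hz => ?_)
    ((hg.continuousOn.locMemLp 1).integrableOn φ.hasCompactSupport φ.tsupport_subset)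
  rw [fderiv_of_notMem_tsupport (𝕜 := ℝ) hz]; rfl

/-- Smooth bounded functions are weakly regular. -/
theorem WeakReg.of_smooth {a a' G H : ℝ × ℝ → ℝ} (ha : ContDiffOn ℝ ∞ a (slab T))
    (hG : ContDiffOn ℝ ∞ G (slab T)) (hb : ∀ z ∈ slab T, |a z| ≤ 1)
    (hx : ∀ z ∈ slab T, dx a z = a' z) (ht : ∀ z ∈ slab T, dt a z = -dx G z + H z) :
    WeakReg T a a' G H := by
  have hm := (slab T).isOpen.measurableSet
  have ae : ∀ {p : ℝ × ℝ → Prop}, (∀ z ∈ slab T, p z) →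
      ∀ᵐ z ∂volume.restrict (slab T : Set (ℝ × ℝ)), p z := fun h =>
    (ae_restrict_iff' hm).2 (Eventually.of_forall h)
  have l1 := (ha.dx_slab.continuousOn.locMemLp 2).congr (ae hx)
  have l2 : LocMemLp T 1 H := by
    refine ((ha.dt_slab.continuousOn.add hG.dx_slab.continuousOn).locMemLp 1).congr
      (ae fun z hz => ?_)
    rw [Pi.add_apply, ht z hz]; ring
  refine ⟨ha.continuousOn.aestronglyMeasurable hm, ⟨1, zero_le_one, ae hb⟩, l1,
    hG.continuousOn.locMemLp 2, l2, fun φ => ?_, fun φ => ?_⟩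
  · rw [← integral_congr_slab (ae hx) (fun _ => φ.zero_off_slab)]
    exact integral_test_mul_fderiv ha φ _
  · have h1 := integral_test_mul_fderiv ha φ (1, 0)
    have h2 := integral_test_mul_fderiv hG φ (0, 1)
    have h3 := integral_congr_slab (ψ := φ) (ae ht) (fun _ => φ.zero_off_slab)
    change ∫ z, φ z * dt a z = -∫ z, dt φ z * a z at h1
    change ∫ z, φ z * dx G z = -∫ z, dx φ z * G z at h2
    rw [← h1, h3, integral_add ((hG.continuousOn.locMemLp 1).integrable_dx_test φ)
      (l2.integrable_test φ)]
    have i1 : Integrable fun z => -(φ z * dx G z) :=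
      ((hG.dx_slab.continuousOn.locMemLp 1).integrable_test φ).neg
    simp only [mul_add, mul_neg]
    rw [integral_add i1
      (l2.integrable_test φ), integral_neg, h2, neg_neg]

end SmoothFacts

/-- The scalar form of the smooth frame system of `q`: `(y₀, y₁, y₂)` are the `j`-th coordinates of
an orthonormal frame `(u, e, u × e)`. -/
structure IsSmoothRow (T : ℝ) (q : ℝ × ℝ → ℂ) (y₀ y₁ y₂ : ℝ × ℝ → ℝ) : Prop where
  smooth₀ : ContDiffOn ℝ ∞ y₀ (slab T)
  smooth₁ : ContDiffOn ℝ ∞ y₁ (slab T)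
  smooth₂ : ContDiffOn ℝ ∞ y₂ (slab T)
  unit : ∀ z ∈ slab T, y₀ z ^ 2 + y₁ z ^ 2 + y₂ z ^ 2 = 1
  dx₀ : ∀ z ∈ slab T, dx y₀ z = (q z).re * y₁ z + (q z).im * y₂ z
  dx₁ : ∀ z ∈ slab T, dx y₁ z = -((q z).re * y₀ z)
  dx₂ : ∀ z ∈ slab T, dx y₂ z = -((q z).im * y₀ z)
  dt₀ : ∀ z ∈ slab T, dt y₀ z =
    -dx (fun z => (q z).im) z * y₁ z + dx (fun z => (q z).re) z * y₂ z
  dt₁ : ∀ z ∈ slab T, dt y₁ z = dx (fun z => (q z).im) z * y₀ z - 1 / 2 * ‖q z‖ ^ 2 * y₂ z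
  dt₂ : ∀ z ∈ slab T, dt y₂ z = -(dx (fun z => (q z).re) z * y₀ z) + 1 / 2 * ‖q z‖ ^ 2 * y₁ z

/-- The frame matrix has orthonormal rows, hence also orthonormal columns. Estimates can thus be
made one coordinate at a time, with rows of unit length. -/
theorem IsOrthoPair.column {u e : E3} (h : IsOrthoPair u e) (i : Fin 3) :
    u i ^ 2 + e i ^ 2 + cross u e i ^ 2 = 1 := by
  have h1 : (frameMatrix u e)ᵀ * frameMatrix u e = 1 :=
    mul_eq_one_comm.1 (frameMatrix_mul_transpose h)
  have h2 := congrArg (fun M : Matrix (Fin 3) (Fin 3) ℝ => M i i) h1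
  simp only [Matrix.mul_apply, Fin.sum_univ_three, Matrix.one_apply_eq] at h2
  simpa [frameMatrix, sq] using h2

namespace IsSmoothFrame

variable {T : ℝ} {q : ℝ × ℝ → ℂ} {u e f : ℝ × ℝ → E3}

theorem isSmoothRow (h : IsSmoothFrame T (fun z => (q z).re) (fun z => (q z).im)
      (fun z => -dx (fun z => (q z).im) z) (dx fun z => (q z).re)
      (fun z => 1 / 2 * ‖q z‖ ^ 2) u e f) (i : Fin 3) :
    IsSmoothRow T q (fun z => u z i) (fun z => e z i) (fun z => f z i) := by
  have sm : ∀ {w : ℝ × ℝ → E3}, ContDiffOn ℝ ∞ w (slab T) →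
      ContDiffOn ℝ ∞ (fun z => w z i) (slab T) := fun hw =>
    (EuclideanSpace.proj i : E3 →L[ℝ] ℝ).contDiff.comp_contDiffOn hw
  have cx : ∀ {w : ℝ × ℝ → E3}, ContDiffOn ℝ ∞ w (slab T) → ∀ z ∈ slab T,
      dx (fun z => w z i) z = dx w z i := fun hw z hz => dx_coord (hw.differentiableAt_slab hz) i
  have ct : ∀ {w : ℝ × ℝ → E3}, ContDiffOn ℝ ∞ w (slab T) → ∀ z ∈ slab T,
      dt (fun z => w z i) z = dt w z i := fun hw z hz => dt_coord (hw.differentiableAt_slab hz) i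
  refine ⟨sm h.smooth_u, sm h.smooth_e, sm h.smooth_f, fun z hz => ?_, fun z hz => ?_,
    fun z hz => ?_, fun z hz => ?_, fun z hz => ?_, fun z hz => ?_, fun z hz => ?_⟩
  · rw [h.f_eq z hz]; exact (h.ortho z hz).column i
  · rw [cx h.smooth_u z hz, h.dx_u z hz]; simp
  · rw [cx h.smooth_e z hz, h.dx_e z hz]; simp
  · rw [cx h.smooth_f z hz, h.dx_f z hz]; simp
  · rw [ct h.smooth_u z hz, h.dt_u z hz]; simp
  · rw [ct h.smooth_e z hz, h.dt_e z hz]; simp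
  · rw [ct h.smooth_f z hz, h.dt_f z hz]; simp

end IsSmoothFrame

namespace IsSmoothRow

variable {T : ℝ} {q : ℝ × ℝ → ℂ} {y₀ y₁ y₂ : ℝ × ℝ → ℝ}

theorem abs_le (h : IsSmoothRow T q y₀ y₁ y₂) {z : ℝ × ℝ} (hz : z ∈ slab T) :
    |y₀ z| ≤ 1 ∧ |y₁ z| ≤ 1 ∧ |y₂ z| ≤ 1 := by
  have h1 := h.unit z hz
  refine ⟨abs_le_one_iff_mul_self_le_one.2 ?_, abs_le_one_iff_mul_self_le_one.2 ?_,
    abs_le_one_iff_mul_self_le_one.2 ?_⟩ <;> nlinarith [sq_nonneg (y₀ z), sq_nonneg (y₁ z), sq_nonneg (y₂ z)]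

/-- For smooth data the divergence form is the Leibniz rule: derivatives are pulled off `q`, and the
frame equations in `x` replace what falls on the frame. -/
theorem frameReg (h : IsSmoothRow T q y₀ y₁ y₂) (hq : ContDiffOn ℝ ∞ q (slab T)) :
    FrameReg T q y₀ y₁ y₂ := by
  have s1 : ContDiffOn ℝ ∞ (fun z => (q z).re) (slab T) := Complex.reCLM.contDiff.comp_contDiffOn hq
  have s2 : ContDiffOn ℝ ∞ (fun z => (q z).im) (slab T) := Complex.imCLM.contDiff.comp_contDiffOn hq
  have d0 := fun z (hz : z ∈ slab T) => h.smooth₀.differentiableAt_slab hz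
  have d1 := fun z (hz : z ∈ slab T) => h.smooth₁.differentiableAt_slab hz
  have d2 := fun z (hz : z ∈ slab T) => h.smooth₂.differentiableAt_slab hz
  have e1 := fun z (hz : z ∈ slab T) => s1.differentiableAt_slab hz
  have e2 := fun z (hz : z ∈ slab T) => s2.differentiableAt_slab hz
  have hn : ∀ z, ‖q z‖ ^ 2 = (q z).re * (q z).re + (q z).im * (q z).im := fun z => by
    rw [← Complex.normSq_eq_norm_sq, Complex.normSq_apply]
  have dneg : ∀ (g : ℝ × ℝ → ℝ) z, dx (fun z => -g z) z = -dx g z := fun g z => by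
    simp [dx]
  refine ⟨WeakReg.of_smooth h.smooth₀ ((s2.mul h.smooth₁).sub (s1.mul h.smooth₂))
      (fun z hz => (h.abs_le hz).1) h.dx₀ fun z hz => ?_,
    WeakReg.of_smooth h.smooth₁ (s2.mul h.smooth₀).neg
      (fun z hz => (h.abs_le hz).2.1) h.dx₁ fun z hz => ?_,
    WeakReg.of_smooth h.smooth₂ (s1.mul h.smooth₀)
      (fun z hz => (h.abs_le hz).2.2) h.dx₂ fun z hz => ?_⟩
  · have : dx (fun z => (q z).im * y₁ z - (q z).re * y₂ z) z =
        dx (fun z => (q z).im * y₁ z) z - dx (fun z => (q z).re * y₂ z) z := by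
      simp only [dx]
      rw [fderiv_fun_sub ((e2 z hz).fun_mul (d1 z hz)) ((e1 z hz).fun_mul (d2 z hz))]
      rfl
    rw [this, dx_mul (e2 z hz) (d1 z hz), dx_mul (e1 z hz) (d2 z hz), h.dt₀ z hz, h.dx₁ z hz,
      h.dx₂ z hz]
    ring
  · rw [dneg, dx_mul (e2 z hz) (d0 z hz), h.dt₁ z hz, h.dx₀ z hz]
    ring
  · rw [dx_mul (e1 z hz) (d0 z hz), h.dt₂ z hz, h.dx₀ z hz]
    ring

end IsSmoothRow

/-! ### Stability estimate for smooth frames. -/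

section Slices

variable {T : ℝ} {g : ℝ × ℝ → ℝ}

theorem continuous_slice {F : Type*} [TopologicalSpace F] {g : ℝ × ℝ → F}
    (hg : ContinuousOn g (slab T)) {t : ℝ} (ht : t ∈ Ioo (-T) T) :
    Continuous fun x => g (t, x) :=
  hg.comp_continuous (by fun_prop) fun _ => ⟨ht, mem_univ _⟩

theorem hasDerivAt_slice_x (hg : ContDiffOn ℝ ∞ g (slab T)) {t : ℝ} (ht : t ∈ Ioo (-T) T) (x : ℝ) :
    HasDerivAt (fun x => g (t, x)) (dx g (t, x)) x :=
  (hg.differentiableAt_slab (z := (t, x)) ⟨ht, mem_univ _⟩).hasFDerivAt.comp_hasDerivAt x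
    ((hasDerivAt_const x t).prodMk (hasDerivAt_id x))

theorem hasDerivAt_slice_t (hg : ContDiffOn ℝ ∞ g (slab T)) {t : ℝ} (ht : t ∈ Ioo (-T) T) (x : ℝ) :
    HasDerivAt (fun t => g (t, x)) (dt g (t, x)) t :=
  (hg.differentiableAt_slab (z := (t, x)) ⟨ht, mem_univ _⟩).hasFDerivAt.comp_hasDerivAt t
    ((hasDerivAt_id t).prodMk (hasDerivAt_const t x))

theorem Icc_prod_subset_slab {S : ℝ} (hS : S < T) (A : Set ℝ) : Icc (-S) S ×ˢ A ⊆ (slab T : Set (ℝ × ℝ)) :=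
  fun z hz => ⟨⟨by linarith [hz.1.1], by linarith [hz.1.2]⟩, mem_univ _⟩

theorem Icc_subset_Ioo_of_lt {S : ℝ} (hS : S < T) : Icc (-S) S ⊆ Ioo (-T) T :=
  fun z hz => ⟨by linarith [hz.1], by linarith [hz.2]⟩

/-- If `∂_t m - ∂_x B` and `B` are bounded by `D`, then localised integrals of `m` over `x` vary
in time at most by the integral of `D`. -/
theorem abs_integral_cutoff_sub_le {m B D : ℝ × ℝ → ℝ} (hm : ContDiffOn ℝ ∞ m (slab T))
    (hB : ContDiffOn ℝ ∞ B (slab T)) (hD : ContinuousOn D (slab T))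
    (h1 : ∀ z ∈ slab T, |dt m z - dx B z| ≤ D z) (h2 : ∀ z ∈ slab T, |B z| ≤ D z)
    {S R s t : ℝ} (hS : S < T) (hR : 1 ≤ R) (hs : s ∈ Icc (-S) S) (ht : t ∈ Icc (-S) S) :
    |(∫ x in (-R)..R, (1 - x ^ 2 / R ^ 2) * m (t, x)) -
      ∫ x in (-R)..R, (1 - x ^ 2 / R ^ 2) * m (s, x)| ≤
      3 * ∫ z in Icc (-S) S ×ˢ Icc (-R) R, D z := by
  have hI := Icc_subset_Ioo_of_lt hS
  have hR0 : (0 : ℝ) < R := by linarith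
  have hRR : -R ≤ R := by linarith
  have huI : uIcc s t ⊆ Icc (-S) S := (convex_Icc _ _).ordConnected.uIcc_subset hs ht
  -- This cutoff vanishes at `±R`, so integration by parts leaves no boundary terms. On `[-R, R]` it
  -- is at most 1 and its slope is at most `2 / R ≤ 2`, which gives the constant `3 = 1 + 2`.
  set χ : ℝ → ℝ := fun x => 1 - x ^ 2 / R ^ 2 with hχ
  have cχ : Continuous χ := by fun_prop
  have cm := fun {r} (hr : r ∈ Ioo (-T) T) => continuous_slice hm.continuousOn hr
  have cdm := fun {r} (hr : r ∈ Ioo (-T) T) => continuous_slice hm.dt_slab.continuousOn hr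
  have cdB := fun {r} (hr : r ∈ Ioo (-T) T) => continuous_slice hB.dx_slab.continuousOn hr
  have cB := fun {r} (hr : r ∈ Ioo (-T) T) => continuous_slice hB.continuousOn hr
  have cD := fun {r} (hr : r ∈ Ioo (-T) T) => continuous_slice hD hr
  have hχ1 : ∀ x ∈ Icc (-R) R, |χ x| ≤ 1 := fun x hx => by
    have : x ^ 2 / R ^ 2 ≤ 1 := by
      rw [div_le_one (by positivity)]
      exact sq_le_sq' hx.1 hx.2
    have h0 : 0 ≤ x ^ 2 / R ^ 2 := by positivity
    rw [abs_le]; constructor <;> simp only [hχ] <;> linarith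
  have hχ' : ∀ x ∈ Icc (-R) R, |-(2 * x / R ^ 2)| ≤ 2 := fun x hx => by
    rw [abs_neg, abs_div, abs_of_pos (show (0 : ℝ) < R ^ 2 by positivity),
      div_le_iff₀ (by positivity), abs_mul, abs_two]
    have := abs_le.2 hx
    nlinarith
  have dχ : ∀ x, HasDerivAt χ (-(2 * x / R ^ 2)) x := fun x => by
    have := ((hasDerivAt_pow 2 x).div_const (R ^ 2)).const_sub 1
    simpa using this
  -- the inner integral at a fixed time
  have hJ : ∀ r ∈ Icc (-S) S, |∫ x in (-R)..R, χ x * dt m (r, x)| ≤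
      3 * ∫ x in Icc (-R) R, D (r, x) := by
    intro r hr
    have hr' := hI hr
    have ibp := intervalIntegral.integral_mul_deriv_eq_deriv_mul (a := -R) (b := R) (u := χ)
      (v := fun x => B (r, x)) (u' := fun x => -(2 * x / R ^ 2)) (v' := fun x => dx B (r, x))
      (fun x _ => dχ x) (fun x _ => hasDerivAt_slice_x hB hr' x)
      (Continuous.intervalIntegrable (by fun_prop) _ _) ((cdB hr').intervalIntegrable _ _)
    have e0 : χ R = 0 := by simp [hχ, hR0.ne']
    have e1 : χ (-R) = 0 := by simp [hχ, hR0.ne']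
    rw [e0, e1, zero_mul, zero_mul, sub_zero, zero_sub] at ibp
    have cχ' : Continuous fun x : ℝ => -(2 * x / R ^ 2) := by fun_prop
    have k1 : IntervalIntegrable (fun x => χ x * (dt m (r, x) - dx B (r, x))) volume (-R) R :=
      (cχ.mul ((cdm hr').sub (cdB hr'))).intervalIntegrable _ _
    have k2 : IntervalIntegrable (fun x => -(2 * x / R ^ 2) * B (r, x)) volume (-R) R :=
      (cχ'.mul (cB hr')).intervalIntegrable _ _
    have k3 : IntervalIntegrable (fun x => χ x * dx B (r, x)) volume (-R) R :=
      (cχ.mul (cdB hr')).intervalIntegrable _ _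
    have e2 : ∫ x in (-R)..R, χ x * dt m (r, x) =
        ∫ x in (-R)..R, (χ x * (dt m (r, x) - dx B (r, x)) - -(2 * x / R ^ 2) * B (r, x)) := by
      rw [intervalIntegral.integral_sub k1 k2, sub_eq_add_neg, ← ibp,
        ← intervalIntegral.integral_add k1 k3]
      refine intervalIntegral.integral_congr fun x _ => ?_
      ring
    rw [e2, ← Real.norm_eq_abs, ← integral_const_mul, integral_Icc_eq_integral_Ioc,
      ← intervalIntegral.integral_of_le hRR]
    have k4 : IntervalIntegrable (fun x => 3 * D (r, x)) volume (-R) R :=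
      (continuous_const.mul (cD hr')).intervalIntegrable _ _
    refine intervalIntegral.norm_integral_le_of_norm_le hRR (Eventually.of_forall fun x hx => ?_)
      k4
    have hx' := Ioc_subset_Icc_self hx
    have hz : (r, x) ∈ slab T := ⟨hr', mem_univ _⟩
    have a1 := h1 _ hz
    have a2 := h2 _ hz
    have a0 : 0 ≤ D (r, x) := (abs_nonneg _).trans a2
    rw [Real.norm_eq_abs]
    calc _ ≤ |χ x * (dt m (r, x) - dx B (r, x))| + |-(2 * x / R ^ 2) * B (r, x)| := abs_sub _ _
      _ ≤ 1 * D (r, x) + 2 * D (r, x) := by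
        rw [abs_mul, abs_mul]
        exact add_le_add (mul_le_mul (hχ1 x hx') a1 (abs_nonneg _) zero_le_one)
          (mul_le_mul (hχ' x hx') a2 (abs_nonneg _) zero_le_two)
      _ = _ := by ring
  -- The fundamental theorem of calculus in time at each `x`, combined with Fubini's theorem.
  have e3 : (∫ x in (-R)..R, χ x * m (t, x)) - ∫ x in (-R)..R, χ x * m (s, x) =
      ∫ r in s..t, ∫ x in (-R)..R, χ x * dt m (r, x) := by
    have k1 : ∀ {r}, r ∈ Ioo (-T) T → IntervalIntegrable (fun x => χ x * m (r, x)) volume (-R) R :=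
      fun hr => (cχ.mul (cm hr)).intervalIntegrable _ _
    rw [intervalIntegral_intervalIntegral_swap, ← intervalIntegral.integral_sub
      (k1 (hI ht)) (k1 (hI hs))]
    · refine intervalIntegral.integral_congr fun x _ => ?_
      change χ x * m (t, x) - χ x * m (s, x) = ∫ r in s..t, χ x * dt m (r, x)
      rw [intervalIntegral.integral_const_mul, ← mul_sub]
      congr 1
      refine (intervalIntegral.integral_eq_sub_of_hasDerivAt (f := fun r => m (r, x))
        (fun r hr => hasDerivAt_slice_t hm (hI (huI hr)) x) ?_).symm
      refine ContinuousOn.intervalIntegrable ?_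
      exact hm.dt_slab.continuousOn.comp (by fun_prop) fun r hr => ⟨hI (huI hr), mem_univ _⟩
    · have : ContinuousOn (Function.uncurry fun r x => χ x * dt m (r, x)) (uIcc s t ×ˢ uIcc (-R) R) :=
        ContinuousOn.mul (by fun_prop) (hm.dt_slab.continuousOn.mono fun z hz =>
          ⟨hI (huI hz.1), mem_univ _⟩)
      exact (this.integrableOn_compact (isCompact_uIcc.prod isCompact_uIcc)).mono_set
        (prod_mono uIoc_subset_uIcc uIoc_subset_uIcc)
  have iD : IntegrableOn D (Icc (-S) S ×ˢ Icc (-R) R) :=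
    (hD.mono (Icc_prod_subset_slab hS _)).integrableOn_compact (isCompact_Icc.prod isCompact_Icc)
  have iD' : Integrable (fun r => ∫ x in Icc (-R) R, D (r, x)) (volume.restrict (Icc (-S) S)) := by
    rw [IntegrableOn, Measure.volume_eq_prod, ← Measure.prod_restrict] at iD
    exact iD.integral_prod_left
  have hD0 : ∀ r ∈ Icc (-S) S, 0 ≤ ∫ x in Icc (-R) R, D (r, x) := fun r hr =>
    integral_nonneg fun x => (abs_nonneg _).trans (h2 (r, x) ⟨hI hr, mem_univ _⟩)
  rw [e3, Measure.volume_eq_prod, setIntegral_prod _ iD, ← integral_const_mul, ← Real.norm_eq_abs]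
  refine (intervalIntegral.norm_integral_le_integral_norm_uIoc).trans ?_
  calc ∫ r in uIoc s t, ‖∫ x in (-R)..R, χ x * dt m (r, x)‖
      ≤ ∫ r in uIoc s t, 3 * ∫ x in Icc (-R) R, D (r, x) := by
        refine integral_mono_of_nonneg (Eventually.of_forall fun _ => norm_nonneg _)
          ((iD'.mono_measure (Measure.restrict_mono (uIoc_subset_uIcc.trans huI) le_rfl)).const_mul 3) ?_
        exact (ae_restrict_iff' measurableSet_uIoc).2 (Eventually.of_forall fun r hr =>
          hJ r (huI (uIoc_subset_uIcc hr)))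
    _ ≤ _ := by
        refine setIntegral_mono_set (iD'.const_mul 3) ?_
          (uIoc_subset_uIcc.trans huI).eventuallyLE
        exact (ae_restrict_iff' measurableSet_Icc).2 (Eventually.of_forall fun r hr =>
          mul_nonneg (by norm_num) (hD0 r hr))

end Slices

namespace IsSmoothRow

variable {T : ℝ} {q p : ℝ × ℝ → ℂ} {y₀ y₁ y₂ x₀ x₁ x₂ : ℝ × ℝ → ℝ}

/-- The distance density of two solutions of the frame system. -/
theorem dt_inner (hq : ContDiffOn ℝ ∞ q (slab T)) (hp : ContDiffOn ℝ ∞ p (slab T))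
    (hy : IsSmoothRow T q y₀ y₁ y₂) (hx : IsSmoothRow T p x₀ x₁ x₂) :
    ∃ B, ContDiffOn ℝ ∞ B (slab T) ∧
      (∀ z ∈ slab T, |B z| ≤ 4 * ‖q z - p z‖) ∧
      (∀ z ∈ slab T, |dx (fun z => y₀ z * x₀ z + y₁ z * x₁ z + y₂ z * x₂ z) z| ≤ 4 * ‖q z - p z‖) ∧
      ∀ z ∈ slab T, |dt (fun z => y₀ z * x₀ z + y₁ z * x₁ z + y₂ z * x₂ z) z - dx B z| ≤
        7 * (‖q z - p z‖ * (‖q z‖ + ‖p z‖)) := by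
  have a1 : ContDiffOn ℝ ∞ (fun z => (q z).re) (slab T) := Complex.reCLM.contDiff.comp_contDiffOn hq
  have a2 : ContDiffOn ℝ ∞ (fun z => (q z).im) (slab T) := Complex.imCLM.contDiff.comp_contDiffOn hq
  have b1 : ContDiffOn ℝ ∞ (fun z => (p z).re) (slab T) := Complex.reCLM.contDiff.comp_contDiffOn hp
  have b2 : ContDiffOn ℝ ∞ (fun z => (p z).im) (slab T) := Complex.imCLM.contDiff.comp_contDiffOn hp
  have sX : ContDiffOn ℝ ∞ (fun z => y₁ z * x₀ z - y₀ z * x₁ z) (slab T) :=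
    (hy.smooth₁.mul hx.smooth₀).sub (hy.smooth₀.mul hx.smooth₁)
  have sY : ContDiffOn ℝ ∞ (fun z => y₂ z * x₀ z - y₀ z * x₂ z) (slab T) :=
    (hy.smooth₂.mul hx.smooth₀).sub (hy.smooth₀.mul hx.smooth₂)
  have s1 : ContDiffOn ℝ ∞ (fun z => (q z).re - (p z).re) (slab T) := a1.sub b1
  have s2 : ContDiffOn ℝ ∞ (fun z => (q z).im - (p z).im) (slab T) := a2.sub b2
  -- In `∂_t` of the inner product the first derivatives of `q` and `p` occur only through `∂_x (q -
  -- p)`, multiplied by antisymmetric expressions in the rows. `B` has `q - p` in its place; in the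
  -- difference the derivative falls on the rows, at the cost of a factor `|q| + |p|`.
  set B : ℝ × ℝ → ℝ := fun z => ((q z).re - (p z).re) * (y₂ z * x₀ z - y₀ z * x₂ z) -
    ((q z).im - (p z).im) * (y₁ z * x₀ z - y₀ z * x₁ z) with hB
  have fsub : ∀ {f g : ℝ × ℝ → ℝ} {z : ℝ × ℝ}, DifferentiableAt ℝ f z → DifferentiableAt ℝ g z →
      dx (fun z => f z - g z) z = dx f z - dx g z := fun hf hg => by
    simp only [dx, fderiv_fun_sub hf hg, _root_.sub_apply]
  have bd : ∀ {a b c d : ℝ}, |a| ≤ 1 → |b| ≤ 1 → |c| ≤ 1 → |d| ≤ 1 → |a * b - c * d| ≤ 2 := by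
    intro a b c d ha hb hc hd
    refine (abs_sub _ _).trans ?_
    rw [abs_mul, abs_mul]
    have := mul_le_one₀ ha (abs_nonneg b) hb
    have := mul_le_one₀ hc (abs_nonneg d) hd
    linarith
  have reb : ∀ z, |(q z).re - (p z).re| ≤ ‖q z - p z‖ := fun z => by
    simpa using Complex.abs_re_le_norm (q z - p z)
  have imb : ∀ z, |(q z).im - (p z).im| ≤ ‖q z - p z‖ := fun z => by
    simpa using Complex.abs_im_le_norm (q z - p z)
  have comb : ∀ {u v w₁ w₂ d C : ℝ}, |u| ≤ d → |v| ≤ d → |w₁| ≤ C → |w₂| ≤ C →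
      |u * w₁ + v * w₂| ≤ 2 * (d * C) := by
    intro u v w₁ w₂ d C hu hv h1 h2
    refine (abs_add_le _ _).trans ?_
    rw [abs_mul, abs_mul]
    have := mul_le_mul hu h1 (abs_nonneg _) ((abs_nonneg _).trans hu)
    have := mul_le_mul hv h2 (abs_nonneg _) ((abs_nonneg _).trans hv)
    linarith
  refine ⟨B, (s1.mul sY).sub (s2.mul sX), fun z hz => ?_, fun z hz => ?_, fun z hz => ?_⟩
  · obtain ⟨i0, i1, i2⟩ := hy.abs_le hz
    obtain ⟨j0, j1, j2⟩ := hx.abs_le hz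
    have := comb (reb z) ((abs_neg _).trans_le (imb z)) (bd i2 j0 i0 j2) (bd i1 j0 i0 j1)
    have e : B z = ((q z).re - (p z).re) * (y₂ z * x₀ z - y₀ z * x₂ z) +
      -((q z).im - (p z).im) * (y₁ z * x₀ z - y₀ z * x₁ z) := by simp only [hB]; ring
    rw [e]; linarith
  · obtain ⟨i0, i1, i2⟩ := hy.abs_le hz
    obtain ⟨j0, j1, j2⟩ := hx.abs_le hz
    have d0 := hy.smooth₀.differentiableAt_slab hz
    have d1 := hy.smooth₁.differentiableAt_slab hz
    have d2 := hy.smooth₂.differentiableAt_slab hz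
    have e0 := hx.smooth₀.differentiableAt_slab hz
    have e1 := hx.smooth₁.differentiableAt_slab hz
    have e2 := hx.smooth₂.differentiableAt_slab hz
    rw [dx_add ((d0.fun_mul e0).fun_add (d1.fun_mul e1)) (d2.fun_mul e2),
      dx_add (d0.fun_mul e0) (d1.fun_mul e1), dx_mul d0 e0, dx_mul d1 e1, dx_mul d2 e2,
      hy.dx₀ z hz, hy.dx₁ z hz, hy.dx₂ z hz, hx.dx₀ z hz, hx.dx₁ z hz, hx.dx₂ z hz]
    have := comb (reb z) (imb z) (bd i1 j0 i0 j1) (bd i2 j0 i0 j2)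
    refine le_trans (le_of_eq ?_) (this.trans (by linarith))
    congr 1; ring
  · obtain ⟨i0, i1, i2⟩ := hy.abs_le hz
    obtain ⟨j0, j1, j2⟩ := hx.abs_le hz
    have d0 := hy.smooth₀.differentiableAt_slab hz
    have d1 := hy.smooth₁.differentiableAt_slab hz
    have d2 := hy.smooth₂.differentiableAt_slab hz
    have e0 := hx.smooth₀.differentiableAt_slab hz
    have e1 := hx.smooth₁.differentiableAt_slab hz
    have e2 := hx.smooth₂.differentiableAt_slab hz
    have dX := sX.differentiableAt_slab hz
    have dY := sY.differentiableAt_slab hz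
    have dr := s1.differentiableAt_slab hz
    have di := s2.differentiableAt_slab hz
    have hdB : dx B z = dx (fun z => (q z).re - (p z).re) z * (y₂ z * x₀ z - y₀ z * x₂ z) +
        ((q z).re - (p z).re) * dx (fun z => y₂ z * x₀ z - y₀ z * x₂ z) z -
        (dx (fun z => (q z).im - (p z).im) z * (y₁ z * x₀ z - y₀ z * x₁ z) +
        ((q z).im - (p z).im) * dx (fun z => y₁ z * x₀ z - y₀ z * x₁ z) z) := by
      rw [hB, fsub (dr.fun_mul dY) (di.fun_mul dX), dx_mul dr dY, dx_mul di dX]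
    have hdX : dx (fun z => y₁ z * x₀ z - y₀ z * x₁ z) z =
        (-((q z).re * y₀ z) * x₀ z + y₁ z * ((p z).re * x₁ z + (p z).im * x₂ z)) -
        (((q z).re * y₁ z + (q z).im * y₂ z) * x₁ z + y₀ z * -((p z).re * x₀ z)) := by
      rw [fsub (d1.fun_mul e0) (d0.fun_mul e1), dx_mul d1 e0, dx_mul d0 e1,
        hy.dx₀ z hz, hy.dx₁ z hz, hx.dx₀ z hz, hx.dx₁ z hz]
    have hdY : dx (fun z => y₂ z * x₀ z - y₀ z * x₂ z) z =
        (-((q z).im * y₀ z) * x₀ z + y₂ z * ((p z).re * x₁ z + (p z).im * x₂ z)) -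
        (((q z).re * y₁ z + (q z).im * y₂ z) * x₂ z + y₀ z * -((p z).im * x₀ z)) := by
      rw [fsub (d2.fun_mul e0) (d0.fun_mul e2), dx_mul d2 e0, dx_mul d0 e2,
        hy.dx₀ z hz, hy.dx₂ z hz, hx.dx₀ z hz, hx.dx₂ z hz]
    have hr := fsub (a1.differentiableAt_slab hz) (b1.differentiableAt_slab hz)
    have hi := fsub (a2.differentiableAt_slab hz) (b2.differentiableAt_slab hz)
    have mono : ∀ {a b c n : ℝ}, |a| ≤ n → |b| ≤ 1 → |c| ≤ 1 → |a * (b * c)| ≤ n := by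
      intro a b c n ha hb hc
      rw [abs_mul, abs_mul]
      have h2 := mul_le_one₀ hb (abs_nonneg c) hc
      exact (mul_le_of_le_one_right (abs_nonneg a) h2).trans ha
    have qr := Complex.abs_re_le_norm (q z)
    have qi := Complex.abs_im_le_norm (q z)
    have pr := Complex.abs_re_le_norm (p z)
    have pi := Complex.abs_im_le_norm (p z)
    have h1 : |dx (fun z => y₁ z * x₀ z - y₀ z * x₁ z) z| ≤ 3 * (‖q z‖ + ‖p z‖) := by
      rw [hdX]
      have t1 := _root_.abs_le.1 (mono qr i0 j0)
      have t2 := _root_.abs_le.1 (mono pr i1 j1)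
      have t3 := _root_.abs_le.1 (mono pi i1 j2)
      have t4 := _root_.abs_le.1 (mono qr i1 j1)
      have t5 := _root_.abs_le.1 (mono qi i2 j1)
      have t6 := _root_.abs_le.1 (mono pr i0 j0)
      rw [_root_.abs_le]
      constructor <;> linarith
    have h2 : |dx (fun z => y₂ z * x₀ z - y₀ z * x₂ z) z| ≤ 3 * (‖q z‖ + ‖p z‖) := by
      rw [hdY]
      have t1 := _root_.abs_le.1 (mono qi i0 j0)
      have t2 := _root_.abs_le.1 (mono pr i2 j1)
      have t3 := _root_.abs_le.1 (mono pi i2 j2)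
      have t4 := _root_.abs_le.1 (mono qr i1 j2)
      have t5 := _root_.abs_le.1 (mono qi i2 j2)
      have t6 := _root_.abs_le.1 (mono pi i0 j0)
      rw [_root_.abs_le]
      constructor <;> linarith
    have h3 : |1 / 2 * ‖q z‖ ^ 2 - 1 / 2 * ‖p z‖ ^ 2| ≤ 1 / 2 * (‖q z - p z‖ * (‖q z‖ + ‖p z‖)) := by
      have : 1 / 2 * ‖q z‖ ^ 2 - 1 / 2 * ‖p z‖ ^ 2 = 1 / 2 * ((‖q z‖ - ‖p z‖) * (‖q z‖ + ‖p z‖)) := by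
        ring
      rw [this, abs_mul, abs_mul, abs_of_pos (by norm_num : (0 : ℝ) < 1 / 2),
        abs_of_nonneg (by positivity : 0 ≤ ‖q z‖ + ‖p z‖)]
      gcongr
      exact abs_norm_sub_norm_le _ _
    have h4 := comb (reb z) ((abs_neg _).trans_le (imb z)) ((abs_neg _).trans_le h2)
      ((abs_neg _).trans_le h1)
    have h5 : |(1 / 2 * ‖q z‖ ^ 2 - 1 / 2 * ‖p z‖ ^ 2) * (y₁ z * x₂ z - y₂ z * x₁ z)| ≤
        1 / 2 * (‖q z - p z‖ * (‖q z‖ + ‖p z‖)) * 2 := by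
      rw [abs_mul]
      exact mul_le_mul h3 (bd i1 j2 i2 j1) (abs_nonneg _) (by positivity)
    have key : dt (fun z => y₀ z * x₀ z + y₁ z * x₁ z + y₂ z * x₂ z) z - dx B z =
        ((q z).re - (p z).re) * -dx (fun z => y₂ z * x₀ z - y₀ z * x₂ z) z +
        -((q z).im - (p z).im) * -dx (fun z => y₁ z * x₀ z - y₀ z * x₁ z) z +
        (1 / 2 * ‖q z‖ ^ 2 - 1 / 2 * ‖p z‖ ^ 2) * (y₁ z * x₂ z - y₂ z * x₁ z) := by
      rw [hdB, hr, hi, dt_add ((d0.fun_mul e0).fun_add (d1.fun_mul e1)) (d2.fun_mul e2),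
        dt_add (d0.fun_mul e0) (d1.fun_mul e1), dt_mul d0 e0, dt_mul d1 e1, dt_mul d2 e2,
        hy.dt₀ z hz, hy.dt₁ z hz, hy.dt₂ z hz, hx.dt₀ z hz, hx.dt₁ z hz, hx.dt₂ z hz]
      ring
    rw [key]
    refine (abs_add_le _ _).trans ((add_le_add h4 h5).trans (le_of_eq ?_))
    ring

end IsSmoothRow

namespace IsSmoothRow

variable {T : ℝ} {q p : ℝ × ℝ → ℂ} {y₀ y₁ y₂ x₀ x₁ x₂ : ℝ × ℝ → ℝ}

theorem inner_le_one (hy : IsSmoothRow T q y₀ y₁ y₂) (hx : IsSmoothRow T p x₀ x₁ x₂) {z : ℝ × ℝ}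
    (hz : z ∈ slab T) : y₀ z * x₀ z + y₁ z * x₁ z + y₂ z * x₂ z ≤ 1 := by
  have h1 := hy.unit z hz
  have h2 := hx.unit z hz
  nlinarith [sq_nonneg (y₀ z - x₀ z), sq_nonneg (y₁ z - x₁ z), sq_nonneg (y₂ z - x₂ z)]

/-- Two smooth solutions of frame systems that agree at one point remain close. -/
theorem integral_one_sub_inner_le (hq : ContDiffOn ℝ ∞ q (slab T)) (hp : ContDiffOn ℝ ∞ p (slab T))
    (hy : IsSmoothRow T q y₀ y₁ y₂) (hx : IsSmoothRow T p x₀ x₁ x₂) {S R s t : ℝ} (hS : S < T)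
    (hR : 1 ≤ R) (hs : s ∈ Icc (-S) S) (ht : t ∈ Icc (-S) S) (h0 : y₀ (s, 0) = x₀ (s, 0))
    (h1 : y₁ (s, 0) = x₁ (s, 0)) (h2 : y₂ (s, 0) = x₂ (s, 0)) :
    ∫ x in (-(R / 2))..(R / 2),
      (1 - (y₀ (t, x) * x₀ (t, x) + y₁ (t, x) * x₁ (t, x) + y₂ (t, x) * x₂ (t, x))) ≤
      16 * R * (∫ x in Icc (-R) R, ‖q (s, x) - p (s, x)‖) +
      42 * ∫ z in Icc (-S) S ×ˢ Icc (-R) R, ‖q z - p z‖ * (‖q z‖ + ‖p z‖ + 1) := by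
  have hI := Icc_subset_Ioo_of_lt hS
  have hRR : -R ≤ R := by linarith
  have hR0 : (0 : ℝ) < R := by linarith
  obtain ⟨B, hB, hB1, hmx, hmt⟩ := dt_inner hq hp hy hx
  set m : ℝ × ℝ → ℝ := fun z => y₀ z * x₀ z + y₁ z * x₁ z + y₂ z * x₂ z with hm
  have sm : ContDiffOn ℝ ∞ m (slab T) :=
    ((hy.smooth₀.mul hx.smooth₀).add (hy.smooth₁.mul hx.smooth₁)).add (hy.smooth₂.mul hx.smooth₂)
  have m1 : ∀ z ∈ slab T, m z ≤ 1 := fun z hz => hy.inner_le_one hx hz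
  have cm := fun {r} (hr : r ∈ Ioo (-T) T) => continuous_slice sm.continuousOn hr
  have cdm := fun {r} (hr : r ∈ Ioo (-T) T) => continuous_slice sm.dx_slab.continuousOn hr
  have cq := fun {r} (hr : r ∈ Ioo (-T) T) => continuous_slice hq.continuousOn hr
  have cp := fun {r} (hr : r ∈ Ioo (-T) T) => continuous_slice hp.continuousOn hr
  have hmem : ∀ {r}, r ∈ Icc (-S) S → ∀ x : ℝ, (r, x) ∈ slab T := fun hr x => ⟨hI hr, mem_univ _⟩
  set I := ∫ x in Icc (-R) R, ‖q (s, x) - p (s, x)‖ with hIdef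
  set J := ∫ z in Icc (-S) S ×ˢ Icc (-R) R, ‖q z - p z‖ * (‖q z‖ + ‖p z‖ + 1) with hJdef
  -- The summand 1 lets the same density dominate `B`, which is linear in `q - p`, and the error,
  -- which is quadratic.
  have hD := abs_integral_cutoff_sub_le (D := fun z => 7 * (‖q z - p z‖ * (‖q z‖ + ‖p z‖ + 1))) sm hB
    (continuousOn_const.mul (((hq.continuousOn.sub hp.continuousOn).norm).mul
      ((hq.continuousOn.norm.add hp.continuousOn.norm).add continuousOn_const)))
    (fun z hz => (hmt z hz).trans (by
      have : 0 ≤ ‖q z - p z‖ := norm_nonneg _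
      nlinarith))
    (fun z hz => (hB1 z hz).trans (by
      have : 0 ≤ ‖q z - p z‖ := norm_nonneg _
      have : 0 ≤ ‖q z - p z‖ * (‖q z‖ + ‖p z‖) := by positivity
      nlinarith)) hS hR hs ht
  rw [integral_const_mul] at hD
  have cχ : Continuous fun x : ℝ => 1 - x ^ 2 / R ^ 2 := by fun_prop
  have hχ : ∀ x ∈ Icc (-R) R, 0 ≤ 1 - x ^ 2 / R ^ 2 ∧ 1 - x ^ 2 / R ^ 2 ≤ 1 := fun x hx => by
    have : x ^ 2 / R ^ 2 ≤ 1 := by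
      rw [div_le_one (by positivity)]
      exact sq_le_sq' hx.1 hx.2
    have h0 : 0 ≤ x ^ 2 / R ^ 2 := by positivity
    constructor <;> linarith
  have iχm : ∀ {r}, r ∈ Icc (-S) S → IntervalIntegrable (fun x => (1 - x ^ 2 / R ^ 2) * m (r, x))
      volume (-R) R := fun hr => (cχ.mul (cm (hI hr))).intervalIntegrable _ _
  have iw : ∀ {r}, r ∈ Icc (-S) S → Continuous (fun x => 1 - m (r, x)) := fun hr =>
    continuous_const.sub (cm (hI hr))
  have iχw : ∀ {r}, r ∈ Icc (-S) S → ∀ a b, IntervalIntegrable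
      (fun x => (1 - x ^ 2 / R ^ 2) * (1 - m (r, x))) volume a b := fun hr _ _ =>
    (cχ.mul (iw hr)).intervalIntegrable _ _
  have e : ∀ {r}, r ∈ Icc (-S) S → ∫ x in (-R)..R, (1 - x ^ 2 / R ^ 2) * (1 - m (r, x)) =
      (∫ x in (-R)..R, (1 - x ^ 2 / R ^ 2)) - ∫ x in (-R)..R, (1 - x ^ 2 / R ^ 2) * m (r, x) := by
    intro r hr
    rw [← intervalIntegral.integral_sub (cχ.intervalIntegrable _ _) (iχm hr)]
    refine intervalIntegral.integral_congr fun x _ => ?_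
    ring
  have key : ∫ x in (-R)..R, (1 - x ^ 2 / R ^ 2) * (1 - m (t, x)) ≤
      (∫ x in (-R)..R, (1 - x ^ 2 / R ^ 2) * (1 - m (s, x))) + 21 * J := by
    rw [e ht, e hs]
    have := (_root_.abs_le.1 hD).1
    linarith
  have hI0 : 0 ≤ I := integral_nonneg fun _ => norm_nonneg _
  have hJ0 : 0 ≤ J := integral_nonneg fun _ => by positivity
  -- the initial time
  have init : ∫ x in (-R)..R, (1 - x ^ 2 / R ^ 2) * (1 - m (s, x)) ≤ 8 * R * I := by
    have hms : m (s, 0) = 1 := by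
      have := hx.unit _ (hmem hs 0)
      simp only [hm, h0, h1, h2]
      linear_combination this
    have cδ : Continuous fun x => 4 * ‖q (s, x) - p (s, x)‖ :=
      continuous_const.mul ((cq (hI hs)).sub (cp (hI hs))).norm
    -- The rows agree at `x = 0`, so `m = 1` there, and `|∂_x m| ≤ 4 |q - p|` is integrated from 0.
    have hw : ∀ x ∈ Icc (-R) R, 1 - m (s, x) ≤ 4 * I := fun x hx => by
      have ftc := intervalIntegral.integral_eq_sub_of_hasDerivAt (f := fun x => m (s, x)) (a := 0)
        (b := x) (fun x _ => hasDerivAt_slice_x sm (hI hs) x) ((cdm (hI hs)).intervalIntegrable _ _)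
      have hle : |∫ x in (0 : ℝ)..x, dx m (s, x)| ≤ 4 * I := by
        rw [← Real.norm_eq_abs]
        refine (intervalIntegral.norm_integral_le_integral_norm_uIoc).trans ?_
        have h0R : (0 : ℝ) ∈ Icc (-R) R := ⟨by linarith, by linarith⟩
        have hsub : uIoc 0 x ⊆ Icc (-R) R :=
          uIoc_subset_uIcc.trans ((convex_Icc _ _).ordConnected.uIcc_subset h0R hx)
        rw [hIdef, ← integral_const_mul]
        calc ∫ x in uIoc 0 x, ‖dx m (s, x)‖ ≤ ∫ x in uIoc 0 x, 4 * ‖q (s, x) - p (s, x)‖ := by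
              refine integral_mono_of_nonneg (Eventually.of_forall fun _ => norm_nonneg _)
                (cδ.integrableOn_uIoc) (Eventually.of_forall fun x => hmx _ (hmem hs x))
          _ ≤ _ := setIntegral_mono_set (cδ.integrableOn_Icc)
              (Eventually.of_forall fun x => by positivity) hsub.eventuallyLE
      have := (_root_.abs_le.1 hle).1
      rw [ftc] at this
      simp only [hms] at this
      linarith
    calc ∫ x in (-R)..R, (1 - x ^ 2 / R ^ 2) * (1 - m (s, x)) ≤ ∫ x in (-R)..R, 4 * I := by
          refine intervalIntegral.integral_mono_on hRR (iχw hs _ _)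
            (continuous_const.intervalIntegrable _ _) fun x hx => ?_
          have := hw x hx
          have h3 : 0 ≤ 1 - m (s, x) := by linarith [m1 _ (hmem hs x)]
          have := hχ x hx
          nlinarith
      _ = 8 * R * I := by rw [intervalIntegral.integral_const]; simp only [smul_eq_mul]; ring
  -- On the half interval the cutoff is at least `3 / 4`.
  have final : ∫ x in (-(R / 2))..(R / 2), (1 - m (t, x)) ≤
      4 / 3 * ∫ x in (-R)..R, (1 - x ^ 2 / R ^ 2) * (1 - m (t, x)) := by
    have hnn : ∀ x ∈ Ioc (-R) R, 0 ≤ (1 - x ^ 2 / R ^ 2) * (1 - m (t, x)) := fun x hx =>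
      mul_nonneg (hχ x (Ioc_subset_Icc_self hx)).1 (by linarith [m1 _ (hmem ht x)])
    have g1 : ∫ x in (-(R / 2))..(R / 2), (1 - m (t, x)) ≤
        ∫ x in (-(R / 2))..(R / 2), 4 / 3 * ((1 - x ^ 2 / R ^ 2) * (1 - m (t, x))) := by
      refine intervalIntegral.integral_mono_on (by linarith) ((iw ht).intervalIntegrable _ _)
        ((iχw ht _ _).const_mul _) fun x hx => ?_
      have h3 : 0 ≤ 1 - m (t, x) := by linarith [m1 _ (hmem ht x)]
      have h4 : x ^ 2 / R ^ 2 ≤ 1 / 4 := by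
        rw [div_le_iff₀ (by positivity)]
        nlinarith [hx.1, hx.2]
      nlinarith
    rw [intervalIntegral.integral_const_mul] at g1
    have g2 : ∫ x in (-(R / 2))..(R / 2), (1 - x ^ 2 / R ^ 2) * (1 - m (t, x)) ≤
        ∫ x in (-R)..R, (1 - x ^ 2 / R ^ 2) * (1 - m (t, x)) :=
      intervalIntegral.integral_mono_interval (by linarith) (by linarith) (by linarith)
        ((ae_restrict_iff' measurableSet_Ioc).2 (Eventually.of_forall hnn)) (iχw ht _ _)
    linarith
  have hRI : 0 ≤ R * I := mul_nonneg hR0.le hI0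
  -- The factor `4 / 3` applied to `8 * R * I + 21 * J` is bounded by a factor 2, which gives the
  -- constants 16 and 42.
  nlinarith

end IsSmoothRow

/-! ### Compactness in the space of functions continuous in time. -/

section ContL2

variable {T : ℝ} {F : Type*} [NormedAddCommGroup F]

/-- The times `T * (1 - 1 / (n + 1))` increase to `T` from strictly below, and index the exhaustion
used for diagonal extraction. -/
theorem exists_Icc_mem_of_mem_Ioo {t : ℝ} (ht : t ∈ Ioo (-T) T) :
    ∃ n : ℕ, t ∈ Ioo (-(T * (1 - 1 / ((n : ℝ) + 1)))) (T * (1 - 1 / ((n : ℝ) + 1))) := by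
  have h1 : Tendsto (fun n : ℕ => T * (1 - 1 / ((n : ℝ) + 1))) atTop (𝓝 (T * (1 - 0))) :=
    (tendsto_one_div_add_atTop_nhds_zero_nat.const_sub 1).const_mul T
  rw [sub_zero, mul_one] at h1
  obtain ⟨n, hn⟩ := (h1.eventually (lt_mem_nhds (abs_lt.2 ht))).exists
  exact ⟨n, abs_lt.1 hn⟩

theorem mul_one_sub_lt (hT : 0 < T) (n : ℕ) : T * (1 - 1 / ((n : ℝ) + 1)) < T := by
  have : 0 < 1 / ((n : ℝ) + 1) := by positivity
  nlinarith

theorem mul_one_sub_mono (hT : 0 < T) {m n : ℕ} (h : m ≤ n) :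
    T * (1 - 1 / ((m : ℝ) + 1)) ≤ T * (1 - 1 / ((n : ℝ) + 1)) := by
  have : 1 / ((n : ℝ) + 1) ≤ 1 / ((m : ℝ) + 1) := by gcongr
  nlinarith

theorem ContinuousOn.stronglyMeasurable_indicator_isOpen {X : Type*} [TopologicalSpace X]
    [SecondCountableTopology X] [MeasurableSpace X] [OpensMeasurableSpace X] {E : Type*}
    [NormedAddCommGroup E] {Y : X → E} {s : Set X} (hY : ContinuousOn Y s) (hs : IsOpen s) :
    StronglyMeasurable (s.indicator Y) := by
  refine stronglyMeasurable_of_restrict_of_restrict_compl hs.measurableSet ?_ ?_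
  · have : s.domRestrict (s.indicator Y) = s.domRestrict Y := by
      ext x; exact indicator_of_mem x.2 _
    rw [this]
    exact (continuousOn_iff_continuous_domRestrict.1 hY).stronglyMeasurable
  · have : sᶜ.domRestrict (s.indicator Y) = fun _ => 0 := by
      ext x; exact indicator_of_notMem x.2 _
    rw [this]
    exact stronglyMeasurable_const

theorem ContinuousOn.memLp_slice {Y : ℝ × ℝ → F} (hY : ContinuousOn Y (slab T)) {t : ℝ}
    (ht : t ∈ Ioo (-T) T) {K : Set ℝ} (hK : IsCompact K) :
    MemLp (fun x => Y (t, x)) 2 (volume.restrict K) := by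
  have hc := continuous_slice hY ht
  obtain ⟨C, hC⟩ := hK.exists_bound_of_continuousOn hc.continuousOn
  have : IsFiniteMeasure (volume.restrict K) := ⟨by simpa using hK.measure_lt_top⟩
  exact MemLp.of_bound (hc.continuousOn.aestronglyMeasurable_of_isCompact hK hK.measurableSet) C
    ((ae_restrict_iff' hK.measurableSet).2 (Eventually.of_forall hC))

/-- Continuous functions are continuous in time with values in `L²_loc`. -/
theorem ContinuousOn.contL2loc {Y : ℝ × ℝ → F} (hY : ContinuousOn Y (slab T)) : ContL2loc T Y := by
  intro K hK t₀ ht₀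
  refine ⟨hY.memLp_slice ht₀ hK, ?_⟩
  have hfin : IsFiniteMeasure (volume.restrict K) := ⟨by simpa using hK.measure_lt_top⟩
  obtain ⟨a, b, hab, hmem, hsub⟩ := exists_Icc_mem_subset_of_mem_nhds (isOpen_Ioo.mem_nhds ht₀)
  have hu : UniformContinuousOn ↿(fun t x => Y (t, x)) (Icc a b ×ˢ K) :=
    (isCompact_Icc.prod hK).uniformContinuousOn_of_continuous
      (hY.mono fun z hz => ⟨hsub hz.1, mem_univ _⟩)
  have hl := hu.tendstoUniformlyOn hab
  rw [nhdsWithin_eq_nhds.2 hmem, Metric.tendstoUniformlyOn_iff] at hl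
  rw [ENNReal.tendsto_nhds_zero]
  intro ε hε
  set M : ℝ≥0∞ := (volume.restrict K) univ ^ (2 : ℝ≥0∞).toReal⁻¹ with hM
  have hMt : M ≠ ⊤ := ENNReal.rpow_ne_top_of_nonneg (by positivity) (measure_ne_top _ _)
  obtain ⟨δ, hδ, hδε⟩ : ∃ δ : ℝ, 0 < δ ∧ M * ENNReal.ofReal δ ≤ ε := by
    have : Tendsto (fun δ : ℝ => M * ENNReal.ofReal δ) (𝓝[>] 0) (𝓝 (M * ENNReal.ofReal 0)) :=
      ENNReal.Tendsto.const_mul ((ENNReal.continuous_ofReal.tendsto 0).mono_left inf_le_left)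
        (Or.inr hMt)
    rw [ENNReal.ofReal_zero, mul_zero] at this
    obtain ⟨δ, h1, h2⟩ := ((this.eventually (ge_mem_nhds hε)).and self_mem_nhdsWithin).exists
    exact ⟨δ, h2, h1⟩
  filter_upwards [hl δ hδ] with t ht
  refine (eLpNorm_le_of_ae_bound (C := δ) ?_).trans hδε
  refine (ae_restrict_iff' hK.measurableSet).2 (Eventually.of_forall fun x hx => ?_)
  rw [← dist_eq_norm, dist_comm]
  exact (ht x hx).le

/-- A sequence of continuous functions that is Cauchy in `L²_{x,loc}` locally uniformly in time has
a subsequence that converges, for every time, almost everywhere, and the limit is continuous in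
time with values in `L²_{x,loc}`. -/
theorem exists_subseq_tendsto_of_cauchy [CompleteSpace F] (hT : 0 < T) {Y : ℕ → ℝ × ℝ → F}
    (hY : ∀ k, ContinuousOn (Y k) (slab T))
    (hcau : ∀ S R : ℝ, S < T → ∀ ε : ℝ≥0∞, 0 < ε → ∃ N, ∀ k ≥ N, ∀ l ≥ N, ∀ t ∈ Icc (-S) S,
      eLpNorm (fun x => Y k (t, x) - Y l (t, x)) 2 (volume.restrict (Icc (-R) R)) < ε) :
    ∃ φ : ℕ → ℕ, StrictMono φ ∧ ∃ Z : ℝ × ℝ → F, StronglyMeasurable Z ∧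
      (∀ t ∈ Ioo (-T) T, ∀ᵐ x : ℝ, Tendsto (fun n => Y (φ n) (t, x)) atTop (𝓝 (Z (t, x)))) ∧
      ContL2loc T Z := by
  set s : ℕ → ℝ := fun n => T * (1 - 1 / ((n : ℝ) + 1)) with hs
  -- Summable bounds, not just null ones: they give almost everywhere convergence of one and the
  -- same subsequence for every time.
  set B : ℕ → ℝ≥0∞ := fun n => 2⁻¹ ^ n with hB
  have hB0 : ∀ n, 0 < B n := fun n => by simp [hB, ENNReal.pow_pos]
  have hBs : ∀ n₀, ∑' n, B (n + n₀) ≠ ⊤ := fun n₀ => by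
    simp only [hB, pow_add, ENNReal.tsum_mul_right]
    refine ENNReal.mul_ne_top ?_ (ENNReal.pow_ne_top (by simp))
    rw [ENNReal.tsum_geometric]; simp
  obtain ⟨φ, hφ, hP⟩ := extraction_forall_of_eventually' (P := fun n k => ∀ k' ≥ k, ∀ l ≥ k,
      ∀ t ∈ Icc (-s n) (s n), eLpNorm (fun x => Y k' (t, x) - Y l (t, x)) 2
        (volume.restrict (Icc (-(n : ℝ)) n)) < B n) fun n => by
    obtain ⟨N, hN⟩ := hcau (s n) n (mul_one_sub_lt hT n) (B n) (hB0 n)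
    exact ⟨N, fun k hk k' hk' l hl => hN k' (hk.trans hk') l (hk.trans hl)⟩
  -- Truncation makes the functions measurable on the whole plane, so that their pointwise limit
  -- `Z`, with its default value where there is none, is measurable jointly in `(t, x)`.
  set I : ℕ → ℝ × ℝ → F := fun n => (slab T : Set (ℝ × ℝ)).indicator (Y (φ n)) with hI
  have hIm : ∀ n, StronglyMeasurable (I n) := fun n =>
    (hY _).stronglyMeasurable_indicator_isOpen (slab T).isOpen
  set Z : ℝ × ℝ → F := fun z => limUnder atTop fun n => I n z with hZ
  have hIY : ∀ n {t} (_ : t ∈ Ioo (-T) T) x, I n (t, x) = Y (φ n) (t, x) := fun n t ht x =>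
    indicator_of_mem (show (t, x) ∈ (slab T : Set (ℝ × ℝ)) from ⟨ht, mem_univ _⟩) _
  -- the quantitative Cauchy property on a compact set
  have hc : ∀ n₀ : ℕ, ∀ t ∈ Icc (-s n₀) (s n₀), ∀ N n m : ℕ, N ≤ n → N ≤ m →
      eLpNorm ((fun x => Y (φ (n + n₀)) (t, x)) - fun x => Y (φ (m + n₀)) (t, x)) 2
        (volume.restrict (Icc (-(n₀ : ℝ)) n₀)) < B (N + n₀) := by
    intro n₀ t ht N n m hn hm
    have h1 := hP (N + n₀) (φ (n + n₀)) (hφ.monotone (by omega)) (φ (m + n₀))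
      (hφ.monotone (by omega)) t ?_
    · refine lt_of_le_of_lt (eLpNorm_mono_measure _ (Measure.restrict_mono ?_ le_rfl)) h1
      have : (n₀ : ℝ) ≤ ((N + n₀ : ℕ) : ℝ) := by exact_mod_cast Nat.le_add_left _ _
      exact Icc_subset_Icc (by linarith) this
    · have := mul_one_sub_mono hT (show n₀ ≤ N + n₀ by omega)
      exact ⟨by linarith [ht.1], by linarith [ht.2]⟩
  have hslice : ∀ n₀ : ℕ, ∀ t ∈ Ioo (-T) T, ∀ n,
      AEStronglyMeasurable (fun x => Y (φ (n + n₀)) (t, x))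
        (volume.restrict (Icc (-(n₀ : ℝ)) n₀)) := fun n₀ t ht n =>
    ((hY _).memLp_slice ht isCompact_Icc).aestronglyMeasurable
  have hsub : ∀ n, Icc (-s n) (s n) ⊆ Ioo (-T) T := fun n =>
    Icc_subset_Ioo_of_lt (mul_one_sub_lt hT n)
  have hlim : ∀ n₀ : ℕ, ∀ t ∈ Icc (-s n₀) (s n₀), ∀ᵐ x ∂volume.restrict (Icc (-(n₀ : ℝ)) n₀),
      Tendsto (fun n => Y (φ n) (t, x)) atTop (𝓝 (Z (t, x))) := by
    intro n₀ t ht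
    have h1 := Lp.ae_tendsto_of_cauchy_eLpNorm (hslice n₀ t (hsub n₀ ht)) (by norm_num) (hBs n₀)
      (hc n₀ t ht)
    filter_upwards [h1] with x ⟨l, hl⟩
    have h2 := (tendsto_add_atTop_iff_nat (f := fun n => Y (φ n) (t, x)) n₀).1 hl
    have h3 : Tendsto (fun n => I n (t, x)) atTop (𝓝 l) := by simpa only [hIY _ (hsub n₀ ht)] using h2
    have h4 : Z (t, x) = l := h3.limUnder_eq
    rwa [h4]
  have hex : ∀ {t : ℝ}, t ∈ Ioo (-T) T → ∀ R : ℝ, ∃ n₀ : ℕ, t ∈ Ioo (-s n₀) (s n₀) ∧ R ≤ n₀ := by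
    intro t ht R
    obtain ⟨n, hn⟩ := exists_Icc_mem_of_mem_Ioo ht
    obtain ⟨m, hm⟩ := exists_nat_ge R
    have := mul_one_sub_mono hT (le_max_left n m)
    refine ⟨max n m, ⟨by linarith [hn.1], by linarith [hn.2]⟩, hm.trans ?_⟩
    exact_mod_cast le_max_right n m
  have hae : ∀ t ∈ Ioo (-T) T, ∀ᵐ x : ℝ, Tendsto (fun n => Y (φ n) (t, x)) atTop (𝓝 (Z (t, x))) := by
    intro t ht
    have hU : (⋃ n : ℕ, Icc (-(n : ℝ)) n) = univ := by
      refine eq_univ_of_forall fun x => mem_iUnion.2 ?_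
      obtain ⟨n, hn⟩ := exists_nat_ge |x|
      exact ⟨n, abs_le.1 hn⟩
    rw [← Measure.restrict_univ (μ := (volume : Measure ℝ)), ← hU, ae_restrict_iUnion_iff]
    intro n
    obtain ⟨n₀, h1, h2⟩ := hex ht n
    exact ae_restrict_of_ae_restrict_of_subset (Icc_subset_Icc (by linarith) h2)
      (hlim n₀ t (Ioo_subset_Icc_self h1))
  refine ⟨φ, hφ, Z, StronglyMeasurable.limUnder hIm, hae, ?_⟩
  have hZm : StronglyMeasurable Z := StronglyMeasurable.limUnder hIm
  have hZs : ∀ t (μ : Measure ℝ), AEStronglyMeasurable (fun x => Z (t, x)) μ := fun t μ =>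
    (hZm.comp_measurable measurable_prodMk_left).aestronglyMeasurable
  intro K hK t₀ ht₀
  obtain ⟨R, hR⟩ := hK.isBounded.subset_closedBall 0
  rw [Real.closedBall_eq_Icc, zero_sub, zero_add] at hR
  obtain ⟨n₀, h1, h2⟩ := hex ht₀ R
  have hKn : K ⊆ Icc (-(n₀ : ℝ)) n₀ := hR.trans (Icc_subset_Icc (by linarith) h2)
  have hYm : ∀ n, ∀ t ∈ Ioo (-T) T, AEStronglyMeasurable (fun x => Y (φ (n + n₀)) (t, x))
      (volume.restrict K) := fun n t ht => ((hY _).memLp_slice ht hK).aestronglyMeasurable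
  -- Fatou's lemma carries the Cauchy bound to the limit, uniformly in `t`; this is what transfers
  -- continuity in time to `Z`.
  have hclose : ∀ N, ∀ t ∈ Icc (-s n₀) (s n₀),
      eLpNorm (fun x => Y (φ (N + n₀)) (t, x) - Z (t, x)) 2 (volume.restrict K) ≤ B (N + n₀) := by
    intro N t ht
    refine (eLpNorm_mono_measure _ (Measure.restrict_mono hKn le_rfl)).trans ?_
    refine (Lp.eLpNorm_lim_le_liminf_eLpNorm
      (f := fun m x => Y (φ (N + n₀)) (t, x) - Y (φ (m + n₀)) (t, x))
      (fun m => (hslice n₀ t (hsub n₀ ht) N).sub (hslice n₀ t (hsub n₀ ht) m)) _ ?_).trans ?_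
    · filter_upwards [hlim n₀ t ht] with x hx
      exact ((tendsto_add_atTop_iff_nat (f := fun n => Y (φ n) (t, x)) n₀).2 hx).const_sub _
    · refine liminf_le_of_frequently_le' (Eventually.frequently ?_)
      filter_upwards [eventually_ge_atTop N] with m hm
      exact (hc n₀ t ht N N m le_rfl hm).le
  have hB_lim : Tendsto (fun N => B (N + n₀)) atTop (𝓝 0) :=
    (tendsto_add_atTop_iff_nat n₀).2
      (ENNReal.tendsto_pow_atTop_nhds_zero_of_lt_one (by simp))
  refine ⟨?_, ?_⟩
  · have h3 := (hY (φ (0 + n₀))).memLp_slice ht₀ hK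
    have h4 : MemLp (fun x => Y (φ (0 + n₀)) (t₀, x) - Z (t₀, x)) 2 (volume.restrict K) :=
      ⟨(hYm 0 t₀ ht₀).sub (hZs _ _), (hclose 0 t₀ (Ioo_subset_Icc_self h1)).trans_lt
        (by simp [hB])⟩
    have h5 := h3.sub h4
    refine (memLp_congr_ae (Eventually.of_forall fun x => ?_)).1 h5
    simp
  · rw [ENNReal.tendsto_nhds_zero]
    intro ε hε
    have hε3 : 0 < ε / 3 := ENNReal.div_pos hε.ne' (by norm_num)
    obtain ⟨N, hN⟩ := (hB_lim.eventually (ge_mem_nhds hε3)).exists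
    have h3 := ((hY (φ (N + n₀))).contL2loc K hK t₀ ht₀).2
    filter_upwards [h3.eventually (ge_mem_nhds hε3), isOpen_Ioo.mem_nhds h1] with t ht ht1
    have htT := hsub n₀ (Ioo_subset_Icc_self ht1)
    have e : (fun x => Z (t, x) - Z (t₀, x)) =
        (fun x => Y (φ (N + n₀)) (t, x) - Y (φ (N + n₀)) (t₀, x)) -
          (fun x => Y (φ (N + n₀)) (t, x) - Z (t, x)) +
          (fun x => Y (φ (N + n₀)) (t₀, x) - Z (t₀, x)) := by
      ext x; simp
    have m1 := (hYm N t htT).sub (hYm N t₀ ht₀)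
    have m2 := (hYm N t htT).sub (hZs t _)
    have m3 := (hYm N t₀ ht₀).sub (hZs t₀ _)
    rw [e]
    calc _ ≤ _ := eLpNorm_add_le (m1.sub m2) m3 (by norm_num)
      _ ≤ ε / 3 + ε / 3 + ε / 3 := add_le_add ((eLpNorm_sub_le m1 m2 (by norm_num)).trans
          (add_le_add ht ((hclose N t (Ioo_subset_Icc_self ht1)).trans hN)))
          ((hclose N t₀ (Ioo_subset_Icc_self h1)).trans hN)
      _ = ε := ENNReal.add_thirds ε

end ContL2

/-! ### The `L²` distance of two frames. -/

theorem norm_triple_sq_le (a b c : E3) : ‖((a, b, c) : E3 × E3 × E3)‖ ^ 2 ≤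
    ‖a‖ ^ 2 + ‖b‖ ^ 2 + ‖c‖ ^ 2 := by
  have h : ‖((a, b, c) : E3 × E3 × E3)‖ = max ‖a‖ (max ‖b‖ ‖c‖) := rfl
  rw [h]
  have := sq_nonneg ‖a‖
  have := sq_nonneg ‖b‖
  have := sq_nonneg ‖c‖
  rcases max_choice ‖a‖ (max ‖b‖ ‖c‖) with h1 | h1 <;> rw [h1]
  · linarith
  · rcases max_choice ‖b‖ ‖c‖ with h2 | h2 <;> rw [h2] <;> linarith

section FrameDistance

variable {T : ℝ} {q p : ℝ × ℝ → ℂ} {u e f v g h : ℝ × ℝ → E3}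

/-- The scalar stability estimate is summed over the three coordinates. The squared distance of two
unit rows is `2 (1 - m)`, whence the factor `6 = 2 · 3` under the root. -/
theorem eLpNorm_frame_sub_le (hq : ContDiffOn ℝ ∞ q (slab T)) (hp : ContDiffOn ℝ ∞ p (slab T))
    (hu : ContinuousOn u (slab T)) (he : ContinuousOn e (slab T)) (hf : ContinuousOn f (slab T))
    (hv : ContinuousOn v (slab T)) (hg : ContinuousOn g (slab T)) (hh : ContinuousOn h (slab T))
    (hy : ∀ i, IsSmoothRow T q (fun z => u z i) (fun z => e z i) (fun z => f z i))
    (hx : ∀ i, IsSmoothRow T p (fun z => v z i) (fun z => g z i) (fun z => h z i))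
    {S R s t : ℝ} (hS : S < T) (hR : 1 ≤ R) (hs : s ∈ Icc (-S) S) (ht : t ∈ Icc (-S) S)
    (h0 : u (s, 0) = v (s, 0)) (h1 : e (s, 0) = g (s, 0)) (h2 : f (s, 0) = h (s, 0)) :
    eLpNorm (fun x => ((u (t, x), e (t, x), f (t, x)) : E3 × E3 × E3) - (v (t, x), g (t, x), h (t, x)))
      2 (volume.restrict (Icc (-(R / 2)) (R / 2))) ≤
      ENNReal.ofReal (√(6 * (16 * R * (∫ x in Icc (-R) R, ‖q (s, x) - p (s, x)‖) +
        42 * ∫ z in Icc (-S) S ×ˢ Icc (-R) R, ‖q z - p z‖ * (‖q z‖ + ‖p z‖ + 1)))) := by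
  have hI := Icc_subset_Ioo_of_lt hS
  have hmem : ∀ x : ℝ, (t, x) ∈ slab T := fun x => ⟨hI ht, mem_univ _⟩
  have key := fun i => IsSmoothRow.integral_one_sub_inner_le hq hp (hy i) (hx i) hS hR hs ht
    (congrArg (fun w : E3 => w i) h0) (congrArg (fun w : E3 => w i) h1)
    (congrArg (fun w : E3 => w i) h2)
  have hmp : MemLp (fun x => ((u (t, x), e (t, x), f (t, x)) : E3 × E3 × E3) -
      (v (t, x), g (t, x), h (t, x))) 2 (volume.restrict (Icc (-(R / 2)) (R / 2))) :=
    ContinuousOn.memLp_slice (Y := fun z => ((u z, e z, f z) : E3 × E3 × E3) - (v z, g z, h z))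
      ((hu.prodMk (he.prodMk hf)).sub (hv.prodMk (hg.prodMk hh))) (hI ht) isCompact_Icc
  rw [hmp.eLpNorm_eq_integral_rpow_norm two_ne_zero (by norm_num)]
  refine ENNReal.ofReal_le_ofReal ?_
  have e2 : (2 : ℝ≥0∞).toReal = 2 := by norm_num
  rw [e2, Real.sqrt_eq_rpow, inv_eq_one_div]
  refine Real.rpow_le_rpow (integral_nonneg fun _ => by positivity) ?_ (by norm_num)
  have cw : ∀ {w : ℝ × ℝ → E3}, ContinuousOn w (slab T) → ∀ i, Continuous fun x => w (t, x) i :=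
    fun hw i => (PiLp.continuous_apply 2 _ i).comp (continuous_slice hw (hI ht))
  set m : Fin 3 → ℝ → ℝ := fun i x =>
    1 - (u (t, x) i * v (t, x) i + e (t, x) i * g (t, x) i + f (t, x) i * h (t, x) i) with hm
  have cm : ∀ i, Continuous (m i) := fun i =>
    continuous_const.sub ((((cw hu i).mul (cw hv i)).add ((cw he i).mul (cw hg i))).add
      ((cw hf i).mul (cw hh i)))
  have im : ∀ i, IntegrableOn (m i) (Icc (-(R / 2)) (R / 2)) := fun i => (cm i).integrableOn_Icc
  have im2 : IntegrableOn (fun x => m 0 x + m 1 x) (Icc (-(R / 2)) (R / 2)) := (im 0).add (im 1)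
  have im3 : IntegrableOn (fun x => m 0 x + m 1 x + m 2 x) (Icc (-(R / 2)) (R / 2)) :=
    im2.add (im 2)
  have bound : ∀ x, ‖((u (t, x), e (t, x), f (t, x)) : E3 × E3 × E3) -
      (v (t, x), g (t, x), h (t, x))‖ ^ (2 : ℝ) ≤
      2 * (m 0 x + m 1 x + m 2 x) := by
    intro x
    rw [Real.rpow_two]
    refine (norm_triple_sq_le _ _ _).trans (le_of_eq ?_)
    rw [E3.norm_sq, E3.norm_sq, E3.norm_sq]
    simp only [PiLp.sub_apply, hm]
    have y0 := (hy 0).unit _ (hmem x)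
    have y1 := (hy 1).unit _ (hmem x)
    have y2 := (hy 2).unit _ (hmem x)
    have x0 := (hx 0).unit _ (hmem x)
    have x1 := (hx 1).unit _ (hmem x)
    have x2 := (hx 2).unit _ (hmem x)
    linear_combination y0 + y1 + y2 + x0 + x1 + x2
  calc _ ≤ ∫ x in Icc (-(R / 2)) (R / 2), 2 * (m 0 x + m 1 x + m 2 x) :=
        integral_mono_of_nonneg (Eventually.of_forall fun _ => by positivity) (im3.const_mul 2)
          (Eventually.of_forall bound)
    _ = 2 * ((∫ x in Icc (-(R / 2)) (R / 2), m 0 x) + (∫ x in Icc (-(R / 2)) (R / 2), m 1 x) +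
        ∫ x in Icc (-(R / 2)) (R / 2), m 2 x) := by
      rw [integral_const_mul, integral_add im2 (im 2), integral_add (im 0) (im 1)]
    _ ≤ _ := by
      have k : ∀ i, ∫ x in Icc (-(R / 2)) (R / 2), m i x ≤
          16 * R * (∫ x in Icc (-R) R, ‖q (s, x) - p (s, x)‖) +
          42 * ∫ z in Icc (-S) S ×ˢ Icc (-R) R, ‖q z - p z‖ * (‖q z‖ + ‖p z‖ + 1) := fun i => by
        rw [integral_Icc_eq_integral_Ioc, ← intervalIntegral.integral_of_le (by linarith)]
        exact key i
      have k0 := k 0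
      have k1 := k 1
      have k2 := k 2
      linarith

end FrameDistance

/-! ### Convergence of the potentials, and a good initial time. -/

section GoodTime

variable {T : ℝ} {q : ℝ × ℝ → ℂ} {qk : ℕ → ℝ × ℝ → ℂ}

/-- By Hölder's inequality: the differences tend to zero in `L²(K)`, while the second factor stays
bounded there for large indices. -/
theorem tendsto_integral_norm_sub_mul (hq : MemL2L2loc T q) (hqk : ∀ k, ContinuousOn (qk k) (slab T))
    {K : Set (ℝ × ℝ)} (hK : IsCompact K) (hKT : K ⊆ slab T)
    (hlim : Tendsto (fun k => eLpNorm (fun z => qk k z - q z) 2 (volume.restrict K)) atTop (𝓝 0)) :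
    Tendsto (fun n : ℕ × ℕ => ∫ z in K, ‖qk n.1 z - qk n.2 z‖ * (‖qk n.1 z‖ + ‖qk n.2 z‖ + 1))
      (atTop ×ˢ atTop) (𝓝 0) := by
  have hfin : IsFiniteMeasure (volume.restrict K) := ⟨by simpa using hK.measure_lt_top⟩
  have mq := hq.memLp hK hKT
  have mk : ∀ k, AEStronglyMeasurable (qk k) (volume.restrict K) := fun k =>
    ((hqk k).mono hKT).aestronglyMeasurable hK.measurableSet
  set μ := volume.restrict K with hμ
  set a : ℕ → ℝ≥0∞ := fun k => eLpNorm (fun z => qk k z - q z) 2 μ with ha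
  set M := eLpNorm q 2 μ with hM
  set m := eLpNorm (fun _ : ℝ × ℝ => (1 : ℝ)) 2 μ with hm
  have hMt : M ≠ ⊤ := mq.eLpNorm_ne_top
  have hmt : m ≠ ⊤ := (memLp_const (1 : ℝ)).eLpNorm_ne_top
  have hk : ∀ k, eLpNorm (qk k) 2 μ ≤ a k + M := fun k => by
    have : qk k = (fun z => qk k z - q z) + q := by ext z; simp
    conv_lhs => rw [this]
    exact eLpNorm_add_le ((mk k).sub mq.1) mq.1 (by norm_num)
  have hd : ∀ k l, eLpNorm (fun z => qk k z - qk l z) 2 μ ≤ a k + a l := fun k l => by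
    have : (fun z => qk k z - qk l z) = (fun z => qk k z - q z) - (fun z => qk l z - q z) := by
      ext z; simp
    rw [this]
    exact eLpNorm_sub_le ((mk k).sub mq.1) ((mk l).sub mq.1) (by norm_num)
  have hw : ∀ k l, eLpNorm (fun z => ‖qk k z‖ + ‖qk l z‖ + 1) 2 μ ≤ (a k + M) + (a l + M) + m := by
    intro k l
    refine (eLpNorm_add_le (f := fun z => ‖qk k z‖ + ‖qk l z‖) ((mk k).norm.add (mk l).norm)
      aestronglyMeasurable_const (by norm_num)).trans (add_le_add ?_ le_rfl)
    refine (eLpNorm_add_le (f := fun z => ‖qk k z‖) (mk k).norm (mk l).norm (by norm_num)).trans ?_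
    rw [eLpNorm_norm, eLpNorm_norm]
    exact add_le_add (hk k) (hk l)
  have hprod : ∀ n : ℕ × ℕ,
      eLpNorm (fun z => ‖qk n.1 z - qk n.2 z‖ * (‖qk n.1 z‖ + ‖qk n.2 z‖ + 1)) 1 μ ≤
        (a n.1 + a n.2) * ((a n.1 + M) + (a n.2 + M) + m) := by
    intro n
    have h1 := eLpNorm_le_eLpNorm_mul_eLpNorm_of_nnnorm (μ := μ) (p := 2) (q := 2) (r := 1)
      ((mk n.1).sub (mk n.2)).norm (((mk n.1).norm.add (mk n.2).norm).add
        (aestronglyMeasurable_const (b := (1 : ℝ)))) (fun x y : ℝ => x * y) 1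
      (Eventually.of_forall fun z => by rw [one_mul, nnnorm_mul])
    refine h1.trans ?_
    rw [ENNReal.coe_one, one_mul]
    refine mul_le_mul' ?_ (hw n.1 n.2)
    exact (eLpNorm_norm _).trans_le (hd n.1 n.2)
  have hlim1 : Tendsto (fun n : ℕ × ℕ => a n.1) (atTop ×ˢ atTop) (𝓝 0) := hlim.comp tendsto_fst
  have hlim2 : Tendsto (fun n : ℕ × ℕ => a n.2) (atTop ×ˢ atTop) (𝓝 0) := hlim.comp tendsto_snd
  have hbd : Tendsto (fun n : ℕ × ℕ => (a n.1 + a n.2) * ((a n.1 + M) + (a n.2 + M) + m))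
      (atTop ×ˢ atTop) (𝓝 0) := by
    have h1 := hlim1.add hlim2
    have h2 := ((hlim1.add_const M).add (hlim2.add_const M)).add_const m
    have h3 := ENNReal.Tendsto.mul h1 (Or.inr (by finiteness)) h2 (Or.inr (by simp))
    simpa using h3
  have h4 := tendsto_of_tendsto_of_tendsto_of_le_of_le tendsto_const_nhds hbd
    (fun _ => zero_le) hprod
  have h5 := (ENNReal.tendsto_toReal ENNReal.zero_ne_top).comp h4
  refine h5.congr fun n => ?_
  simp only [Function.comp, eLpNorm_one_eq_lintegral_enorm]
  rw [← integral_norm_eq_lintegral_enorm]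
  · refine integral_congr_ae (Eventually.of_forall fun z => ?_)
    exact Real.norm_of_nonneg (by positivity)
  · exact ((mk n.1).sub (mk n.2)).norm.mul (((mk n.1).norm.add (mk n.2).norm).add
      aestronglyMeasurable_const)

/-- After passing to a subsequence, there is a time at which a convergent sequence converges in
`L¹_loc`. -/
theorem exists_good_time (hT : 0 < T) (hq : MemL2L2loc T q) (hqk : ∀ k, ContinuousOn (qk k) (slab T))
    (hlim : ∀ K : Set (ℝ × ℝ), IsCompact K → K ⊆ slab T →
      Tendsto (fun k => eLpNorm (fun z => qk k z - q z) 2 (volume.restrict K)) atTop (𝓝 0)) :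
    ∃ ψ : ℕ → ℕ, StrictMono ψ ∧ ∃ t₀ ∈ Ioo (-T) T, ∀ R : ℝ,
      Tendsto (fun n : ℕ × ℕ => ∫ x in Icc (-R) R, ‖qk (ψ n.1) (t₀, x) - qk (ψ n.2) (t₀, x)‖)
        (atTop ×ˢ atTop) (𝓝 0) := by
  set J : Set ℝ := Icc (-(T / 2)) (T / 2) with hJ
  have hJT : J ⊆ Ioo (-T) T := Icc_subset_Ioo_of_lt (by linarith)
  set K : ℕ → Set (ℝ × ℝ) := fun n => J ×ˢ Icc (-(n : ℝ)) n with hKdef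
  have hKc : ∀ n, IsCompact (K n) := fun n => isCompact_Icc.prod isCompact_Icc
  have hKT : ∀ n, K n ⊆ slab T := fun n z hz => ⟨hJT hz.1, mem_univ _⟩
  have mq := hq.aestronglyMeasurable
  -- A globally measurable representative has measurable time slices, which those of `q` need not
  -- be.
  set r := mq.mk q with hr
  have hrm : StronglyMeasurable r := mq.stronglyMeasurable_mk
  have hqr : ∀ᵐ z ∂volume.restrict (slab T : Set (ℝ × ℝ)), q z = r z := mq.ae_eq_mk
  have mk : ∀ k n, AEStronglyMeasurable (qk k) (volume.restrict (K n)) := fun k n =>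
    ((hqk k).mono (hKT n)).aestronglyMeasurable (hKc n).measurableSet
  have hL1 : ∀ n, Tendsto (fun k => ∫⁻ z in K n, ‖qk k z - r z‖ₑ) atTop (𝓝 0) := by
    intro n
    have hfin : IsFiniteMeasure (volume.restrict (K n)) := ⟨by simpa using (hKc n).measure_lt_top⟩
    set c : ℝ≥0∞ := (volume.restrict (K n)) univ ^ (1 / (1 : ℝ≥0∞).toReal - 1 / (2 : ℝ≥0∞).toReal)
    have hc : c ≠ ⊤ := ENNReal.rpow_ne_top_of_nonneg (by norm_num) (measure_ne_top _ _)
    have h1 := ENNReal.Tendsto.mul_const (hlim (K n) (hKc n) (hKT n)) (b := c) (Or.inr hc)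
    rw [zero_mul] at h1
    refine tendsto_of_tendsto_of_tendsto_of_le_of_le tendsto_const_nhds h1
      (fun _ => zero_le) fun k => ?_
    have h2 : ∫⁻ z in K n, ‖qk k z - r z‖ₑ = eLpNorm (fun z => qk k z - q z) 1
        (volume.restrict (K n)) := by
      rw [eLpNorm_one_eq_lintegral_enorm]
      refine lintegral_congr_ae ?_
      filter_upwards [ae_restrict_of_ae_restrict_of_subset (hKT n) hqr] with z hz
      rw [hz]
    rw [h2]
    exact eLpNorm_le_eLpNorm_mul_rpow_measure_univ (by norm_num)
      ((mk k n).sub (mq.mono_set (hKT n)))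
  -- The boxes grow with `n` while the errors are summable. The sum over `n` of the errors on slices
  -- is then integrable in time, hence finite at almost every time, and one such time serves every
  -- `R`.
  obtain ⟨ψ, hψ, hP⟩ := extraction_forall_of_eventually'
    (P := fun n k => ∫⁻ z in K n, ‖qk k z - r z‖ₑ ≤ 2⁻¹ ^ n) fun n => by
      have := (hL1 n).eventually (ge_mem_nhds (show (0 : ℝ≥0∞) < 2⁻¹ ^ n by
        simp [ENNReal.pow_pos]))
      exact eventually_atTop.1 this
  set G : ℕ → ℝ → ℝ≥0∞ := fun n t => ∫⁻ x in Icc (-(n : ℝ)) n, ‖qk (ψ n) (t, x) - r (t, x)‖ₑ with hG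
  have hmeas : ∀ n, AEMeasurable (fun z => ‖qk (ψ n) z - r z‖ₑ)
      ((volume.restrict J).prod (volume.restrict (Icc (-(n : ℝ)) n))) := fun n => by
    rw [Measure.prod_restrict]
    exact ((mk (ψ n) n).sub hrm.aestronglyMeasurable).enorm
  have hGm : ∀ n, AEMeasurable (G n) (volume.restrict J) := fun n => (hmeas n).lintegral_prod_right'
  have hGi : ∀ n, ∫⁻ t in J, G n t ≤ 2⁻¹ ^ n := fun n => by
    refine le_trans (le_of_eq ?_) (hP n)
    rw [hKdef, Measure.volume_eq_prod, ← Measure.prod_restrict, lintegral_prod _ (hmeas n)]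
  have hsum : ∫⁻ t in J, ∑' n, G n t ≠ ⊤ := by
    rw [lintegral_tsum hGm]
    refine ne_top_of_le_ne_top ?_ (ENNReal.tsum_le_tsum hGi)
    rw [ENNReal.tsum_geometric]; simp
  have hae := ae_lt_top' (AEMeasurable.tsum hGm) hsum
  have hpos : (volume.restrict J) ≠ 0 := by
    rw [Ne, Measure.restrict_eq_zero, hJ, Real.volume_Icc]
    simp; linarith
  have : (ae (volume.restrict J)).NeBot := ae_neBot.2 hpos
  obtain ⟨t₀, ht₀, ht₀J⟩ := (hae.and (ae_restrict_mem measurableSet_Icc)).exists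
  refine ⟨ψ, hψ, t₀, hJT ht₀J, fun R => ?_⟩
  have hG0 : Tendsto (fun n => G n t₀) atTop (𝓝 0) := ENNReal.tendsto_atTop_zero_of_tsum_ne_top ht₀.ne
  set b : ℕ → ℝ≥0∞ := fun n => ∫⁻ x in Icc (-R) R, ‖qk (ψ n) (t₀, x) - r (t₀, x)‖ₑ with hb
  have hb0 : Tendsto b atTop (𝓝 0) := by
    refine tendsto_of_tendsto_of_tendsto_of_le_of_le' tendsto_const_nhds hG0
      (Eventually.of_forall fun _ => zero_le) ?_
    obtain ⟨N, hN⟩ := exists_nat_ge R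
    filter_upwards [eventually_ge_atTop N] with n hn
    have : R ≤ n := hN.trans (by exact_mod_cast hn)
    exact lintegral_mono_set (Icc_subset_Icc (by linarith) this)
  have hsl : ∀ n, Continuous fun x => qk (ψ n) (t₀, x) := fun n =>
    continuous_slice (hqk _) (hJT ht₀J)
  have hrs : StronglyMeasurable fun x => r (t₀, x) := hrm.comp_measurable measurable_prodMk_left
  have hbb : Tendsto (fun n : ℕ × ℕ => b n.1 + b n.2) (atTop ×ˢ atTop) (𝓝 0) := by
    simpa using (hb0.comp tendsto_fst).add (hb0.comp tendsto_snd)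
  have h4 := tendsto_of_tendsto_of_tendsto_of_le_of_le tendsto_const_nhds hbb
    (f := fun n : ℕ × ℕ => ∫⁻ x in Icc (-R) R, ‖qk (ψ n.1) (t₀, x) - qk (ψ n.2) (t₀, x)‖ₑ)
    (fun _ => zero_le) fun n => by
      simp only [hb]
      have hme : Measurable fun x => ‖qk (ψ n.1) (t₀, x) - r (t₀, x)‖ₑ :=
        ((hsl n.1).stronglyMeasurable.sub hrs).enorm
      rw [← lintegral_add_left hme]
      refine lintegral_mono fun x => ?_
      calc ‖qk (ψ n.1) (t₀, x) - qk (ψ n.2) (t₀, x)‖ₑ =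
          ‖(qk (ψ n.1) (t₀, x) - r (t₀, x)) - (qk (ψ n.2) (t₀, x) - r (t₀, x))‖ₑ := by
            rw [sub_sub_sub_cancel_right]
        _ ≤ _ := enorm_sub_le
  have h5 := (ENNReal.tendsto_toReal ENNReal.zero_ne_top).comp h4
  refine h5.congr fun n => ?_
  simp only [Function.comp]
  exact (integral_norm_eq_lintegral_enorm ((hsl n.1).sub (hsl n.2)).aestronglyMeasurable).symm

end GoodTime

/-! ### Passage to the limit in the scalar frame system. -/

/-- Convergence in `L¹_loc` of the slab. -/
structure TendstoL1Loc (T : ℝ) (f : ℕ → ℝ × ℝ → ℝ) (g : ℝ × ℝ → ℝ) : Prop where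
  mem : ∀ n, LocMemLp T 1 (f n)
  mem_lim : LocMemLp T 1 g
  tendsto : ∀ K : Set (ℝ × ℝ), IsCompact K → K ⊆ slab T →
    Tendsto (fun n => eLpNorm (fun z => f n z - g z) 1 (volume.restrict K)) atTop (𝓝 0)

namespace TendstoL1Loc

variable {T : ℝ} {f f' : ℕ → ℝ × ℝ → ℝ} {g g' : ℝ × ℝ → ℝ}

theorem add (h : TendstoL1Loc T f g) (h' : TendstoL1Loc T f' g') :
    TendstoL1Loc T (fun n z => f n z + f' n z) (fun z => g z + g' z) where
  mem n := (h.mem n).add (h'.mem n)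
  mem_lim := h.mem_lim.add h'.mem_lim
  tendsto K hK hKT := by
    have h1 := (h.tendsto K hK hKT).add (h'.tendsto K hK hKT)
    rw [add_zero] at h1
    refine tendsto_of_tendsto_of_tendsto_of_le_of_le tendsto_const_nhds h1 (fun _ => zero_le)
      fun n => ?_
    refine le_trans (le_of_eq ?_) (eLpNorm_add_le ((h.mem n K hK hKT).1.sub (h.mem_lim K hK hKT).1)
      ((h'.mem n K hK hKT).1.sub (h'.mem_lim K hK hKT).1) le_rfl)
    congr 1; ext z; simp only [Pi.add_apply]; ring

theorem neg (h : TendstoL1Loc T f g) : TendstoL1Loc T (fun n z => -f n z) (fun z => -g z) where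
  mem n := (h.mem n).neg
  mem_lim := h.mem_lim.neg
  tendsto K hK hKT := by
    refine (h.tendsto K hK hKT).congr fun n => eLpNorm_congr_norm_ae (Eventually.of_forall fun z => ?_)
    rw [← norm_neg]; congr 1; ring

theorem const_mul (h : TendstoL1Loc T f g) (c : ℝ) :
    TendstoL1Loc T (fun n z => c * f n z) (fun z => c * g z) where
  mem n K hK hKT := (h.mem n K hK hKT).const_mul c
  mem_lim K hK hKT := (h.mem_lim K hK hKT).const_mul c
  tendsto K hK hKT := by
    have h1 := ENNReal.Tendsto.const_mul (a := ‖c‖ₑ) (h.tendsto K hK hKT) (Or.inr enorm_ne_top)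
    rw [mul_zero] at h1
    refine h1.congr fun n => ?_
    rw [← eLpNorm_const_smul]
    congr 1; ext z; simp only [Pi.smul_apply, smul_eq_mul]; ring

theorem congr (h : TendstoL1Loc T f g) (h1 : ∀ n z, f n z = f' n z) (h2 : ∀ z, g z = g' z) :
    TendstoL1Loc T f' g' := by
  have e1 : f = f' := by ext n z; exact h1 n z
  have e2 : g = g' := by ext z; exact h2 z
  rwa [← e1, ← e2]

/-- Multiplication by a bounded sequence that converges almost everywhere. -/
theorem mul_bdd (h : TendstoL1Loc T f g) {y : ℕ → ℝ × ℝ → ℝ} {w : ℝ × ℝ → ℝ}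
    (hy : ∀ n, AEStronglyMeasurable (y n) (volume.restrict (slab T : Set (ℝ × ℝ))))
    (hw : AEStronglyMeasurable w (volume.restrict (slab T : Set (ℝ × ℝ))))
    (hb : ∀ n, ∀ᵐ z ∂volume.restrict (slab T : Set (ℝ × ℝ)), |y n z| ≤ 1)
    (hlim : ∀ᵐ z ∂volume.restrict (slab T : Set (ℝ × ℝ)),
      Tendsto (fun n => y n z) atTop (𝓝 (w z))) :
    TendstoL1Loc T (fun n z => f n z * y n z) (fun z => g z * w z) := by
  have hbw : ∀ᵐ z ∂volume.restrict (slab T : Set (ℝ × ℝ)), |w z| ≤ 1 := by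
    filter_upwards [hlim, ae_all_iff.2 hb] with z h1 h2
    exact le_of_tendsto h1.abs (Eventually.of_forall h2)
  refine ⟨fun n => (h.mem n).mul_bdd (hy n) ⟨1, zero_le_one, hb n⟩,
    h.mem_lim.mul_bdd hw ⟨1, zero_le_one, hbw⟩, fun K hK hKT => ?_⟩
  have mg := (h.mem_lim K hK hKT)
  have mf := fun n => (h.mem n K hK hKT)
  have my := fun n => (hy n).mono_set hKT
  have mw := hw.mono_set hKT
  have hbK := fun n => ae_restrict_of_ae_restrict_of_subset hKT (hb n)
  have hbwK := ae_restrict_of_ae_restrict_of_subset hKT hbw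
  have hlK := ae_restrict_of_ae_restrict_of_subset hKT hlim
  -- Dominated convergence with the majorant `2 |g|`; convergence of `y n` in norm is not needed.
  have h2 : Tendsto (fun n => ∫⁻ z in K, ‖g z * (y n z - w z)‖ₑ) atTop (𝓝 0) := by
    have := tendsto_lintegral_of_dominated_convergence' (μ := volume.restrict K)
      (F := fun n z => ‖g z * (y n z - w z)‖ₑ) (f := fun _ => 0) (fun z => ‖g z‖ₑ * 2)
      (fun n => (mg.1.mul ((my n).sub mw)).enorm) (fun n => ?_) ?_ ?_
    · simpa using this
    · filter_upwards [hbK n, hbwK] with z h3 h4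
      rw [enorm_mul]
      gcongr
      refine enorm_sub_le.trans ?_
      have h5 : ‖y n z‖ₑ ≤ 1 := by
        rw [← ofReal_norm, ← ENNReal.ofReal_one]; exact ENNReal.ofReal_le_ofReal h3
      have h6 : ‖w z‖ₑ ≤ 1 := by
        rw [← ofReal_norm, ← ENNReal.ofReal_one]; exact ENNReal.ofReal_le_ofReal h4
      exact (add_le_add h5 h6).trans (by norm_num)
    · rw [lintegral_mul_const' _ _ (by norm_num)]
      refine ENNReal.mul_ne_top ?_ (by norm_num)
      rw [← eLpNorm_one_eq_lintegral_enorm]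
      exact mg.eLpNorm_ne_top
    · filter_upwards [hlK] with z hz
      have : Tendsto (fun n => g z * (y n z - w z)) atTop (𝓝 (g z * (w z - w z))) :=
        (hz.sub_const _).const_mul _
      rw [sub_self, mul_zero] at this
      simpa using this.enorm
  have h1 := (h.tendsto K hK hKT).add h2
  rw [add_zero] at h1
  refine tendsto_of_tendsto_of_tendsto_of_le_of_le tendsto_const_nhds h1 (fun _ => zero_le)
    fun n => ?_
  have e : (fun z => f n z * y n z - g z * w z) =
      (fun z => (f n z - g z) * y n z) + fun z => g z * (y n z - w z) := by
    ext z; simp only [Pi.add_apply]; ring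
  simp only [e]
  refine (eLpNorm_add_le (((mf n).1.sub mg.1).mul (my n)) (mg.1.mul ((my n).sub mw)) le_rfl).trans ?_
  refine add_le_add (eLpNorm_mono_ae ?_) (eLpNorm_one_eq_lintegral_enorm).le
  filter_upwards [hbK n] with z hz
  rw [Pi.mul_apply, norm_mul]
  exact mul_le_of_le_one_right (norm_nonneg _) hz

theorem tendsto_integral (h : TendstoL1Loc T f g) {ψ : ℝ × ℝ → ℝ} (hψ : Continuous ψ)
    {K : Set (ℝ × ℝ)} (hK : IsCompact K) (hKT : K ⊆ slab T) (h0 : ∀ z ∉ K, ψ z = 0) :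
    Tendsto (fun n => ∫ z, ψ z * f n z) atTop (𝓝 (∫ z, ψ z * g z)) := by
  have ie : ∀ w : ℝ × ℝ → ℝ, ∫ z, ψ z * w z = ∫ z in K, ψ z * w z := fun w =>
    (setIntegral_eq_integral_of_forall_compl_eq_zero fun z hz => by rw [h0 z hz, zero_mul]).symm
  obtain ⟨C, hC⟩ := hK.exists_bound_of_continuousOn hψ.continuousOn
  simp only [ie]
  have im : ∀ {w : ℝ × ℝ → ℝ}, LocMemLp T 1 w → Integrable (fun z => ψ z * w z) (volume.restrict K) :=
    fun hw => (integrable_mul_of_eq_zero_off hK hψ h0 (hw.integrableOn hK hKT)).integrableOn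
  refine tendsto_integral_of_L1' _ (im h.mem_lim).1 (Eventually.of_forall fun n => im (h.mem n)) ?_
  have h1 := ENNReal.Tendsto.const_mul (a := ENNReal.ofReal C) (h.tendsto K hK hKT)
    (Or.inr ENNReal.ofReal_ne_top)
  rw [mul_zero] at h1
  refine tendsto_of_tendsto_of_tendsto_of_le_of_le tendsto_const_nhds h1 (fun _ => zero_le)
    fun n => ?_
  refine eLpNorm_le_mul_eLpNorm_of_ae_le_mul ?_ 1
  refine (ae_restrict_iff' hK.measurableSet).2 (Eventually.of_forall fun z hz => ?_)
  simp only [Pi.sub_apply]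
  rw [← mul_sub, norm_mul]
  exact mul_le_mul_of_nonneg_right (hC z hz) (norm_nonneg _)

end TendstoL1Loc

/-- A weak limit of weakly regular functions. -/
theorem WeakReg.of_tendsto {T : ℝ} {a a' G H : ℕ → ℝ × ℝ → ℝ} {b b' G' H' : ℝ × ℝ → ℝ}
    (h : ∀ n, WeakReg T (a n) (a' n) (G n) (H n)) (ha : TendstoL1Loc T a b)
    (ha' : TendstoL1Loc T a' b') (hG : TendstoL1Loc T G G') (hH : TendstoL1Loc T H H')
    (hm : AEStronglyMeasurable b (volume.restrict (slab T)))
    (hb : ∀ᵐ z ∂volume.restrict (slab T : Set (ℝ × ℝ)), |b z| ≤ 1)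
    (h1 : LocMemLp T 2 b') (h2 : LocMemLp T 2 G') : WeakReg T b b' G' H' where
  meas := hm
  bdd := ⟨1, zero_le_one, hb⟩
  memLp_dx := h1
  memLp_G := h2
  memLp_H := hH.mem_lim
  wdx φ := by
    have l1 := ha'.tendsto_integral φ.continuous φ.hasCompactSupport φ.tsupport_subset
      fun z hz => φ.zero_off hz
    have l2 := ha.tendsto_integral (continuous_dx φ.contDiff) φ.hasCompactSupport φ.tsupport_subset
      fun z hz => dx_eq_zero hz
    refine tendsto_nhds_unique l1 (l2.neg.congr fun n => ((h n).wdx φ).symm)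
  wdt φ := by
    have l1 := ha.tendsto_integral (continuous_dt φ.contDiff) φ.hasCompactSupport φ.tsupport_subset
      fun z hz => dt_eq_zero hz
    have l2 := hG.tendsto_integral (continuous_dx φ.contDiff) φ.hasCompactSupport φ.tsupport_subset
      fun z hz => dx_eq_zero hz
    have l3 := hH.tendsto_integral φ.continuous φ.hasCompactSupport φ.tsupport_subset
      fun z hz => φ.zero_off hz
    rw [integral_add (hG.mem_lim.integrable_dx_test φ) (hH.mem_lim.integrable_test φ)]
    refine tendsto_nhds_unique l1.neg ((l2.add l3).congr fun n => ?_)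
    rw [(h n).wdt φ, integral_add ((hG.mem n).integrable_dx_test φ) ((hH.mem n).integrable_test φ)]

section Quadratic

variable {T : ℝ} {q : ℝ × ℝ → ℂ} {qk : ℕ → ℝ × ℝ → ℂ}

/-- By Cauchy–Schwarz. This is where strong convergence in `L²_loc` matters: the sources are
quadratic in `q`. -/
theorem TendstoL1Loc.mul_of_L2 {f f' : ℕ → ℝ × ℝ → ℝ} {g g' : ℝ × ℝ → ℝ}
    (hf : ∀ n, LocMemLp T 2 (f n)) (hg : LocMemLp T 2 g) (hf' : ∀ n, LocMemLp T 2 (f' n))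
    (hg' : LocMemLp T 2 g')
    (h : ∀ K : Set (ℝ × ℝ), IsCompact K → K ⊆ slab T →
      Tendsto (fun n => eLpNorm (fun z => f n z - g z) 2 (volume.restrict K)) atTop (𝓝 0))
    (h' : ∀ K : Set (ℝ × ℝ), IsCompact K → K ⊆ slab T →
      Tendsto (fun n => eLpNorm (fun z => f' n z - g' z) 2 (volume.restrict K)) atTop (𝓝 0)) :
    TendstoL1Loc T (fun n z => f n z * f' n z) (fun z => g z * g' z) := by
  refine ⟨fun n => (hf n).mul (hf' n), hg.mul hg', fun K hK hKT => ?_⟩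
  set μ := volume.restrict K
  have mf := fun n => hf n K hK hKT
  have mf' := fun n => hf' n K hK hKT
  have mg := hg K hK hKT
  have mg' := hg' K hK hKT
  have prod : ∀ {a b : ℝ × ℝ → ℝ}, AEStronglyMeasurable a μ → AEStronglyMeasurable b μ →
      eLpNorm (fun z => a z * b z) 1 μ ≤ eLpNorm a 2 μ * eLpNorm b 2 μ := fun ha hb => by
    have := eLpNorm_le_eLpNorm_mul_eLpNorm_of_nnnorm (μ := μ) (p := 2) (q := 2) (r := 1) ha hb
      (fun x y : ℝ => x * y) 1 (Eventually.of_forall fun z => by rw [one_mul, nnnorm_mul])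
    simpa using this
  have l1 := h K hK hKT
  have l2 := h' K hK hKT
  have hbd : Tendsto (fun n => eLpNorm (fun z => f n z - g z) 2 μ *
      (eLpNorm (fun z => f' n z - g' z) 2 μ + eLpNorm g' 2 μ) +
      eLpNorm g 2 μ * eLpNorm (fun z => f' n z - g' z) 2 μ) atTop (𝓝 0) := by
    have := (ENNReal.Tendsto.mul l1 (Or.inr (by simpa using mg'.eLpNorm_ne_top))
      (l2.add_const (eLpNorm g' 2 μ)) (Or.inr (by simp))).add
      (ENNReal.Tendsto.const_mul (a := eLpNorm g 2 μ) l2 (Or.inr mg.eLpNorm_ne_top))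
    simpa using this
  refine tendsto_of_tendsto_of_tendsto_of_le_of_le tendsto_const_nhds hbd (fun _ => zero_le)
    fun n => ?_
  have e : (fun z => f n z * f' n z - g z * g' z) =
      (fun z => (f n z - g z) * f' n z) + fun z => g z * (f' n z - g' z) := by
    ext z; simp only [Pi.add_apply]; ring
  simp only [e]
  refine (eLpNorm_add_le (((mf n).1.sub mg.1).mul (mf' n).1)
    (mg.1.mul ((mf' n).1.sub mg'.1)) le_rfl).trans (add_le_add ?_ ?_)
  · refine (prod ((mf n).1.sub mg.1) (mf' n).1).trans (mul_le_mul_right ?_ _)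
    have : f' n = (fun z => f' n z - g' z) + g' := by ext z; simp
    conv_lhs => rw [this]
    exact eLpNorm_add_le ((mf' n).1.sub mg'.1) mg'.1 (by norm_num)
  · exact prod mg.1 ((mf' n).1.sub mg'.1)

/-- A limit of solutions of the scalar frame system. -/
theorem FrameReg.of_tendsto {y₀ y₁ y₂ : ℕ → ℝ × ℝ → ℝ} {w₀ w₁ w₂ : ℝ × ℝ → ℝ}
    (hq : MemL2L2loc T q) (hqk : ∀ k, ContinuousOn (qk k) (slab T))
    (hlim : ∀ K : Set (ℝ × ℝ), IsCompact K → K ⊆ slab T →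
      Tendsto (fun k => eLpNorm (fun z => qk k z - q z) 2 (volume.restrict K)) atTop (𝓝 0))
    (h : ∀ n, FrameReg T (qk n) (y₀ n) (y₁ n) (y₂ n))
    (hb : ∀ n, ∀ᵐ z ∂volume.restrict (slab T : Set (ℝ × ℝ)),
      |y₀ n z| ≤ 1 ∧ |y₁ n z| ≤ 1 ∧ |y₂ n z| ≤ 1)
    (hm₀ : AEStronglyMeasurable w₀ (volume.restrict (slab T : Set (ℝ × ℝ))))
    (hm₁ : AEStronglyMeasurable w₁ (volume.restrict (slab T : Set (ℝ × ℝ))))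
    (hm₂ : AEStronglyMeasurable w₂ (volume.restrict (slab T : Set (ℝ × ℝ))))
    (h₀ : ∀ᵐ z ∂volume.restrict (slab T : Set (ℝ × ℝ)), Tendsto (fun n => y₀ n z) atTop (𝓝 (w₀ z)))
    (h₁ : ∀ᵐ z ∂volume.restrict (slab T : Set (ℝ × ℝ)), Tendsto (fun n => y₁ n z) atTop (𝓝 (w₁ z)))
    (h₂ : ∀ᵐ z ∂volume.restrict (slab T : Set (ℝ × ℝ)), Tendsto (fun n => y₂ n z) atTop (𝓝 (w₂ z))) :
    FrameReg T q w₀ w₁ w₂ := by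
  have c1 : ∀ n, ContinuousOn (fun z => (qk n z).re) (slab T) := fun n =>
    Complex.continuous_re.comp_continuousOn (hqk n)
  have c2 : ∀ n, ContinuousOn (fun z => (qk n z).im) (slab T) := fun n =>
    Complex.continuous_im.comp_continuousOn (hqk n)
  have m1 := hq.locMemLp_re
  have m2 := hq.locMemLp_im
  have l1 : ∀ K : Set (ℝ × ℝ), IsCompact K → K ⊆ slab T → Tendsto (fun n =>
      eLpNorm (fun z => (qk n z).re - (q z).re) 2 (volume.restrict K)) atTop (𝓝 0) :=
    fun K hK hKT => tendsto_of_tendsto_of_tendsto_of_le_of_le tendsto_const_nhds (hlim K hK hKT)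
      (fun _ => zero_le) fun n => eLpNorm_mono fun z => by
        rw [← Complex.sub_re]; exact Complex.abs_re_le_norm _
  have l2 : ∀ K : Set (ℝ × ℝ), IsCompact K → K ⊆ slab T → Tendsto (fun n =>
      eLpNorm (fun z => (qk n z).im - (q z).im) 2 (volume.restrict K)) atTop (𝓝 0) :=
    fun K hK hKT => tendsto_of_tendsto_of_tendsto_of_le_of_le tendsto_const_nhds (hlim K hK hKT)
      (fun _ => zero_le) fun n => eLpNorm_mono fun z => by
        rw [← Complex.sub_im]; exact Complex.abs_im_le_norm _
  have lc : ∀ n, LocMemLp T 2 (fun z => (qk n z).re) := fun n => (c1 n).locMemLp 2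
  have ld : ∀ n, LocMemLp T 2 (fun z => (qk n z).im) := fun n => (c2 n).locMemLp 2
  have one : LocMemLp T 2 (fun _ => (1 : ℝ)) := ContinuousOn.locMemLp continuousOn_const 2
  have one0 : ∀ K : Set (ℝ × ℝ), IsCompact K → K ⊆ slab T → Tendsto (fun _ : ℕ =>
      eLpNorm (fun _ : ℝ × ℝ => (1 : ℝ) - 1) 2 (volume.restrict K)) atTop (𝓝 0) :=
    fun K hK hKT => by simp
  -- The constant coefficient 1 puts the convergence of the frame coordinates themselves under the
  -- same multiplication lemma.
  have t0 : TendstoL1Loc T (fun _ _ => 1) (fun _ => 1) :=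
    (TendstoL1Loc.mul_of_L2 (fun _ => one) one (fun _ => one) one one0 one0).congr
      (fun _ _ => mul_one _) fun _ => mul_one _
  have t1 : TendstoL1Loc T (fun n z => (qk n z).re) (fun z => (q z).re) :=
    (TendstoL1Loc.mul_of_L2 lc m1 (fun _ => one) one l1 one0).congr
      (fun _ _ => mul_one _) fun _ => mul_one _
  have t2 : TendstoL1Loc T (fun n z => (qk n z).im) (fun z => (q z).im) :=
    (TendstoL1Loc.mul_of_L2 ld m2 (fun _ => one) one l2 one0).congr
      (fun _ _ => mul_one _) fun _ => mul_one _
  have t11 := TendstoL1Loc.mul_of_L2 lc m1 lc m1 l1 l1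
  have t12 := TendstoL1Loc.mul_of_L2 lc m1 ld m2 l1 l2
  have t22 := TendstoL1Loc.mul_of_L2 ld m2 ld m2 l2 l2
  have hn : ∀ w : ℂ, w.re * w.re + w.im * w.im = ‖w‖ ^ 2 := fun w => by
    rw [← Complex.normSq_eq_norm_sq, Complex.normSq_apply]
  have tn : TendstoL1Loc T (fun n z => 1 / 2 * ‖qk n z‖ ^ 2) (fun z => 1 / 2 * ‖q z‖ ^ 2) :=
    ((t11.add t22).const_mul (1 / 2)).congr (fun n z => by rw [hn]) fun z => by rw [hn]
  have b₀ := fun n => (hb n).mono fun z hz => hz.1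
  have b₁ := fun n => (hb n).mono fun z hz => hz.2.1
  have b₂ := fun n => (hb n).mono fun z hz => hz.2.2
  have bw : ∀ {y : ℕ → ℝ × ℝ → ℝ} {w : ℝ × ℝ → ℝ},
      (∀ n, ∀ᵐ z ∂volume.restrict (slab T : Set (ℝ × ℝ)), |y n z| ≤ 1) →
      (∀ᵐ z ∂volume.restrict (slab T : Set (ℝ × ℝ)), Tendsto (fun n => y n z) atTop (𝓝 (w z))) →
      ∀ᵐ z ∂volume.restrict (slab T : Set (ℝ × ℝ)), |w z| ≤ 1 := fun hb hl => by
    filter_upwards [hl, ae_all_iff.2 hb] with z h1 h2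
    exact le_of_tendsto h1.abs (Eventually.of_forall h2)
  have w0 := bw b₀ h₀
  have w1 := bw b₁ h₁
  have w2 := bw b₂ h₂
  have M0 : ∀ {f g}, TendstoL1Loc T f g → TendstoL1Loc T (fun n z => f n z * y₀ n z)
      (fun z => g z * w₀ z) := fun ht => ht.mul_bdd (fun n => (h n).reg₀.meas) hm₀ b₀ h₀
  have M1 : ∀ {f g}, TendstoL1Loc T f g → TendstoL1Loc T (fun n z => f n z * y₁ n z)
      (fun z => g z * w₁ z) := fun ht => ht.mul_bdd (fun n => (h n).reg₁.meas) hm₁ b₁ h₁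
  have M2 : ∀ {f g}, TendstoL1Loc T f g → TendstoL1Loc T (fun n z => f n z * y₂ n z)
      (fun z => g z * w₂ z) := fun ht => ht.mul_bdd (fun n => (h n).reg₂.meas) hm₂ b₂ h₂
  have e0 : TendstoL1Loc T y₀ w₀ := (M0 t0).congr (fun _ _ => one_mul _) fun _ => one_mul _
  have e1 : TendstoL1Loc T y₁ w₁ := (M1 t0).congr (fun _ _ => one_mul _) fun _ => one_mul _
  have e2 : TendstoL1Loc T y₂ w₂ := (M2 t0).congr (fun _ _ => one_mul _) fun _ => one_mul _
  have L : ∀ {w : ℝ × ℝ → ℝ}, AEStronglyMeasurable w (volume.restrict (slab T : Set (ℝ × ℝ))) →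
      (∀ᵐ z ∂volume.restrict (slab T : Set (ℝ × ℝ)), |w z| ≤ 1) →
      LocMemLp T 2 (fun z => (q z).re * w z) ∧ LocMemLp T 2 (fun z => (q z).im * w z) :=
    fun hm hb => ⟨m1.mul_bdd hm ⟨1, zero_le_one, hb⟩, m2.mul_bdd hm ⟨1, zero_le_one, hb⟩⟩
  have L0 := L hm₀ w0
  have L1 := L hm₁ w1
  have L2 := L hm₂ w2
  have z0 : TendstoL1Loc T (fun _ _ => 0) (fun _ => 0) :=
    (t0.const_mul 0).congr (fun _ _ => zero_mul _) fun _ => zero_mul _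
  refine ⟨WeakReg.of_tendsto (fun n => (h n).reg₀) e0 ((M1 t1).add (M2 t2))
      (((M1 t2).add (M2 t1).neg).congr (fun _ _ => (sub_eq_add_neg _ _).symm)
        fun _ => (sub_eq_add_neg _ _).symm) z0 hm₀ w0 (L1.1.add L2.2) ?_,
    WeakReg.of_tendsto (fun n => (h n).reg₁) e1 (M0 t1).neg (M0 t2).neg
      ((((M1 t12).add (M2 t22)).neg.add (M2 tn).neg).congr (fun _ _ => by ring) fun _ => by ring)
      hm₁ w1 L0.1.neg L0.2.neg,
    WeakReg.of_tendsto (fun n => (h n).reg₂) e2 (M0 t2).neg (M0 t1)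
      ((((M1 t11).add (M2 t12)).add (M1 tn)).congr (fun _ _ => by ring) fun _ => by ring)
      hm₂ w2 L0.2.neg L0.1⟩
  simpa only [sub_eq_add_neg] using L1.2.add L2.1.neg

end Quadratic

/-! ### From the scalar system back to the frame system and the Schrödinger map equation. -/

section Assembly

variable {T : ℝ} {q : ℝ × ℝ → ℂ} {u e : ℝ × ℝ → E3}

theorem MemL2L2loc.of_norm_le {F G : Type*} [NormedAddCommGroup F] [NormedAddCommGroup G]
    {w : ℝ × ℝ → F} {g : ℝ × ℝ → G} {C : ℝ} (hg : MemL2L2loc T g)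
    (hm : AEStronglyMeasurable w (volume.restrict (slab T : Set (ℝ × ℝ))))
    (h : ∀ᵐ z ∂volume.restrict (slab T : Set (ℝ × ℝ)), ‖w z‖ ≤ C * ‖g z‖) : MemL2L2loc T w := by
  intro K hK
  have hsub : Ioo (-T) T ×ˢ K ⊆ (slab T : Set (ℝ × ℝ)) := prod_mono le_rfl (subset_univ _)
  exact (hg K hK).of_le_mul (hm.mono_set hsub) (ae_restrict_of_ae_restrict_of_subset hsub h)

theorem memL2L2loc_const (c : ℝ) : MemL2L2loc T (fun _ => c) := by
  intro K hK
  have : IsFiniteMeasure (volume.restrict (Ioo (-T) T ×ˢ K)) := ⟨by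
    rw [Measure.restrict_apply_univ, Measure.volume_eq_prod, Measure.prod_prod, Real.volume_Ioo]
    exact ENNReal.mul_lt_top ENNReal.ofReal_lt_top hK.measure_lt_top⟩
  exact memLp_const c

theorem HasWeakDx.of_apply {w w' : ℝ × ℝ → E3} (hw : ∀ i, LocMemLp T 1 (fun z => w z i))
    (hw' : ∀ i, LocMemLp T 1 (fun z => w' z i))
    (h : ∀ (φ : 𝓓(slab T, ℝ)) i, ∫ z, φ z * w' z i = -∫ z, dx φ z * w z i) : HasWeakDx T w w' := by
  intro φ
  ext i
  rw [PiLp.neg_apply, integral_smul_apply (fun i => (hw' i).integrable_test φ),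
    integral_smul_apply (fun i => (hw i).integrable_dx_test φ), h]

theorem integral_dxMul_apply {g : ℝ × ℝ → ℝ} {w w' : ℝ × ℝ → E3} (hg : LocMemLp T 2 g)
    (hw : ∀ i, LocMemLp T 2 (fun z => w z i)) (hw' : ∀ i, LocMemLp T 2 (fun z => w' z i))
    (φ : 𝓓(slab T, ℝ)) (i : Fin 3) :
    (-∫ z, g z • (dx φ z • w z + φ z • w' z)) i =
      -∫ z, (dx φ z * (g z * w z i) + φ z * (g z * w' z i)) := by
  have hint : ∀ i, Integrable (fun z => (g z • (dx φ z • w z + φ z • w' z)) i) := fun i => by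
    have i1 := (hg.mul (hw i)).integrable_dx_test φ
    have i2 := (hg.mul (hw' i)).integrable_test φ
    refine (i1.add i2).congr (Eventually.of_forall fun z => ?_)
    simp; ring
  rw [PiLp.neg_apply, eval_integral_piLp hint]
  congr 1
  refine integral_congr_ae (Eventually.of_forall fun z => ?_)
  simp; ring

/-- `u ×` rotates the tangent plane by a quarter turn. With `a = q₁`, `b = q₂` this computes `u ×
∂_x u`. -/
theorem cross_smul_add_smul {u e : E3} (h : IsOrthoPair u e) (a b : ℝ) :
    cross u (a • e + b • cross u e) = a • cross u e - b • e := by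
  ext i
  have h1 := h.cross_cross_left i
  have h2 := cross_apply_add u e i
  rw [cross_apply_add]
  simp only [PiLp.add_apply, PiLp.smul_apply, PiLp.sub_apply, smul_eq_mul]
  linear_combination -a * h2 - b * h1

theorem continuous_cross : Continuous fun p : E3 × E3 => cross p.1 p.2 := by
  refine (PiLp.continuous_toLp 2 _).comp (continuous_pi fun i => ?_)
  have : ∀ p : E3 × E3, (p.1.ofLp ⨯₃ p.2.ofLp) i =
      p.1 (i + 1) * p.2 (i + 2) - p.1 (i + 2) * p.2 (i + 1) := fun p => cross_apply_add p.1 p.2 i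
  simp only [this]
  fun_prop

/-- A measurable frame whose coordinates solve the scalar frame system solves the frame system, and
its first vector is a weak solution of the Schrödinger map equation. -/
theorem isFrameSolution_of_frameReg (hq : MemL2L2loc T q)
    (hum : AEStronglyMeasurable u (volume.restrict (slab T : Set (ℝ × ℝ))))
    (hem : AEStronglyMeasurable e (volume.restrict (slab T : Set (ℝ × ℝ))))
    (ho : ∀ t ∈ Ioo (-T) T, ∀ᵐ x : ℝ, IsOrthoPair (u (t, x)) (e (t, x)))
    (hcu : ContL2loc T u) (hce : ContL2loc T e)
    (hreg : ∀ i, FrameReg T q (fun z => u z i) (fun z => e z i) (fun z => cross (u z) (e z) i)) :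
    IsWeakSchrodingerMap T u ∧ IsFrameSolution T q u e := by
  have hort := ae_slab_isOrthoPair hum hem ho
  have hq1 := hq.locMemLp_re
  have hq2 := hq.locMemLp_im
  have qm := hq.aestronglyMeasurable
  have m1 : AEStronglyMeasurable (fun z => (q z).re) (volume.restrict (slab T : Set (ℝ × ℝ))) :=
    Complex.continuous_re.comp_aestronglyMeasurable qm
  have m2 : AEStronglyMeasurable (fun z => (q z).im) (volume.restrict (slab T : Set (ℝ × ℝ))) :=
    Complex.continuous_im.comp_aestronglyMeasurable qm
  have hfm : AEStronglyMeasurable (fun z => cross (u z) (e z))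
      (volume.restrict (slab T : Set (ℝ × ℝ))) :=
    continuous_cross.comp_aestronglyMeasurable (hum.prodMk hem)
  have Lu : MemL2L2loc T u := (memL2L2loc_const 1).of_norm_le (C := 1) hum
    (hort.mono fun z hz => by simp [hz.1])
  have Le : MemL2L2loc T e := (memL2L2loc_const 1).of_norm_le (C := 1) hem
    (hort.mono fun z hz => by simp [hz.2.1])
  have Lf : MemL2L2loc T (fun z => cross (u z) (e z)) := (memL2L2loc_const 1).of_norm_le (C := 1) hfm
    (hort.mono fun z hz => by simp [hz.norm_cross])
  have Lux : MemL2L2loc T (fun z => (q z).re • e z + (q z).im • cross (u z) (e z)) := by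
    refine hq.of_norm_le (C := 2) ((m1.smul hem).add (m2.smul hfm)) (hort.mono fun z hz => ?_)
    refine (norm_add_le _ _).trans ?_
    rw [norm_smul, norm_smul, hz.2.1, hz.norm_cross]
    have := Complex.abs_re_le_norm (q z)
    have := Complex.abs_im_le_norm (q z)
    simp only [Real.norm_eq_abs]
    linarith
  have Lex : MemL2L2loc T (fun z => -((q z).re • u z)) := by
    refine hq.of_norm_le (C := 1) (m1.smul hum).neg (hort.mono fun z hz => ?_)
    rw [norm_neg, norm_smul, hz.1, mul_one, one_mul]
    exact Complex.abs_re_le_norm (q z)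
  have Lfx : MemL2L2loc T (fun z => -((q z).im • u z)) := by
    refine hq.of_norm_le (C := 1) (m2.smul hum).neg (hort.mono fun z hz => ?_)
    rw [norm_neg, norm_smul, hz.1, mul_one, one_mul]
    exact Complex.abs_im_le_norm (q z)
  have L1 : ∀ {w : ℝ × ℝ → E3}, MemL2L2loc T w → ∀ i, LocMemLp T 1 (fun z => w z i) := fun hw i =>
    (hw.locMemLp i).mono_exponent (by norm_num)
  have wu : HasWeakDx T u (fun z => (q z).re • e z + (q z).im • cross (u z) (e z)) :=
    HasWeakDx.of_apply (L1 Lu) (L1 Lux) fun φ i => (hreg i).reg₀.wdx φ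
  have we : HasWeakDx T e (fun z => -((q z).re • u z)) :=
    HasWeakDx.of_apply (L1 Le) (L1 Lex) fun φ i => (hreg i).reg₁.wdx φ
  have wf : HasWeakDx T (fun z => cross (u z) (e z)) (fun z => -((q z).im • u z)) :=
    HasWeakDx.of_apply (L1 Lf) (L1 Lfx) fun φ i => (hreg i).reg₂.wdx φ
  have hdu : ∀ (φ : 𝓓(slab T, ℝ)) i, (-∫ z, dt φ z • u z) i =
      ∫ z, dx φ z * ((q z).im * e z i - (q z).re * cross (u z) (e z) i) := fun φ i => by
    rw [PiLp.neg_apply, integral_smul_apply (fun i => (L1 Lu i).integrable_dt_test φ),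
      (hreg i).reg₀.wdt φ]
    simp
  have hnu : ∀ t ∈ Ioo (-T) T, ∀ᵐ x : ℝ, ‖u (t, x)‖ = 1 := fun t ht => (ho t ht).mono fun x hx => hx.1
  refine ⟨⟨⟨Lu, _, Lux, wu⟩, hcu, hnu, _, Lux, wu, fun φ => ?_⟩,
    ⟨⟨Lu, _, Lux, wu⟩, hcu, ⟨Le, _, Lex, we⟩, hce, hnu,
      fun t ht => (ho t ht).mono fun x hx => hx.2.1, fun t ht => (ho t ht).mono fun x hx => hx.2.2,
      ⟨_, _, ⟨_, Le, Lex, we, fun _ => rfl⟩, ⟨_, Lf, Lfx, wf, fun _ => rfl⟩, fun φ => ?_⟩, wu,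
      ⟨_, ⟨_, Lu, Lux, wu, fun _ => rfl⟩, fun φ => ?_⟩, we⟩⟩
  · ext i
    -- The flux of the scalar equation of `u` is, up to sign, `u × ∂_x u`, so `hdu` already is the
    -- Schrödinger map equation.
    have hc : ∀ᵐ z ∂volume.restrict (slab T : Set (ℝ × ℝ)),
        ∀ i, (q z).re * cross (u z) (e z) i - (q z).im * e z i =
        cross (u z) ((q z).re • e z + (q z).im • cross (u z) (e z)) i := by
      filter_upwards [hort] with z hz i
      rw [cross_smul_add_smul hz]
      simp
    have hl : ∀ i, LocMemLp T 1
        (fun z => cross (u z) ((q z).re • e z + (q z).im • cross (u z) (e z)) i) := fun i => by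
      refine LocMemLp.congr ?_ (hc.mono fun z hz => hz i)
      have := ((hreg i).reg₀.memLp_G.neg).mono_exponent (p := 1) (by norm_num)
      simpa only [neg_sub] using this
    rw [hdu, PiLp.neg_apply, integral_smul_apply (fun i => (hl i).integrable_dx_test φ),
      ← integral_congr_slab (hc.mono fun z hz => hz i) (fun _ => φ.dx_zero_off_slab), ← integral_neg]
    refine integral_congr_ae (Eventually.of_forall fun z => ?_)
    simp only; ring
  -- Expanding the two products by their definition gives the flux of `hdu` and the zeroth-order
  -- terms `±q₁ q₂ u`, which cancel.
  · ext i
    rw [hdu, PiLp.add_apply, integral_dxMul_apply hq2.neg Le.locMemLp Lex.locMemLp,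
      integral_dxMul_apply hq1 Lf.locMemLp Lfx.locMemLp, ← neg_add, ← integral_add, ← integral_neg]
    · refine integral_congr_ae (Eventually.of_forall fun z => ?_)
      simp only [PiLp.neg_apply, PiLp.smul_apply, smul_eq_mul]; ring
    · exact ((hq2.neg.mul (Le.locMemLp i)).integrable_dx_test φ).add
        ((hq2.neg.mul (Lex.locMemLp i)).integrable_test φ)
    · exact ((hq1.mul (Lf.locMemLp i)).integrable_dx_test φ).add
        ((hq1.mul (Lfx.locMemLp i)).integrable_test φ)
  · have n2 : LocMemLp T 1 (fun z => ‖q z‖ ^ 2) := fun K hK hKT =>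
      memLp_one_iff_integrable.2 ((hq.memLp hK hKT).integrable_norm_pow (by norm_num))
    have k2 : ∀ i, LocMemLp T 1 (fun z => ((-(1 / 2) * ‖q z‖ ^ 2 : ℝ) • cross (u z) (e z)) i) := by
      intro i K hK hKT
      have := (n2.mul_bdd (hreg i).reg₂.meas (hreg i).reg₂.bdd K hK hKT).const_mul (-(1 / 2))
      simpa only [PiLp.smul_apply, smul_eq_mul, mul_assoc] using this
    ext i
    rw [PiLp.add_apply, PiLp.neg_apply, integral_smul_apply (fun i => (L1 Le i).integrable_dt_test φ),
      integral_dxMul_apply hq2.neg Lu.locMemLp Lux.locMemLp,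
      integral_smul_apply (fun i => (k2 i).integrable_test φ), (hreg i).reg₁.wdt φ,
      ← integral_neg, ← integral_add]
    · refine integral_congr_ae (Eventually.of_forall fun z => ?_)
      simp only [PiLp.add_apply, PiLp.smul_apply, smul_eq_mul]; ring
    · exact (((hreg i).reg₁.memLp_G.mono_exponent (p := 1) (by norm_num)).integrable_dx_test φ).add
        ((hreg i).reg₁.memLp_H.integrable_test φ)
    · exact (((hq2.neg.mul (Lu.locMemLp i)).integrable_dx_test φ).add
        ((hq2.neg.mul (Lux.locMemLp i)).integrable_test φ)).neg

end Assembly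

/-! ### Existence by approximation. -/

section Existence

variable {T : ℝ} {q : ℝ × ℝ → ℂ} {qk : ℕ → ℝ × ℝ → ℂ}

/-- Fubini's theorem, which needs the set of convergence to be measurable. Norms of differences,
truncated to the slab, are globally measurable real functions and express the convergence as a limit
equal to zero. -/
theorem ae_tendsto_slab {F : Type*} [NormedAddCommGroup F] {Y : ℕ → ℝ × ℝ → F} {Z : ℝ × ℝ → F}
    (hY : ∀ n, ContinuousOn (Y n) (slab T)) (hZ : StronglyMeasurable Z)
    (h : ∀ t ∈ Ioo (-T) T, ∀ᵐ x : ℝ, Tendsto (fun n => Y n (t, x)) atTop (𝓝 (Z (t, x)))) :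
    ∀ᵐ z ∂volume.restrict (slab T : Set (ℝ × ℝ)), Tendsto (fun n => Y n z) atTop (𝓝 (Z z)) := by
  have hs : MeasurableSet (slab T : Set (ℝ × ℝ)) := (slab T).isOpen.measurableSet
  have hm : ∀ n, Measurable ((slab T : Set (ℝ × ℝ)).indicator fun z => ‖Y n z - Z z‖) := fun n => by
    have c : StronglyMeasurable ((slab T : Set (ℝ × ℝ)).indicator (Y n)) := by
      refine stronglyMeasurable_of_restrict_of_restrict_compl hs ?_ ?_
      · exact (continuousOn_iff_continuous_domRestrict.1
          ((hY n).congr fun z hz => indicator_of_mem hz _)).stronglyMeasurable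
      · rw [show ((slab T : Set (ℝ × ℝ))ᶜ).domRestrict ((slab T : Set (ℝ × ℝ)).indicator (Y n)) =
          fun _ => 0 from funext fun z => indicator_of_notMem z.2 _]
        exact stronglyMeasurable_const
    have e : ((slab T : Set (ℝ × ℝ)).indicator fun z => ‖Y n z - Z z‖) =
        (slab T : Set (ℝ × ℝ)).indicator
          fun z => ‖(slab T : Set (ℝ × ℝ)).indicator (Y n) z - Z z‖ := by
      refine indicator_congr fun z hz => ?_
      rw [indicator_of_mem hz]
    rw [e]
    exact (c.sub hZ).norm.measurable.indicator hs
  have hset := measurableSet_tendsto (𝓝 (0 : ℝ)) (l := atTop) hm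
  have key : ∀ᵐ z ∂volume.restrict (slab T : Set (ℝ × ℝ)), z ∈ {z | Tendsto
      (fun n => (slab T : Set (ℝ × ℝ)).indicator (fun z => ‖Y n z - Z z‖) z) atTop (𝓝 (0 : ℝ))} := by
    rw [ae_slab_iff, Measure.ae_prod_mem_iff_ae_ae_mem hset]
    filter_upwards [ae_restrict_mem measurableSet_Ioo] with t ht
    filter_upwards [h t ht] with x hx
    have hz : (t, x) ∈ (slab T : Set (ℝ × ℝ)) := ⟨ht, mem_univ _⟩
    simpa only [mem_ofPred_eq, indicator_of_mem hz] using tendsto_iff_norm_sub_tendsto_zero.1 hx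
  filter_upwards [key, ae_restrict_mem hs] with z hz hzs
  rw [tendsto_iff_norm_sub_tendsto_zero]
  simpa only [mem_ofPred_eq, indicator_of_mem hzs] using hz

theorem ContL2loc.of_norm_sub_le {F G : Type*} [NormedAddCommGroup F] [NormedSpace ℝ F]
    [NormedAddCommGroup G] [NormedSpace ℝ G] {Z : ℝ × ℝ → F} (hZ : ContL2loc T Z) (L : F →L[ℝ] G)
    (hL : ∀ v, ‖L v‖ ≤ ‖v‖) : ContL2loc T fun z => L (Z z) := fun K hK t₀ ht₀ => by
  obtain ⟨h1, h2⟩ := hZ K hK t₀ ht₀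
  refine ⟨h1.mono (L.continuous.comp_aestronglyMeasurable h1.1) (ae_of_all _ fun x => hL _), ?_⟩
  refine tendsto_of_tendsto_of_tendsto_of_le_of_le tendsto_const_nhds h2 (fun _ => zero_le)
    fun t => eLpNorm_mono fun x => ?_
  rw [← map_sub]
  exact hL _

theorem isClosed_isOrthoPair : IsClosed {p : E3 × E3 | IsOrthoPair p.1 p.2} :=
  (isClosed_eq continuous_fst.norm continuous_const).inter
    ((isClosed_eq continuous_snd.norm continuous_const).inter
      (isClosed_eq (continuous_fst.inner continuous_snd) continuous_const))

/-- Smooth frames of smooth potentials converging in `L²_loc`, equal at a common good time, form a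
Cauchy sequence locally uniformly in time with values in `L²_loc`. -/
theorem frames_cauchy (hq : MemL2L2loc T q) (hqk : ∀ k, ContDiffOn ℝ ∞ (qk k) (slab T))
    (hlim : ∀ K : Set (ℝ × ℝ), IsCompact K → K ⊆ slab T →
      Tendsto (fun k => eLpNorm (fun z => qk k z - q z) 2 (volume.restrict K)) atTop (𝓝 0))
    {t₀ : ℝ} (ht₀ : t₀ ∈ Ioo (-T) T)
    (hgood : ∀ R : ℝ, Tendsto (fun n : ℕ × ℕ => ∫ x in Icc (-R) R,
      ‖qk n.1 (t₀, x) - qk n.2 (t₀, x)‖) (atTop ×ˢ atTop) (𝓝 0))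
    {u e f : ℕ → ℝ × ℝ → E3} (hu : ∀ k, ContinuousOn (u k) (slab T))
    (he : ∀ k, ContinuousOn (e k) (slab T)) (hf : ∀ k, ContinuousOn (f k) (slab T))
    (hrow : ∀ k i, IsSmoothRow T (qk k) (fun z => u k z i) (fun z => e k z i) (fun z => f k z i))
    (h0 : ∀ k l, u k (t₀, 0) = u l (t₀, 0)) (h1 : ∀ k l, e k (t₀, 0) = e l (t₀, 0))
    (h2 : ∀ k l, f k (t₀, 0) = f l (t₀, 0)) {S : ℝ} (R : ℝ) (hS : S < T) {ε : ℝ≥0∞} (hε : 0 < ε) :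
    ∃ N, ∀ k ≥ N, ∀ l ≥ N, ∀ t ∈ Icc (-S) S,
      eLpNorm (fun x => ((u k (t, x), e k (t, x), f k (t, x)) : E3 × E3 × E3) -
        (u l (t, x), e l (t, x), f l (t, x))) 2 (volume.restrict (Icc (-R) R)) < ε := by
  -- The time interval is enlarged to contain the normalisation time, and the radius is doubled
  -- because the stability estimate holds on half of the interval in `x`.
  set S' := max S |t₀| with hS'
  have hS'T : S' < T := max_lt hS (abs_lt.2 ht₀)
  set R' := max 1 (2 * R) with hR'
  have hR1 : 1 ≤ R' := le_max_left _ _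
  have hRR : R ≤ R' / 2 := by have := le_max_right 1 (2 * R); linarith
  have hc := fun k => (hqk k).continuousOn
  have hK : Icc (-S') S' ×ˢ Icc (-R') R' ⊆ (slab T : Set (ℝ × ℝ)) := fun z hz =>
    ⟨Icc_subset_Ioo_of_lt hS'T hz.1, mem_univ _⟩
  have hKc : IsCompact (Icc (-S') S' ×ˢ Icc (-R') R') := isCompact_Icc.prod isCompact_Icc
  have lim := tendsto_integral_norm_sub_mul hq hc hKc hK (hlim _ hKc hK)
  have lim2 := ENNReal.tendsto_ofReal ((((hgood R').const_mul (16 * R')).add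
    (lim.const_mul 42)).const_mul 6).sqrt
  simp only [mul_zero, add_zero, Real.sqrt_zero, ENNReal.ofReal_zero] at lim2
  have ev := lim2.eventually_lt_const hε
  rw [prod_atTop_atTop_eq] at ev
  obtain ⟨N, hN⟩ := eventually_atTop_prod_self'.1 ev
  refine ⟨N, fun k hk l hl t ht => lt_of_le_of_lt ?_ (hN k hk l hl)⟩
  have ht' : t ∈ Icc (-S') S' :=
    Icc_subset_Icc (neg_le_neg (le_max_left _ _)) (le_max_left _ _) ht
  have hs' : t₀ ∈ Icc (-S') S' := abs_le.1 (le_max_right S |t₀|)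
  exact (eLpNorm_mono_measure _ (Measure.restrict_mono
    (Icc_subset_Icc (neg_le_neg hRR) hRR) le_rfl)).trans
    (eLpNorm_frame_sub_le (hqk k) (hqk l) (hu k) (he k) (hf k) (hu l) (he l) (hf l) (hrow k)
      (hrow l) hS'T hR1 hs' ht' (h0 k l) (h1 k l) (h2 k l))

/-- The constraints are closed conditions, so pointwise convergence preserves them. This is why
almost everywhere convergence at every single time is needed. -/
theorem limit_frame {u e f : ℕ → E3} {W : E3 × E3 × E3}
    (h : Tendsto (fun n => (u n, e n, f n)) atTop (𝓝 W)) (ho : ∀ n, IsOrthoPair (u n) (e n))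
    (hf : ∀ n, f n = cross (u n) (e n)) : IsOrthoPair W.1 W.2.1 ∧ W.2.2 = cross W.1 W.2.1 := by
  obtain ⟨a, b, c⟩ := W
  have a1 : Tendsto u atTop (𝓝 a) := h.fst_nhds
  have a2 : Tendsto e atTop (𝓝 b) := h.snd_nhds.fst_nhds
  have a3 : Tendsto f atTop (𝓝 c) := h.snd_nhds.snd_nhds
  have a12 : Tendsto (fun n => (u n, e n)) atTop (𝓝 (a, b)) := a1.prodMk_nhds a2
  have key : ∀ g : E3 → E3 → E3, (Continuous fun p : E3 × E3 => g p.1 p.2) →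
      Tendsto (fun n => g (u n) (e n)) atTop (𝓝 (g a b)) := fun g hg =>
    (hg.tendsto (a, b)).comp a12
  have a4 := key cross continuous_cross
  have hp : (a, b) ∈ {p : E3 × E3 | IsOrthoPair p.1 p.2} :=
    isClosed_isOrthoPair.mem_of_tendsto a12 (Eventually.of_forall ho)
  exact ⟨hp, tendsto_nhds_unique a3 ((funext hf : f = fun n => cross (u n) (e n)) ▸ a4)⟩

/-- All approximating frames are normalised to the standard basis at `(t₀, 0)`, with `t₀` a good
time, since without a common normalisation their rotations would be arbitrary. The third vector `f`
is carried through the limit and identified with `u × e` only afterwards. -/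
theorem exists_isFrameSolution (hT : 0 < T) (hq : MemL2L2loc T q)
    (hqk : ∀ k, IsSmoothNLS T (qk k))
    (hlim : ∀ K : Set (ℝ × ℝ), IsCompact K → K ⊆ slab T →
      Tendsto (fun k => eLpNorm (fun z => qk k z - q z) 2 (volume.restrict K)) atTop (𝓝 0)) :
    ∃ u e : ℝ × ℝ → E3, IsWeakSchrodingerMap T u ∧ IsFrameSolution T q u e := by
  obtain ⟨ψ, hψ, t₀, ht₀, hgood⟩ := exists_good_time hT hq (fun k => (hqk k).1.continuousOn) hlim
  have hz₀ : (t₀, (0 : ℝ)) ∈ slab T := ⟨ht₀, mem_univ _⟩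
  choose u e f hF hu0 he0 using fun k => (hqk (ψ k)).exists_smooth_frame hz₀
  have hu := fun k => (hF k).smooth_u.continuousOn
  have he := fun k => (hF k).smooth_e.continuousOn
  have hf := fun k => (hF k).smooth_f.continuousOn
  have hrow := fun k i => (hF k).isSmoothRow i
  have hf0 : ∀ k l, f k (t₀, 0) = f l (t₀, 0) := fun k l => by
    rw [(hF k).f_eq _ hz₀, (hF l).f_eq _ hz₀, hu0, hu0, he0, he0]
  obtain ⟨φ, hφ, Z, hZ, hlimZ, hcZ⟩ := exists_subseq_tendsto_of_cauchy hT
    (Y := fun k z => ((u k z, e k z, f k z) : E3 × E3 × E3))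
    (fun k => (hu k).prodMk ((he k).prodMk (hf k)))
    fun S R hS ε hε => frames_cauchy (qk := fun k => qk (ψ k)) hq (fun k => (hqk (ψ k)).1)
      (fun K hK hKT => (hlim K hK hKT).comp hψ.tendsto_atTop) ht₀ hgood hu he hf hrow
      (fun k l => (hu0 k).trans (hu0 l).symm) (fun k l => (he0 k).trans (he0 l).symm) hf0 R hS hε
  have comp : ∀ z ∈ slab T, Tendsto (fun n => ((u (φ n) z, e (φ n) z, f (φ n) z) : E3 × E3 × E3))
      atTop (𝓝 (Z z)) → IsOrthoPair (Z z).1 (Z z).2.1 ∧ (Z z).2.2 = cross (Z z).1 (Z z).2.1 := by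
    exact fun z hz h => limit_frame h (fun n => (hF (φ n)).ortho z hz) fun n => (hF (φ n)).f_eq z hz
  have hae := ae_tendsto_slab (fun n => (hu (φ n)).prodMk ((he (φ n)).prodMk (hf (φ n)))) hZ hlimZ
  have hs := ae_restrict_mem (μ := volume) (slab T).isOpen.measurableSet
  have m1 : StronglyMeasurable fun z => (Z z).1 := continuous_fst.comp_stronglyMeasurable hZ
  have m2 : StronglyMeasurable fun z => (Z z).2.1 :=
    (continuous_fst.comp continuous_snd).comp_stronglyMeasurable hZ
  have ci : ∀ i, Continuous fun v : E3 => v i := fun i => by fun_prop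
  refine ⟨fun z => (Z z).1, fun z => (Z z).2.1, isFrameSolution_of_frameReg hq
    m1.aestronglyMeasurable m2.aestronglyMeasurable (fun t ht => (hlimZ t ht).mono fun x hx =>
      (comp (t, x) ⟨ht, mem_univ _⟩ hx).1)
    (hcZ.of_norm_sub_le (ContinuousLinearMap.fst ℝ _ _) fun v => norm_fst_le v)
    (hcZ.of_norm_sub_le ((ContinuousLinearMap.fst ℝ _ _).comp (ContinuousLinearMap.snd ℝ _ _))
      fun v => (norm_fst_le v.2).trans (norm_snd_le v)) fun i => ?_⟩
  refine FrameReg.of_tendsto (qk := fun n => qk (ψ (φ n))) hq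
    (fun n => (hqk _).1.continuousOn)
    (fun K hK hKT => (hlim K hK hKT).comp (hψ.comp hφ).tendsto_atTop)
    (fun n => (hrow (φ n) i).frameReg (hqk _).1)
    (fun n => hs.mono fun z hz => (hrow (φ n) i).abs_le hz)
    ((ci i).comp_stronglyMeasurable m1).aestronglyMeasurable
    ((ci i).comp_stronglyMeasurable m2).aestronglyMeasurable
    ((ci i).comp_stronglyMeasurable (continuous_cross.comp_stronglyMeasurable
      (m1.prodMk m2))).aestronglyMeasurable
    ?_ ?_ ?_
  · filter_upwards [hae] with z hz
    exact ((ci i).tendsto _).comp hz.fst_nhds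
  · filter_upwards [hae] with z hz
    exact ((ci i).tendsto _).comp hz.snd_nhds.fst_nhds
  · filter_upwards [hae, hs] with z hz hzs
    rw [← (comp z hzs hz).2]
    exact ((ci i).tendsto _).comp hz.snd_nhds.snd_nhds

end Existence

end

theorem theorem3p2 (T : ℝ) (hT : 0 < T) (q : ℝ × ℝ → ℂ)
    (hq : MemL2L2loc T q)
    (hq2 : l2HNegOneNorm T (fun z => ‖q z‖ ^ 2) < ⊤)
    (qk : ℕ → ℝ × ℝ → ℂ)
    (hqk : ∀ k, IsSmoothNLS T (qk k))
    (hlim : ∀ K : Set (ℝ × ℝ), IsCompact K → K ⊆ slab T →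
      Tendsto (fun k => eLpNorm (fun z => qk k z - q z) 2 (volume.restrict K)) atTop (𝓝 0))
    (hlim2 : ∀ S, 0 < S → S < T →
      Tendsto (fun k => l2HNegOneNorm S (fun z => ‖qk k z‖ ^ 2 - ‖q z‖ ^ 2)) atTop (𝓝 0)) :
    (∃ u e : ℝ × ℝ → E3, IsWeakSchrodingerMap T u ∧ IsFrameSolution T q u e) ∧
    ∀ u e u' e' : ℝ × ℝ → E3, IsFrameSolution T q u e → IsFrameSolution T q u' e' →
      ∃ ρ : E3 ≃ₗᵢ[ℝ] E3, LinearMap.det (ρ.toLinearEquiv : E3 →ₗ[ℝ] E3) = 1 ∧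
        ∀ t ∈ Ioo (-T) T, ∀ᵐ x : ℝ, u' (t, x) = ρ (u (t, x)) ∧ e' (t, x) = ρ (e (t, x)) :=
  ⟨exists_isFrameSolution hT hq hqk hlim,
    fun _ _ _ _ h h' => IsFrameSolution.exists_rotation hT hq h h'⟩
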